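/- Let $a,b,s\in\mathbb{R}$ with $s\neq 0$, $c\in L^2(0,1)$ and $\delta>0$. Consider the cascade $$\partial_t y=\partial_{xx}y+ay,\quad \partial_t z=\partial_{xx}z+bz,\quad \partial_x y(t,0)=s\,z(t,0),\quad y(t,1)=\partial_x z(t,1)=0,\quad \partial_x z(t,0)=u(t),$$ for $t>0$, $x\in(0,1)$, with initial data $y_0,z_0\in L^2(0,1)$, control $u$ and measurement $y_m(t)=\int_0^1 c(x)y(t,x)\,dx$. Notation. For $n,m\in\mathbb{N}=\{0,1,\dots\}$ put $\lambda_{1,n}=a-(n+\tfrac12)^2\pi^2$, $\lambda_{2,m}=b-m^2\pi^2$, $\mu_0=1$, $\mu_m=\sqrt2$ for $m\ge1$, $$\Delta=\{(n,m)\in\mathbb{N}^2 : 4(b-a)=(4m^2-(2n+1)^2)\pi^2\},$$ $$\Theta=\{n\in\mathbb{N} : \exists k\in\mathbb{N},\ 4(b-a)=((2k+1)^2-(2n+1)^2)\pi^2\}.$$ Let $\phi_{1,n}(x)=\sqrt2\cos((n+\frac12)\pi x)$. Let $\phi_{2,m}(x)=\frac{s\mu_m}{(k+1/2)\pi}(1-x)\sin((k+\frac12)\pi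 x)$ if $(k,m)\in\Delta$ for some (necessarily unique) $k$; otherwise $\phi_{2,m}(x)=s\mu_m(x-1)$ if $\lambda_{2,m}=a$, and $\phi_{2,m}(x)=-\frac{s\mu_m}{r\cosh r}\sinh(r(1-x))$ with $r^2=\lambda_{2,m}-a$ if $\lambda_{2,m}\ne a$. Let $\psi_{2,m}(x)=\mu_m\cos(m\pi x)$. Let $\psi_{1,n}(x)=-\frac{\sqrt2 s}{r\sinh r}\cosh(r(1-x))$ with $r^2=\lambda_{1,n}-b$ if $(n,k)\notin\Delta$ for all $k$; if $(n,0)\in\Delta$ let $\psi_{1,n}(x)=-\sqrt2 s\big(\frac13+\frac1{(2n+1)^2\pi^2}\big)+\sqrt2 s x-\frac{\sqrt2}{2}s x^2$; and if $(n,k)\in\Delta$ with $k\ge1$ let $\psi_{1,n}(x)=\frac{\sqrt2 s}{k\pi}(1-x)\sin(k\pi x)-\frac{2s}{\pi^2}\big(\frac1{(2n+1)^2}+\frac1{4k^2}\big)\sqrt2\cos(k\pi x)$. (Complex $r$ is allowed; all these functions are real-valued.) With $\varphi(x)=x-x^2/2$, $\alpha=\varphi''+b\varphi$, $\beta=-\varphi$,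 put $\alpha_{i,k}=\int_0^1\alpha\psi_{i,k}$, $\beta_{i,k}=\int_0^1\beta\psi_{i,k}$, $c_{i,k}=\int_0^1 c\,\phi_{i,k}$. Let $N_0,M_0\ge0$ be integers with $\lambda_{1,N_0+1}<-\delta$, $\lambda_{2,M_0+1}<-\delta$, and $n\le N_0$, $m\le M_0$ for all $(n,m)\in\Delta$. Index $\mathbb{R}^{N_0+M_0+2}$ by the modes $(1,n)$, $0\le n\le N_0$, and $(2,m)$, $0\le m\le M_0$. Let $A_1$ be the matrix with diagonal entries $\lambda_{1,n},\lambda_{2,m}$, with entry $-\sqrt2 s\mu_m$ in row $(1,n)$ and column $(2,m)$ for each $(n,m)\in\Delta$, and zeros elsewhere; let $B_{1,u}=(\alpha_{i,k})$, $B_{1,v}=(\beta_{i,k})$ (columns), $C_1=(c_{i,k})$ (row), and $$A_{1,a}=\begin{bmatrix}A_1&B_{1,u}\\0&0\end{bmatrix},\qquad B_{1,a}=\begin{bmatrix}B_{1,v}\\1\end{bmatrix}.$$ Assume $\Theta\cap\{0,\dots,N_0\}=\emptyset$ (controllability), and $c_{1,n}\ne0$ for all $0\le n\le N_0$ and $c_{2,m}\neq0$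 for all $0\le m\le M_0$ such that $(k,m)\notin\Delta$ for every $k$ (observability of $(A_1,C_1)$). Let $K=[K_x\ k_u]\in\mathbb{R}^{1\times(N_0+M_0+3)}$ and $L\in\mathbb{R}^{N_0+M_0+2}$ be such that all eigenvalues of $A_{1,a}-B_{1,a}K$ and of $A_1-LC_1$ have real part less than $-\delta$. For integers $N\ge N_0$, $M\ge M_0$ consider the output feedback $$\dot u=v,\qquad v=-K_x\hat X_1-k_u u,$$ $$\dot{\hat X}_1=A_1\hat X_1+B_{1,u}u+B_{1,v}v-L\Big(C_1\hat X_1+\sum_{n=N_0+1}^N c_{1,n}\hat x_{1,n}+\sum_{m=M_0+1}^M c_{2,m}\hat x_{2,m}-y_m\Big),$$ $$\dot{\hat x}_{1,n}=\lambda_{1,n}\hat x_{1,n}+\alpha_{1,n}u+\beta_{1,n}v\ (N_0<n\le N),\qquad \dot{\hat x}_{2,m}=\lambda_{2,m}\hat x_{2,m}+\alpha_{2,m}u+\beta_{2,m}v\ (M_0<m\le M).$$ Then for all sufficiently large $N$ and $M$ there is $C>0$ such that, for all initial data $y_0,z_0\in L^2(0,1)$, $u(0)=u_0\in\mathbb{R}$,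 $\hat X_1(0)\in\mathbb{R}^{N_0+M_0+2}$, $\hat x_{1,n}(0),\hat x_{2,m}(0)\in\mathbb{R}$, the (weak) solutions of the closed loop satisfy, for every $t\ge0$, $$\|(y,z)(t)\|_Y^2+u(t)^2+\|\hat X_1(t)\|^2+\sum_{n=N_0+1}^N\hat x_{1,n}(t)^2+\sum_{m=M_0+1}^M\hat x_{2,m}(t)^2$$ $$\le Ce^{-2\delta t}\Big(\|(y_0,z_0)\|_Y^2+u_0^2+\|\hat X_1(0)\|^2+\sum_{n=N_0+1}^N\hat x_{1,n}(0)^2+\sum_{m=M_0+1}^M\hat x_{2,m}(0)^2\Big)$$ with $Y=L^2(0,1)\times L^2(0,1)$. If moreover $y_0,z_0\in H^2(0,1)$ with $y_0(1)=z_0'(1)=0$, $y_0'(0)=s z_0(0)$ and $z_0'(0)=u_0$, then $(y,z)(t)\in Y$ for all $t\geq 0$ and the same estimate holds with $Y=\{f\in H^1(0,1): f(1)=0\}\times H^1(0,1)$, $\|(f,g)\|_Y^2=\int_0^1 (f'^2+g^2+g'^2)\,dx$. -/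

import Mathlib

open MeasureTheory Set
open scoped ContDiff

noncomputable section

namespace HeatCascade

/-! ### Function spaces on the interval (0,1) -/

/-- The real Hilbert space `L²(0,1)`. -/
abbrev L2I : Type := Lp ℝ 2 (volume.restrict (Ioo (0 : ℝ) 1))

/-- `∫₀¹ f(x) g(x) dx`. -/
def pairing (f g : ℝ → ℝ) : ℝ := ∫ x in Ioo (0 : ℝ) 1, f x * g x

/-- `f ∈ H¹(0,1)` with continuous representative `F` (on `[0,1]`) and weak derivative `g ∈ L²(0,1)`:
`F` is absolutely continuous on `[0,1]` with almost everywhere derivative `g`. Boundary values of `f`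
are those of `F`. -/
structure IsH1 (f : L2I) (F : ℝ → ℝ) (g : L2I) : Prop where
  ae_eq : ∀ᵐ x ∂(volume.restrict (Ioo (0 : ℝ) 1)), f x = F x
  ftc : ∀ x ∈ Icc (0 : ℝ) 1, F x = F 0 + ∫ t in (0 : ℝ)..x, g t

/-- `(y, z)` lies in `ℋ¹ = {f ∈ H¹(0,1) | f(1) = 0} × H¹(0,1)` and
`r = ∫₀¹ (y')² + z² + (z')²` is the square of its norm there. -/
def HasH1NormSq (y z : L2I) (r : ℝ) : Prop :=
  ∃ (Y Z : ℝ → ℝ) (dy dz : L2I), IsH1 y Y dy ∧ Y 1 = 0 ∧ IsH1 z Z dz ∧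
    r = ‖dy‖ ^ 2 + ‖z‖ ^ 2 + ‖dz‖ ^ 2

/-- `y₀, z₀ ∈ H²(0,1)` with `y₀(1) = z₀'(1) = 0`, `y₀'(0) = s z₀(0)` and `z₀'(0) = u₀`. -/
def CompatibleH2 (s : ℝ) (y₀ z₀ : L2I) (u₀ : ℝ) : Prop :=
  ∃ (Y Y' Z Z' : ℝ → ℝ) (dy ddy dz ddz : L2I),
    IsH1 y₀ Y dy ∧ IsH1 dy Y' ddy ∧ IsH1 z₀ Z dz ∧ IsH1 dz Z' ddz ∧
    Y 1 = 0 ∧ Z' 1 = 0 ∧ Y' 0 = s * Z 0 ∧ Z' 0 = u₀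

/-! ### The heat-heat cascade -/

/-- Smooth test pairs: they satisfy the boundary conditions of the adjoint operator,
`f(1) = f'(0) = g'(1) = 0` and `g'(0) = s f(0)`. -/
structure IsTestPair (s : ℝ) (f g : ℝ → ℝ) : Prop where
  smooth_fst : ContDiff ℝ ∞ f
  smooth_snd : ContDiff ℝ ∞ g
  fst_one : f 1 = 0
  deriv_fst_zero : deriv f 0 = 0
  deriv_snd_one : deriv g 1 = 0
  deriv_snd_zero : deriv g 0 = s * f 0

/-- `(y, z) ∈ C([0,∞); L²(0,1)²)` is the (weak, equivalently mild) solution, with boundary input `u`, of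
`∂ₜy = ∂ₓₓy + a y`, `∂ₜz = ∂ₓₓz + b z`, `∂ₓy(t,0) = s z(t,0)`, `y(t,1) = ∂ₓz(t,1) = 0`,
`∂ₓz(t,0) = u(t)`. The weak formulation is obtained by multiplying by a test pair and integrating
by parts twice in space: the only boundary term that remains is `-u(t) g(0)`. -/
structure IsWeakSolution (a b s : ℝ) (u : ℝ → ℝ) (y z : ℝ → L2I) : Prop where
  cont_fst : ContinuousOn y (Ici 0)
  cont_snd : ContinuousOn z (Ici 0)
  weak : ∀ f g : ℝ → ℝ, IsTestPair s f g → ∀ t : ℝ, 0 ≤ t →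
    pairing (y t) f + pairing (z t) g = pairing (y 0) f + pairing (z 0) g +
      ∫ τ in (0 : ℝ)..t,
        (pairing (y τ) (fun x => deriv (deriv f) x + a * f x)
          + pairing (z τ) (fun x => deriv (deriv g) x + b * g x) - u τ * g 0)

/-! ### Spectral data -/

/-- `λ₁ₙ = a - (n + 1/2)² π²`. -/
def lam1 (a : ℝ) (n : ℕ) : ℝ := a - ((n : ℝ) + 1 / 2) ^ 2 * Real.pi ^ 2

/-- `λ₂ₘ = b - m² π²`. -/
def lam2 (b : ℝ) (m : ℕ) : ℝ := b - (m : ℝ) ^ 2 * Real.pi ^ 2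

/-- `Δ(a,b)`: the pairs `(n,m)` with `λ₁ₙ = λ₂ₘ`. -/
def Delta (a b : ℝ) : Set (ℕ × ℕ) :=
  {p | 4 * (b - a) = (4 * (p.2 : ℝ) ^ 2 - (2 * (p.1 : ℝ) + 1) ^ 2) * Real.pi ^ 2}

/-- `Θ(a,b)`: the indices of the uncontrollable modes. -/
def Theta (a b : ℝ) : Set ℕ :=
  {n | ∃ k : ℕ, 4 * (b - a) = ((2 * (k : ℝ) + 1) ^ 2 - (2 * (n : ℝ) + 1) ^ 2) * Real.pi ^ 2}

/-- `μ₀ = 1` and `μₘ = √2` for `m ≥ 1`. -/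
def mu (m : ℕ) : ℝ := if m = 0 then 1 else Real.sqrt 2

/-- First component of the eigenvector `φ₁ₙ` (the second one is zero). -/
def phi1 (n : ℕ) (x : ℝ) : ℝ := Real.sqrt 2 * Real.cos (((n : ℝ) + 1 / 2) * Real.pi * x)

open Classical in
/-- First component of the (generalized) eigenvector `φ₂ₘ`. Outside resonance, and with
`r² = λ₂ₘ - a ≠ 0`, it is `- s μₘ sinh(r(1-x)) / (r cosh r)`; for `r = iρ` this is
`- s μₘ sin(ρ(1-x)) / (ρ cos ρ)`. -/
def phi2 (a b s : ℝ) (m : ℕ) (x : ℝ) : ℝ :=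
  if h : ∃ k : ℕ, (k, m) ∈ Delta a b then
    s * mu m / (((h.choose : ℝ) + 1 / 2) * Real.pi) * (1 - x)
      * Real.sin (((h.choose : ℝ) + 1 / 2) * Real.pi * x)
  else if lam2 b m - a = 0 then s * mu m * (-1 + x)
  else if 0 < lam2 b m - a then
    -(s * mu m / (Real.sqrt (lam2 b m - a) * Real.cosh (Real.sqrt (lam2 b m - a))))
      * Real.sinh (Real.sqrt (lam2 b m - a) * (1 - x))
  else
    -(s * mu m / (Real.sqrt (a - lam2 b m) * Real.cos (Real.sqrt (a - lam2 b m))))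
      * Real.sin (Real.sqrt (a - lam2 b m) * (1 - x))

open Classical in
/-- Second component of the element `ψ₁ₙ` of the dual Riesz basis. Outside resonance, and with
`r² = λ₁ₙ - b ≠ 0`, it is `- √2 s cosh(r(1-x)) / (r sinh r)`; for `r = iρ` this is
`√2 s cos(ρ(1-x)) / (ρ sin ρ)`. -/
def psi1 (a b s : ℝ) (n : ℕ) (x : ℝ) : ℝ :=
  if h : ∃ k : ℕ, (n, k) ∈ Delta a b then
    if h.choose = 0 then
      -(s * Real.sqrt 2 * (1 / 3 + 1 / ((2 * (n : ℝ) + 1) ^ 2 * Real.pi ^ 2)))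
        + Real.sqrt 2 * s * x - Real.sqrt 2 / 2 * s * x ^ 2
    else
      Real.sqrt 2 * s / ((h.choose : ℝ) * Real.pi) * (1 - x)
          * Real.sin ((h.choose : ℝ) * Real.pi * x)
        + -(2 * s / Real.pi ^ 2 * (1 / (2 * (n : ℝ) + 1) ^ 2 + 1 / (4 * (h.choose : ℝ) ^ 2)))
          * Real.sqrt 2 * Real.cos ((h.choose : ℝ) * Real.pi * x)
  else if 0 < lam1 a n - b then
    -(Real.sqrt 2 * s / (Real.sqrt (lam1 a n - b) * Real.sinh (Real.sqrt (lam1 a n - b))))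
      * Real.cosh (Real.sqrt (lam1 a n - b) * (1 - x))
  else
    Real.sqrt 2 * s / (Real.sqrt (b - lam1 a n) * Real.sin (Real.sqrt (b - lam1 a n)))
      * Real.cos (Real.sqrt (b - lam1 a n) * (1 - x))

/-- Second component of the element `ψ₂ₘ` of the dual Riesz basis (the first one is zero):
`1` for `m = 0` and `√2 cos(mπx)` for `m ≥ 1`. -/
def psi2 (m : ℕ) (x : ℝ) : ℝ := mu m * Real.cos ((m : ℝ) * Real.pi * x)

/-- `α = φ'' + b φ` for the lifting function `φ(x) = x - x²/2`. -/
def alpha (b : ℝ) (x : ℝ) : ℝ := -1 + b * (x - x ^ 2 / 2)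

/-- `β = -φ` for the lifting function `φ(x) = x - x²/2`. -/
def beta (x : ℝ) : ℝ := -(x - x ^ 2 / 2)

/-- `α₁ₙ = ⟨(0,α), ψ₁ₙ⟩`. -/
def alpha1 (a b s : ℝ) (n : ℕ) : ℝ := pairing (alpha b) (psi1 a b s n)

/-- `α₂ₘ = ⟨(0,α), ψ₂ₘ⟩`. -/
def alpha2 (b : ℝ) (m : ℕ) : ℝ := pairing (alpha b) (psi2 m)

/-- `β₁ₙ = ⟨(0,β), ψ₁ₙ⟩`. -/
def beta1 (a b s : ℝ) (n : ℕ) : ℝ := pairing beta (psi1 a b s n)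

/-- `β₂ₘ = ⟨(0,β), ψ₂ₘ⟩`. -/
def beta2 (m : ℕ) : ℝ := pairing beta (psi2 m)

/-- `c₁ₙ = ∫₀¹ c φ₁ₙ¹`. -/
def c1 (c : L2I) (n : ℕ) : ℝ := pairing c (phi1 n)

/-- `c₂ₘ = ∫₀¹ c φ₂ₘ¹`. -/
def c2 (a b s : ℝ) (c : L2I) (m : ℕ) : ℝ := pairing c (phi2 a b s m)

/-! ### The truncated model -/

/-- Index set of the modes `λ₁₀, …, λ₁,N₀` (left) and `λ₂₀, …, λ₂,M₀` (right). -/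
abbrev Idx (N₀ M₀ : ℕ) : Type := Fin (N₀ + 1) ⊕ Fin (M₀ + 1)

open Classical in
/-- The matrix `A₁` of the dynamics of these modes: the eigenvalues on the diagonal, and the entry
`-√2 s μₘ` at `(n, m)` for each `(n,m) ∈ Δ(a,b)`. -/
def A₁ (a b s : ℝ) (N₀ M₀ : ℕ) : Matrix (Idx N₀ M₀) (Idx N₀ M₀) ℝ :=
  Matrix.fromBlocks
    (Matrix.diagonal fun n => lam1 a n)
    (Matrix.of fun n m => if ((n : ℕ), (m : ℕ)) ∈ Delta a b then -(Real.sqrt 2 * s * mu m) else 0)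
    0
    (Matrix.diagonal fun m => lam2 b m)

/-- The vector `B₁ᵤ`. -/
def B₁u (a b s : ℝ) (N₀ M₀ : ℕ) : Idx N₀ M₀ → ℝ :=
  Sum.elim (fun n => alpha1 a b s n) (fun m => alpha2 b m)

/-- The vector `B₁ᵥ`. -/
def B₁v (a b s : ℝ) (N₀ M₀ : ℕ) : Idx N₀ M₀ → ℝ :=
  Sum.elim (fun n => beta1 a b s n) (fun m => beta2 m)

/-- The row vector `C₁`. -/
def C₁ (a b s : ℝ) (c : L2I) (N₀ M₀ : ℕ) : Idx N₀ M₀ → ℝ :=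
  Sum.elim (fun n => c1 c n) (fun m => c2 a b s c m)

/-- `A₁ₐ = [A₁ B₁ᵤ; 0 0]`. -/
def A₁a (a b s : ℝ) (N₀ M₀ : ℕ) : Matrix (Idx N₀ M₀ ⊕ Unit) (Idx N₀ M₀ ⊕ Unit) ℝ :=
  Matrix.fromBlocks (A₁ a b s N₀ M₀) (Matrix.of fun i _ => B₁u a b s N₀ M₀ i) 0 0

/-- `B₁ₐ = [B₁ᵥ; 1]`. -/
def B₁a (a b s : ℝ) (N₀ M₀ : ℕ) : Idx N₀ M₀ ⊕ Unit → ℝ :=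
  Sum.elim (B₁v a b s N₀ M₀) (fun _ => 1)

/-- All (complex) eigenvalues of the real square matrix `A` have real part less than `-δ`. -/
def SpectralAbscissaLT {ι : Type} [Fintype ι] [DecidableEq ι] (A : Matrix ι ι ℝ) (δ : ℝ) : Prop :=
  ∀ w ∈ spectrum ℂ (A.map (Complex.ofReal)), w.re < -δ

/-! ### The closed loop -/

/-- The controller
`u' = v`, `v = -Kₓ X̂₁ - kᵤ u`,
`X̂₁' = A₁ X̂₁ + B₁ᵤ u + B₁ᵥ v - L (C₁ X̂₁ + ∑_{N₀<n≤N} c₁ₙ x̂₁ₙ + ∑_{M₀<m≤M} c₂ₘ x̂₂ₘ - yₘ)`,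
`x̂₁ₙ' = λ₁ₙ x̂₁ₙ + α₁ₙ u + β₁ₙ v` for `N₀ < n ≤ N`,
`x̂₂ₘ' = λ₂ₘ x̂₂ₘ + α₂ₘ u + β₂ₘ v` for `M₀ < m ≤ M`,
driven by the measurement `yₘ(t)`, on `t ≥ 0`. -/
structure IsControllerTrajectory (a b s : ℝ) (c : L2I) (N₀ M₀ N M : ℕ)
    (Kx : Idx N₀ M₀ → ℝ) (ku : ℝ) (L : Idx N₀ M₀ → ℝ) (ym : ℝ → ℝ)
    (u v : ℝ → ℝ) (X : ℝ → Idx N₀ M₀ → ℝ) (x1 x2 : ℕ → ℝ → ℝ) : Prop where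
  feedback : ∀ t : ℝ, 0 ≤ t → v t = -(Kx ⬝ᵥ X t) - ku * u t
  deriv_u : ∀ t : ℝ, 0 ≤ t → HasDerivWithinAt u (v t) (Ici 0) t
  deriv_X : ∀ t : ℝ, 0 ≤ t → HasDerivWithinAt X
    (Matrix.mulVec (A₁ a b s N₀ M₀) (X t) + u t • B₁u a b s N₀ M₀ + v t • B₁v a b s N₀ M₀
      - (C₁ a b s c N₀ M₀ ⬝ᵥ X t + ∑ n ∈ Finset.Ioc N₀ N, c1 c n * x1 n t
          + ∑ m ∈ Finset.Ioc M₀ M, c2 a b s c m * x2 m t - ym t) • L) (Ici 0) t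
  deriv_x1 : ∀ n ∈ Finset.Ioc N₀ N, ∀ t : ℝ, 0 ≤ t → HasDerivWithinAt (x1 n)
    (lam1 a n * x1 n t + alpha1 a b s n * u t + beta1 a b s n * v t) (Ici 0) t
  deriv_x2 : ∀ m ∈ Finset.Ioc M₀ M, ∀ t : ℝ, 0 ≤ t → HasDerivWithinAt (x2 m)
    (lam2 b m * x2 m t + alpha2 b m * u t + beta2 m * v t) (Ici 0) t

/-- A solution of the cascade in closed loop with the controller, for the measurement
`yₘ(t) = ∫₀¹ c(x) y(t,x) dx`. -/
structure IsClosedLoopSolution (a b s : ℝ) (c : L2I) (N₀ M₀ N M : ℕ)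
    (Kx : Idx N₀ M₀ → ℝ) (ku : ℝ) (L : Idx N₀ M₀ → ℝ) (y z : ℝ → L2I)
    (u v : ℝ → ℝ) (X : ℝ → Idx N₀ M₀ → ℝ) (x1 x2 : ℕ → ℝ → ℝ) : Prop where
  plant : IsWeakSolution a b s u y z
  controller : IsControllerTrajectory a b s c N₀ M₀ N M Kx ku L
    (fun t => pairing c (y t)) u v X x1 x2

/-- `u(t)² + ‖X̂₁(t)‖² + ∑_{N₀<n≤N} x̂₁ₙ(t)² + ∑_{M₀<m≤M} x̂₂ₘ(t)²`. -/
def controllerNormSq (N₀ M₀ N M : ℕ) (u : ℝ → ℝ) (X : ℝ → Idx N₀ M₀ → ℝ)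
    (x1 x2 : ℕ → ℝ → ℝ) (t : ℝ) : ℝ :=
  u t ^ 2 + ∑ i, X t i ^ 2 + ∑ n ∈ Finset.Ioc N₀ N, x1 n t ^ 2 + ∑ m ∈ Finset.Ioc M₀ M, x2 m t ^ 2

end HeatCascade

end

/-! Testing the weak formulation against the pairs (`phi1 n`, `psi1 n`) and (0, `psi2 m`) turns the
plant into scalar equations. They are coupled only along Δ, hence only among the low modes. Adding
`u * beta` to the second component replaces the boundary term by the inputs `α u + β v`, so that
`lowModes` solves exactly the finite system given by `A₁`, `B₁u` and `B₁v`.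

The observer is driven by a measurement that differs from the output of the low modes in two ways.
The errors on the modes between the two truncation levels solve free stable equations and are
harmless. The modes above `N` and `M` are ignored by the observer and react to the control. If `|u|`
and `|v|` are at most `U e^{-δt}`, such a mode is at most `e^{-δt}` times its initial value plus a
constant times `U/(n+1)²`, because the spectral gaps grow quadratically (`exists_gap1`,
`exists_gap2`). The output coefficients are square summable, so together these modes contribute
initial data plus a multiple of `tailGain` times `U`, and `tailGain` tends to zero.

This gives a small-gain argument. The separation principle for the finite-dimensional loop
(`exists_observer_feedback_bound`) yields `U ≤ κ (initial data + small · U)`, and for large `N`, `M`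
the last term is absorbed (`exists_lowModes_decay`). All estimates are in the supremum norm with
weight `e^{δt}` on `[0, T]`, with constants independent of `T`. No rate is lost, since every
eigenvalue involved lies strictly to the left of `-δ`.

Two facts link the modes with the infinite-dimensional state. The measurement is the sum of its
modal contributions (`exists_measurement`), which follows from Parseval for two cosine systems and
from `biorthogonal`, without any Riesz basis theory. Conversely, `z` is read off from its cosine
coefficients, and those of `y` differ from the modal coordinates by pairings of `z` with `psi1 n`.
These pairings are `O(1/n)` in `L²` and `O(1/n²)` for `z` in `H¹`, which gives decay in `L²`
(`exists_L2_decay`) and, after multiplication by the frequencies, in `H¹` (`exists_H1_decay`). -/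

namespace HeatCascade

/-! ### Scalar equations in exponentially weighted norms -/

/-- A forced scalar equation whose rate is faster than the decay rate of the forcing term. -/
theorem norm_le_of_scalar_ode {E : Type*} [NormedAddCommGroup E] [NormedSpace ℂ E]
    {w : ℂ} {δ G T : ℝ} (hw : w.re < -δ) {x g : ℝ → E}
    (hx : ∀ t, 0 ≤ t → t ≤ T → HasDerivWithinAt x (w • x t + g t) (Ici 0) t)
    (hg : ∀ t, 0 ≤ t → t ≤ T → ‖g t‖ ≤ G * Real.exp (-δ * t)) {t : ℝ} (ht : 0 ≤ t) (htT : t ≤ T) :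
    ‖x t‖ ≤ Real.exp (-δ * t) * (‖x 0‖ + G / (-w.re - δ)) := by
  set ε : ℝ := -w.re - δ with hε
  have hε0 : 0 < ε := by rw [hε]; linarith
  have hG : 0 ≤ G := by
    have h := hg 0 le_rfl (ht.trans htT)
    have h0 := norm_nonneg (g 0)
    simp at h; linarith
  have hexp : ∀ t : ℝ, HasDerivAt (fun t : ℝ => Complex.exp (-w * t)) (Complex.exp (-w * t) * -w) t := by
    intro t
    have h1 : HasDerivAt (fun t : ℝ => -w * (t : ℂ)) (-w * ((1 : ℝ) : ℂ)) t :=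
      (HasDerivAt.ofReal_comp (hasDerivAt_id t)).const_mul (-w)
    simpa using h1.cexp
  have hnexp : ∀ t : ℝ, ‖Complex.exp (-w * t)‖ = Real.exp (-w.re * t) := by
    intro t
    rw [Complex.norm_exp]; simp
  -- The integrating factor removes `w`; what is left has norm at most `G e^{εt}`.
  have hd : ∀ t, 0 ≤ t → t ≤ T → HasDerivWithinAt (fun t : ℝ => Complex.exp (-w * t) • x t)
      (Complex.exp (-w * t) • g t) (Ici 0) t := by
    intro t h0 h1
    have h := (hexp t).hasDerivWithinAt (s := Ici 0) |>.smul (hx t h0 h1)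
    refine h.congr_deriv ?_
    rw [smul_add, smul_smul, add_right_comm, ← add_smul]
    ring_nf
    simp
  -- The comparison function is the primitive of `G e^{εt}` that equals `‖x 0‖` at time 0. Dividing
  -- it by `e^{εt}` leaves `‖x 0‖ + G/ε`, with no loss in the rate because `ε > 0`.
  have hB : ∀ t : ℝ, HasDerivAt (fun t : ℝ => ‖x 0‖ + G * (Real.exp (ε * t) - 1) / ε)
      (G * Real.exp (ε * t)) t := by
    intro t
    have h1 : HasDerivAt (fun t : ℝ => Real.exp (ε * t)) (Real.exp (ε * t) * (ε * 1)) t :=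
      ((hasDerivAt_id t).const_mul ε).exp
    have h2 := (((h1.sub_const 1).const_mul G).div_const ε).const_add ‖x 0‖
    refine h2.congr_deriv ?_
    field_simp
  have key := image_norm_le_of_norm_deriv_right_le_deriv_boundary (a := 0) (b := T)
    (f := fun t : ℝ => Complex.exp (-w * t) • x t)
    (f' := fun t => Complex.exp (-w * t) • g t)
    (fun t h => (hd t h.1 h.2).continuousWithinAt.mono Icc_subset_Ici_self)
    (fun t h => (hd t h.1 h.2.le).mono (Ici_subset_Ici.2 h.1))
    (B := fun t : ℝ => ‖x 0‖ + G * (Real.exp (ε * t) - 1) / ε)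
    (B' := fun t => G * Real.exp (ε * t)) (by simp) hB
    (fun t h => by
      rw [norm_smul, hnexp]
      calc _ ≤ Real.exp (-w.re * t) * (G * Real.exp (-δ * t)) :=
            mul_le_mul_of_nonneg_left (hg t h.1 h.2.le) (Real.exp_pos _).le
        _ = G * Real.exp (ε * t) := by
            rw [mul_left_comm, ← Real.exp_add, hε]; ring_nf) (x := t) ⟨ht, htT⟩
  simp only [norm_smul, hnexp] at key
  have e1 : Real.exp (-w.re * t) = Real.exp (ε * t) * Real.exp (δ * t) := by
    rw [← Real.exp_add, hε]; ring_nf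
  have e2 : Real.exp (-δ * t) = (Real.exp (δ * t))⁻¹ := by
    rw [← Real.exp_neg]; ring_nf
  have h1 : 1 ≤ Real.exp (ε * t) := Real.one_le_exp (by positivity)
  have hp := Real.exp_pos (δ * t)
  have hq := Real.exp_pos (ε * t)
  rw [e1] at key
  rw [e2, inv_mul_eq_div, le_div_iff₀ hp]
  have h3 : ‖x 0‖ + G * (Real.exp (ε * t) - 1) / ε ≤ Real.exp (ε * t) * (‖x 0‖ + G / ε) := by
    have : G * (Real.exp (ε * t) - 1) / ε = Real.exp (ε * t) * (G / ε) - G / ε := by ring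
    rw [this]
    have := mul_le_mul_of_nonneg_right h1 (norm_nonneg (x 0))
    have : 0 ≤ G / ε := by positivity
    nlinarith
  have h4 := key.trans h3
  have h5 : Real.exp (ε * t) * (‖x t‖ * Real.exp (δ * t)) ≤ Real.exp (ε * t) * (‖x 0‖ + G / ε) := by
    calc _ = Real.exp (ε * t) * Real.exp (δ * t) * ‖x t‖ := by ring
      _ ≤ _ := h4
  exact le_of_mul_le_mul_left h5 hq

theorem abs_le_of_scalar_ode {w δ G T : ℝ} (hw : w < -δ) {x g : ℝ → ℝ}
    (hx : ∀ t, 0 ≤ t → t ≤ T → HasDerivWithinAt x (w * x t + g t) (Ici 0) t)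
    (hg : ∀ t, 0 ≤ t → t ≤ T → |g t| ≤ G * Real.exp (-δ * t)) {t : ℝ} (ht : 0 ≤ t) (htT : t ≤ T) :
    |x t| ≤ Real.exp (-δ * t) * (|x 0| + G / (-w - δ)) := by
  have := norm_le_of_scalar_ode (w := (w : ℂ)) (x := fun t => (x t : ℂ)) (g := fun t => (g t : ℂ))
    (T := T) (G := G) (by simpa using hw)
    (fun t h0 h1 => by
      have := (hx t h0 h1).ofReal_comp
      refine this.congr_deriv ?_
      push_cast; simp)
    (fun t h0 h1 => by simpa using hg t h0 h1) ht htT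
  simpa using this

/-! ### Forced linear systems with a stable matrix -/

section Matrix

variable {ι : Type} [Fintype ι] [DecidableEq ι]

open Polynomial in
-- Induction on the factors of an annihilating polynomial, which avoids Jordan forms and matrix
-- exponentials. Peel off a factor `X - w` and put `D = A - w`. Since `D` commutes with `A`, `D x`
-- solves the same system with forcing `D h` and is annihilated by the remaining factors, so it
-- decays. Then `x' = w x + (D x + h)` is a scalar equation with decaying forcing. Strictness of
-- `w.re < -δ` absorbs the powers of `t` that repeated roots would produce.
theorem exists_decay_of_aeval_prod_eq_zero (A : Matrix ι ι ℂ) (δ : ℝ) (s : Multiset ℂ)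
    (hs : ∀ w ∈ s, w.re < -δ) :
    ∃ K : ℝ, 0 ≤ K ∧ ∀ (T H : ℝ) (x h : ℝ → ι → ℂ),
      (∀ t, 0 ≤ t → t ≤ T → HasDerivWithinAt x (Matrix.mulVec A (x t) + h t) (Ici 0) t) →
      (∀ t, 0 ≤ t → t ≤ T →
        Matrix.mulVec (aeval A (s.map fun w => X - C w).prod) (x t) = 0) →
      (∀ t, 0 ≤ t → t ≤ T → ‖h t‖ ≤ H * Real.exp (-δ * t)) →
      ∀ t, 0 ≤ t → t ≤ T → ‖x t‖ ≤ K * (‖x 0‖ + H) * Real.exp (-δ * t) := by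
  induction s using Multiset.induction with
  | empty =>
    refine ⟨0, le_rfl, fun T H x h _ h0 _ t ht hT => ?_⟩
    have := h0 t ht hT
    simp at this
    simp [this]
  | cons w s ih =>
    obtain ⟨K, hK, ih⟩ := ih (fun v hv => hs v (Multiset.mem_cons_of_mem hv))
    have hw := hs w (Multiset.mem_cons_self _ _)
    set D : Matrix ι ι ℂ := A - Matrix.scalar ι w with hD
    let ℓ : (ι → ℂ) →L[ℂ] (ι → ℂ) := LinearMap.toContinuousLinearMap (Matrix.mulVecLin D)
    have hℓ : ∀ v, ℓ v = Matrix.mulVec D v := fun v => rfl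
    have hℓn : ∀ v, ‖Matrix.mulVec D v‖ ≤ ‖ℓ‖ * ‖v‖ := fun v => ℓ.le_opNorm v
    have hε : 0 < -w.re - δ := by linarith
    refine ⟨1 + (K * ‖ℓ‖ + 1) / (-w.re - δ), by positivity, fun T H x h hx h0 hh t ht hT => ?_⟩
    have hH : 0 ≤ H := by
      have h1 := hh 0 le_rfl (ht.trans hT)
      have h2 := norm_nonneg (h 0)
      simp at h1; linarith
    have hDA : Commute D A := by
      rw [hD]
      exact (Commute.refl A).sub_left (Matrix.scalar_commute w (fun _ => Commute.all _ _) A)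
    have hsc : ∀ v, Matrix.mulVec A v = w • v + Matrix.mulVec D v := by
      intro v
      rw [hD, Matrix.sub_mulVec]
      simp [Matrix.scalar_apply]
    have hy := ih T (‖ℓ‖ * H) (fun t => Matrix.mulVec D (x t)) (fun t => Matrix.mulVec D (h t))
      (fun t h1 h2 => by
        have h3 := (ℓ.restrictScalars ℝ).hasFDerivAt.comp_hasDerivWithinAt t (hx t h1 h2)
        refine h3.congr_deriv ?_
        change Matrix.mulVec D _ = _
        rw [Matrix.mulVec_add, Matrix.mulVec_mulVec, Matrix.mulVec_mulVec, hDA.eq])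
      (fun t h1 h2 => by
        have := h0 t h1 h2
        rw [Multiset.map_cons, Multiset.prod_cons, mul_comm, map_mul] at this
        have h4 : aeval A (X - C w) = D := by
          simp [hD, Matrix.algebraMap_eq_diagonal]
        rw [h4] at this
        rw [Matrix.mulVec_mulVec]; exact this)
      (fun t h1 h2 => (hℓn _).trans (by
        rw [mul_assoc]; exact mul_le_mul_of_nonneg_left (hh t h1 h2) (norm_nonneg _)))
    have hx2 := norm_le_of_scalar_ode hw (x := x) (g := fun t => Matrix.mulVec D (x t) + h t)
      (G := (K * ‖ℓ‖ + 1) * (‖x 0‖ + H)) (T := T)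
      (fun t h1 h2 => (hx t h1 h2).congr_deriv (by rw [hsc, add_assoc]))
      (fun t h1 h2 => by
        refine (norm_add_le _ _).trans ?_
        have h3 := hy t h1 h2
        have h4 := hh t h1 h2
        have h5 := hℓn (x 0)
        have hp := Real.exp_pos (-δ * t)
        have h6 : K * (‖Matrix.mulVec D (x 0)‖ + ‖ℓ‖ * H) * Real.exp (-δ * t)
            ≤ K * (‖ℓ‖ * ‖x 0‖ + ‖ℓ‖ * H) * Real.exp (-δ * t) := by gcongr
        have h7 : H * Real.exp (-δ * t) ≤ (‖x 0‖ + H) * Real.exp (-δ * t) := by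
          gcongr; linarith [norm_nonneg (x 0)]
        calc _ ≤ K * (‖ℓ‖ * ‖x 0‖ + ‖ℓ‖ * H) * Real.exp (-δ * t) + (‖x 0‖ + H) * Real.exp (-δ * t) :=
              add_le_add (h3.trans h6) (h4.trans h7)
          _ = _ := by ring) ht hT
    refine hx2.trans ?_
    rw [mul_comm]
    gcongr
    have : (1 + (K * ‖ℓ‖ + 1) / (-w.re - δ)) * (‖x 0‖ + H)
      = ‖x 0‖ + H + (K * ‖ℓ‖ + 1) * (‖x 0‖ + H) / (-w.re - δ) := by ring
    rw [this]
    linarith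

/-- Forced linear systems with a Hurwitz matrix, in exponentially weighted supremum norms. -/
theorem SpectralAbscissaLT.exists_decay {A : Matrix ι ι ℝ} {δ : ℝ} (hA : SpectralAbscissaLT A δ) :
    ∃ K : ℝ, 0 ≤ K ∧ ∀ (T H : ℝ) (x h : ℝ → ι → ℝ),
      (∀ t, 0 ≤ t → t ≤ T → HasDerivWithinAt x (Matrix.mulVec A (x t) + h t) (Ici 0) t) →
      (∀ t, 0 ≤ t → t ≤ T → ‖h t‖ ≤ H * Real.exp (-δ * t)) →
      ∀ t, 0 ≤ t → t ≤ T → ‖x t‖ ≤ K * (‖x 0‖ + H) * Real.exp (-δ * t) := by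
  set B : Matrix ι ι ℂ := A.map Complex.ofReal with hB
  obtain ⟨K, hK, h⟩ := exists_decay_of_aeval_prod_eq_zero B δ B.charpoly.roots (fun w hw => by
    apply hA
    rw [Matrix.mem_spectrum_iff_isRoot_charpoly]
    exact Polynomial.isRoot_of_mem_roots hw)
  refine ⟨K, hK, fun T H x g hx hg t ht hT => ?_⟩
  have hnorm : ∀ v : ι → ℝ, ‖fun i => (v i : ℂ)‖ = ‖v‖ := by
    intro v
    simp only [Pi.norm_def]
    congr 2
    ext i; simp
  have key := h T H (fun t i => (x t i : ℂ)) (fun t i => (g t i : ℂ))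
    (fun t h1 h2 => by
      rw [hasDerivWithinAt_pi]
      intro i
      have := ((hasDerivWithinAt_pi.1 (hx t h1 h2)) i).ofReal_comp
      refine this.congr_deriv ?_
      simp [Matrix.mulVec, dotProduct, hB])
    (fun t h1 h2 => by
      -- Over `ℂ` the characteristic polynomial is the product over its roots, so Cayley–Hamilton
      -- supplies the annihilation hypothesis.
      have h3 : (B.charpoly.roots.map fun w => Polynomial.X - Polynomial.C w).prod = B.charpoly :=
        ((IsAlgClosed.splits B.charpoly).eq_prod_roots_of_monic (Matrix.charpoly_monic B)).symm
      rw [h3, Matrix.aeval_self_charpoly, Matrix.zero_mulVec])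
    (fun t h1 h2 => by rw [hnorm]; exact hg t h1 h2) t ht hT
  rwa [hnorm, hnorm] at key

end Matrix

/-! ### Continuous functions in `L²(0,1)` -/

theorem memLp_of_continuous {f : ℝ → ℝ} (hf : Continuous f) :
    MemLp f 2 (volume.restrict (Ioo (0 : ℝ) 1)) := by
  obtain ⟨C, hC⟩ := isCompact_Icc.exists_bound_of_continuousOn (s := Icc (0 : ℝ) 1) hf.continuousOn
  refine MemLp.of_bound hf.aestronglyMeasurable C ?_
  filter_upwards [ae_restrict_mem measurableSet_Ioo] with x hx
  exact hC x (Ioo_subset_Icc_self hx)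

open Classical in
/-- The class in `L²(0,1)` of a square integrable function. -/
noncomputable def toL2 (f : ℝ → ℝ) : L2I :=
  if h : MemLp f 2 (volume.restrict (Ioo (0 : ℝ) 1)) then h.toLp f else 0

theorem coeFn_toL2 {f : ℝ → ℝ} (hf : Continuous f) :
    ∀ᵐ x ∂(volume.restrict (Ioo (0 : ℝ) 1)), toL2 f x = f x := by
  rw [toL2, dif_pos (memLp_of_continuous hf)]
  exact MemLp.coeFn_toLp _

theorem integral_Ioo_eq (f : ℝ → ℝ) : ∫ x in Ioo (0 : ℝ) 1, f x = ∫ x in (0 : ℝ)..1, f x := by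
  rw [intervalIntegral.integral_of_le zero_le_one, integral_Ioc_eq_integral_Ioo]

theorem pairing_eq_intervalIntegral (f g : ℝ → ℝ) :
    pairing f g = ∫ x in (0 : ℝ)..1, f x * g x := integral_Ioo_eq _

theorem pairing_comm (f g : ℝ → ℝ) : pairing f g = pairing g f := by
  simp only [pairing, mul_comm]

theorem inner_eq_pairing (f g : L2I) : inner ℝ f g = pairing f g := by
  rw [L2.inner_def, pairing]
  refine integral_congr_ae (Filter.Eventually.of_forall fun x => ?_)
  simp [mul_comm]

theorem inner_toL2_right (f : L2I) {g : ℝ → ℝ} (hg : Continuous g) :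
    inner ℝ f (toL2 g) = pairing f g := by
  rw [inner_eq_pairing]
  refine integral_congr_ae ?_
  filter_upwards [coeFn_toL2 hg] with x hx
  rw [hx]

theorem inner_toL2_left (f : L2I) {g : ℝ → ℝ} (hg : Continuous g) :
    inner ℝ (toL2 g) f = pairing f g := by
  rw [real_inner_comm, inner_toL2_right f hg]

theorem pairing_toL2_left {f : ℝ → ℝ} (hf : Continuous f) (g : ℝ → ℝ) :
    pairing (toL2 f) g = pairing f g := by
  refine integral_congr_ae ?_
  filter_upwards [coeFn_toL2 hf] with x hx
  rw [hx]

theorem inner_toL2_toL2 {f g : ℝ → ℝ} (hf : Continuous f) (hg : Continuous g) :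
    inner ℝ (toL2 f) (toL2 g) = pairing f g := by
  rw [inner_toL2_right _ hg, pairing_toL2_left hf]

theorem abs_pairing_le (f : L2I) {g : ℝ → ℝ} (hg : Continuous g) :
    |pairing f g| ≤ ‖f‖ * ‖toL2 g‖ := by
  rw [← inner_toL2_right f hg]
  exact abs_real_inner_le_norm _ _

theorem norm_toL2_le {f : ℝ → ℝ} (hf : Continuous f) {C : ℝ} (hC : 0 ≤ C)
    (h : ∀ x ∈ Icc (0 : ℝ) 1, |f x| ≤ C) : ‖toL2 f‖ ≤ C := by
  have h1 : ‖toL2 f‖ ^ 2 ≤ C ^ 2 := by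
    rw [← real_inner_self_eq_norm_sq, inner_toL2_toL2 hf hf, pairing_eq_intervalIntegral]
    have : ∫ x in (0 : ℝ)..1, f x * f x ≤ ∫ x in (0 : ℝ)..1, C ^ 2 := by
      refine intervalIntegral.integral_mono_on zero_le_one
        ((hf.mul hf).intervalIntegrable _ _) (by simp) fun x hx => ?_
      rw [← sq, ← sq_abs]
      exact pow_le_pow_left₀ (abs_nonneg _) (h x hx) 2
    simpa using this
  exact abs_le_of_sq_le_sq' h1 hC |>.2

theorem integrable_coe (f : L2I) : Integrable f (volume.restrict (Ioo (0 : ℝ) 1)) :=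
  (Lp.memLp f).integrable (by norm_num)

theorem integrable_mul_continuous {f : ℝ → ℝ}
    (hf : Integrable f (volume.restrict (Ioo (0 : ℝ) 1))) {g : ℝ → ℝ} (hg : Continuous g) :
    Integrable (fun x => f x * g x) (volume.restrict (Ioo (0 : ℝ) 1)) := by
  obtain ⟨C, hC⟩ := isCompact_Icc.exists_bound_of_continuousOn (s := Icc (0 : ℝ) 1) hg.continuousOn
  refine hf.mul_bdd (c := C) hg.aestronglyMeasurable ?_
  filter_upwards [ae_restrict_mem measurableSet_Ioo] with x hx
  exact hC x (Ioo_subset_Icc_self hx)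

theorem pairing_add_right (f : L2I) {g h : ℝ → ℝ} (hg : Continuous g) (hh : Continuous h) :
    pairing f (fun x => g x + h x) = pairing f g + pairing f h := by
  simp only [pairing, mul_add]
  exact integral_add (integrable_mul_continuous (integrable_coe f) hg)
    (integrable_mul_continuous (integrable_coe f) hh)

theorem pairing_const_mul_right (f : ℝ → ℝ) (c : ℝ) (g : ℝ → ℝ) :
    pairing f (fun x => c * g x) = c * pairing f g := by
  simp only [pairing, mul_left_comm _ c]
  exact integral_const_mul _ _

theorem pairing_zero_right (f : ℝ → ℝ) : pairing f (fun _ => 0) = 0 := by simp [pairing]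

/-! ### Trigonometric integrals -/

theorem integral_cos_int (k : ℤ) :
    ∫ x in (0 : ℝ)..1, Real.cos (k * Real.pi * x) = if k = 0 then 1 else 0 := by
  split_ifs with h
  · simp [h]
  · have hk : (k : ℝ) * Real.pi ≠ 0 := mul_ne_zero (by exact_mod_cast h) Real.pi_ne_zero
    rw [intervalIntegral.integral_comp_mul_left (fun x => Real.cos x) hk]
    simp [Real.sin_int_mul_pi]

/-- Only `p ± q` have to be integer multiples of `π`, so the formula serves both the half-integer
frequencies of `phi1` and the integer ones of `psi2`. -/
theorem integral_cos_sub_add_cos {p q : ℝ} {j k : ℤ} (hj : p - q = j * Real.pi)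
    (hk : p + q = k * Real.pi) :
    ∫ x in (0 : ℝ)..1, (Real.sqrt 2 * Real.cos (p * x)) * (Real.sqrt 2 * Real.cos (q * x))
      = (if j = 0 then 1 else 0) + (if k = 0 then 1 else 0) := by
  rw [← integral_cos_int j, ← integral_cos_int k, ← intervalIntegral.integral_add
    (Continuous.intervalIntegrable (by fun_prop) _ _)
    (Continuous.intervalIntegrable (by fun_prop) _ _)]
  refine intervalIntegral.integral_congr fun x _ => ?_
  rw [← hj, ← hk, sub_mul, add_mul, Real.cos_sub, Real.cos_add]
  have := Real.mul_self_sqrt (show (0 : ℝ) ≤ 2 by norm_num)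
  linear_combination (Real.cos (p * x) * Real.cos (q * x)) * this

theorem integral_cos_sub_sub_cos {p q : ℝ} {j k : ℤ} (hj : p - q = j * Real.pi)
    (hk : p + q = k * Real.pi) :
    ∫ x in (0 : ℝ)..1, (Real.sqrt 2 * Real.sin (p * x)) * (Real.sqrt 2 * Real.sin (q * x))
      = (if j = 0 then 1 else 0) - (if k = 0 then 1 else 0) := by
  rw [← integral_cos_int j, ← integral_cos_int k, ← intervalIntegral.integral_sub
    (Continuous.intervalIntegrable (by fun_prop) _ _)
    (Continuous.intervalIntegrable (by fun_prop) _ _)]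
  refine intervalIntegral.integral_congr fun x _ => ?_
  rw [← hj, ← hk, sub_mul, add_mul, Real.cos_sub, Real.cos_add]
  have := Real.mul_self_sqrt (show (0 : ℝ) ≤ 2 by norm_num)
  linear_combination (Real.sin (p * x) * Real.sin (q * x)) * this

/-- The frequency of `phi1 n`. -/
noncomputable def freq1 (n : ℕ) : ℝ := ((n : ℝ) + 1 / 2) * Real.pi

/-- The sine functions dual to `phi1`. -/
noncomputable def sin1 (n : ℕ) (x : ℝ) : ℝ := Real.sqrt 2 * Real.sin (freq1 n * x)

/-- The sine functions dual to `psi2`; the index is shifted by one. -/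
noncomputable def sin2 (m : ℕ) (x : ℝ) : ℝ := Real.sqrt 2 * Real.sin (((m : ℝ) + 1) * Real.pi * x)

theorem continuous_phi1 (n : ℕ) : Continuous (phi1 n) := by unfold phi1; fun_prop
theorem continuous_psi2 (m : ℕ) : Continuous (psi2 m) := by unfold psi2; fun_prop
theorem continuous_sin1 (n : ℕ) : Continuous (sin1 n) := by unfold sin1; fun_prop
theorem continuous_sin2 (m : ℕ) : Continuous (sin2 m) := by unfold sin2; fun_prop

theorem pairing_phi1_phi1 (n k : ℕ) : pairing (phi1 n) (phi1 k) = if n = k then 1 else 0 := by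
  rw [pairing_eq_intervalIntegral]
  have := integral_cos_sub_add_cos (p := ((n : ℝ) + 1 / 2) * Real.pi)
    (q := ((k : ℝ) + 1 / 2) * Real.pi) (j := n - k) (k := n + k + 1)
    (by push_cast; ring) (by push_cast; ring)
  simp only [phi1]
  rw [this, if_neg (show ¬ ((n : ℤ) + k + 1 = 0) by omega), add_zero]
  simp only [sub_eq_zero, Nat.cast_inj]

theorem pairing_sin1_sin1 (n k : ℕ) : pairing (sin1 n) (sin1 k) = if n = k then 1 else 0 := by
  rw [pairing_eq_intervalIntegral]
  have := integral_cos_sub_sub_cos (p := ((n : ℝ) + 1 / 2) * Real.pi)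
    (q := ((k : ℝ) + 1 / 2) * Real.pi) (j := n - k) (k := n + k + 1)
    (by push_cast; ring) (by push_cast; ring)
  simp only [sin1, freq1]
  rw [this, if_neg (show ¬ ((n : ℤ) + k + 1 = 0) by omega), sub_zero]
  simp only [sub_eq_zero, Nat.cast_inj]

theorem pairing_sin2_sin2 (n k : ℕ) : pairing (sin2 n) (sin2 k) = if n = k then 1 else 0 := by
  rw [pairing_eq_intervalIntegral]
  have := integral_cos_sub_sub_cos (p := ((n : ℝ) + 1) * Real.pi)
    (q := ((k : ℝ) + 1) * Real.pi) (j := n - k) (k := n + k + 2)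
    (by push_cast; ring) (by push_cast; ring)
  simp only [sin2]
  rw [this, if_neg (show ¬ ((n : ℤ) + k + 2 = 0) by omega), sub_zero]
  simp only [sub_eq_zero, Nat.cast_inj]

theorem psi2_zero : psi2 0 = fun _ => 1 := by ext x; simp [psi2, mu]

theorem psi2_of_ne_zero {m : ℕ} (hm : m ≠ 0) :
    psi2 m = fun x => Real.sqrt 2 * Real.cos ((m : ℝ) * Real.pi * x) := by
  ext x; simp [psi2, mu, hm]

theorem pairing_psi2_psi2 (n k : ℕ) : pairing (psi2 n) (psi2 k) = if n = k then 1 else 0 := by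
  rw [pairing_eq_intervalIntegral]
  have h0 : ∀ k : ℕ, k ≠ 0 → ∫ x in (0 : ℝ)..1, psi2 k x = 0 := by
    intro k hk
    have := integral_cos_int k
    rw [psi2_of_ne_zero hk, intervalIntegral.integral_const_mul]
    push_cast at this
    rw [this, if_neg (by exact_mod_cast hk), mul_zero]
  rcases eq_or_ne n 0 with rfl | hn
  · rcases eq_or_ne k 0 with rfl | hk
    · simp [psi2_zero]
    · simp only [psi2_zero, one_mul]
      rw [h0 k hk, if_neg hk.symm]
  · rcases eq_or_ne k 0 with rfl | hk
    · simp only [psi2_zero, mul_one]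
      rw [h0 n hn, if_neg hn]
    · have := integral_cos_sub_add_cos (p := (n : ℝ) * Real.pi)
        (q := (k : ℝ) * Real.pi) (j := n - k) (k := n + k)
        (by push_cast; ring) (by push_cast; ring)
      rw [psi2_of_ne_zero hn, psi2_of_ne_zero hk, this,
        if_neg (show ¬ ((n : ℤ) + k = 0) by omega), add_zero]
      simp only [sub_eq_zero, Nat.cast_inj]

theorem orthonormal_toL2 {f : ℕ → ℝ → ℝ} (hf : ∀ n, Continuous (f n))
    (h : ∀ n k, pairing (f n) (f k) = if n = k then 1 else 0) :
    Orthonormal ℝ fun n => toL2 (f n) := by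
  rw [orthonormal_iff_ite]
  intro i j
  rw [inner_toL2_toL2 (hf i) (hf j), h]

/-! ### Completeness of the cosine systems -/

/-- Orthogonality to all cosines gives orthogonality to all polynomials in `cos(πx)`. As `cos(πx)`
maps `[0,1]` homeomorphically onto `[-1,1]`, the Weierstrass theorem extends this to all continuous
functions. -/
theorem ae_eq_zero_of_integral_cos_eq_zero {f : ℝ → ℝ}
    (hf : Integrable f (volume.restrict (Ioo (0 : ℝ) 1)))
    (h : ∀ m : ℕ, ∫ x in Ioo (0 : ℝ) 1, f x * Real.cos (m * Real.pi * x) = 0) :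
    ∀ᵐ x ∂(volume.restrict (Ioo (0 : ℝ) 1)), f x = 0 := by
  have hint := fun {g : ℝ → ℝ} (hg : Continuous g) => integrable_mul_continuous hf hg
  -- The frequency ranges over `ℤ` so that the product-to-sum formula can use `m - 1` without a case
  -- distinction.
  have hpow : ∀ (j : ℕ) (m : ℤ), ∫ x in Ioo (0 : ℝ) 1,
      f x * (Real.cos (Real.pi * x) ^ j * Real.cos (m * Real.pi * x)) = 0 := by
    intro j
    induction j with
    | zero =>
      intro m
      simp only [pow_zero, one_mul]
      rcases Int.eq_nat_or_neg m with ⟨k, rfl | rfl⟩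
      · exact_mod_cast h k
      · have := h k
        push_cast
        simpa [neg_mul, Real.cos_neg] using this
    | succ j ih =>
      intro m
      have h1 := ih (m + 1)
      have h2 := ih (m - 1)
      have h3 : ∀ x : ℝ, f x * (Real.cos (Real.pi * x) ^ (j + 1) * Real.cos (m * Real.pi * x))
          = (1 / 2) * (f x * (Real.cos (Real.pi * x) ^ j * Real.cos ((m + 1 : ℤ) * Real.pi * x)))
          + (1 / 2) * (f x * (Real.cos (Real.pi * x) ^ j * Real.cos ((m - 1 : ℤ) * Real.pi * x))) := by
        intro x
        have e1 : ((m + 1 : ℤ) : ℝ) * Real.pi * x = m * Real.pi * x + Real.pi * x := by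
          push_cast; ring
        have e2 : ((m - 1 : ℤ) : ℝ) * Real.pi * x = m * Real.pi * x - Real.pi * x := by
          push_cast; ring
        rw [e1, e2, Real.cos_add, Real.cos_sub]
        ring
      simp_rw [h3]
      rw [integral_add ((hint (by fun_prop)).const_mul _) ((hint (by fun_prop)).const_mul _),
        integral_const_mul, integral_const_mul, h1, h2]
      simp
  have hpoly : ∀ p : Polynomial ℝ, ∫ x in Ioo (0 : ℝ) 1, f x * p.eval (Real.cos (Real.pi * x)) = 0 := by
    intro p
    induction p using Polynomial.induction_on' with
    | add p q hp hq =>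
      simp only [Polynomial.eval_add, mul_add]
      rw [integral_add (hint (by fun_prop)) (hint (by fun_prop)), hp, hq, add_zero]
    | monomial n c =>
      have := hpow n 0
      simp only [Polynomial.eval_monomial, mul_left_comm _ c]
      rw [integral_const_mul]
      simp only [Int.cast_zero, zero_mul, Real.cos_zero, mul_one] at this
      rw [this, mul_zero]
  have hcont : ∀ g : ℝ → ℝ, Continuous g → ∫ x in Ioo (0 : ℝ) 1, f x * g x = 0 := by
    intro g hg
    set S := ∫ x in Ioo (0 : ℝ) 1, |f x| with hS
    have hS0 : 0 ≤ S := integral_nonneg fun x => abs_nonneg _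
    have key : ∀ ε > 0, |∫ x in Ioo (0 : ℝ) 1, f x * g x| ≤ ε * S := by
      intro ε hε
      obtain ⟨p, hp⟩ := exists_polynomial_near_of_continuousOn (-1) 1
        (fun y => g (Real.arccos y / Real.pi))
        (hg.comp (Real.continuous_arccos.div_const _)).continuousOn ε hε
      have e : ∫ x in Ioo (0 : ℝ) 1, f x * g x
          = ∫ x in Ioo (0 : ℝ) 1, f x * (g x - p.eval (Real.cos (Real.pi * x))) := by
        simp only [mul_sub]
        rw [integral_sub (hint hg) (hint (by fun_prop)), hpoly, sub_zero]
      rw [e, hS, ← integral_const_mul]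
      rw [← Real.norm_eq_abs (∫ x in Ioo (0 : ℝ) 1, _)]
      refine norm_integral_le_of_norm_le (hf.abs.const_mul ε) ?_
      filter_upwards [ae_restrict_mem measurableSet_Ioo] with x hx
      have h1 := hp (Real.cos (Real.pi * x)) ⟨Real.neg_one_le_cos _, Real.cos_le_one _⟩
      rw [Real.arccos_cos (by have := Real.pi_pos; nlinarith [hx.1])
        (by have := Real.pi_pos; nlinarith [hx.2]),
        mul_div_cancel_left₀ _ Real.pi_ne_zero, abs_sub_comm] at h1
      rw [norm_mul, mul_comm]
      exact mul_le_mul_of_nonneg_right h1.le (norm_nonneg _)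
    by_contra hne
    have hpos := abs_pos.2 hne
    have h1 := key (|∫ x in Ioo (0 : ℝ) 1, f x * g x| / (2 * (S + 1))) (by positivity)
    rw [div_mul_eq_mul_div, le_div_iff₀ (by positivity)] at h1
    nlinarith
  have := IsOpen.ae_eq_zero_of_integral_contDiff_smul_eq_zero
    (isOpen_Ioo : IsOpen (Ioo (0 : ℝ) 1)) (μ := volume.restrict (Ioo (0 : ℝ) 1)) (f := f)
    (hf.locallyIntegrable.locallyIntegrableOn _) (fun g hg _ _ => by
      have := hcont g hg.continuous
      simpa [mul_comm] using this)
  filter_upwards [this, ae_restrict_mem measurableSet_Ioo] with x h1 h2 using h1 h2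

theorem eq_zero_of_pairing_psi2 {f : L2I} (h : ∀ m, pairing f (psi2 m) = 0) : f = 0 := by
  have h1 : ∀ m : ℕ, ∫ x in Ioo (0 : ℝ) 1, f x * Real.cos (m * Real.pi * x) = 0 := by
    intro m
    have h2 := h m
    have : psi2 m = fun x => mu m * Real.cos (m * Real.pi * x) := rfl
    rw [this, pairing_const_mul_right] at h2
    rcases mul_eq_zero.1 h2 with h3 | h3
    · exfalso
      unfold mu at h3
      split_ifs at h3
      · norm_num at h3
      · exact (Real.sqrt_pos.2 two_pos).ne' h3
    · exact h3
  have := ae_eq_zero_of_integral_cos_eq_zero (integrable_coe f) h1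
  exact (Lp.eq_zero_iff_ae_eq_zero).2 this

/-- By product-to-sum, `f(x) cos(πx/2)` is orthogonal to every integer cosine, hence zero; and
`cos(πx/2)` does not vanish on `(0,1)`. -/
theorem eq_zero_of_pairing_phi1 {f : L2I} (h : ∀ n, pairing f (phi1 n) = 0) : f = 0 := by
  have h1 : ∀ n : ℕ, ∫ x in Ioo (0 : ℝ) 1, f x * Real.cos (((n : ℝ) + 1 / 2) * Real.pi * x) = 0 := by
    intro n
    have h2 := h n
    have : phi1 n = fun x => Real.sqrt 2 * Real.cos (((n : ℝ) + 1 / 2) * Real.pi * x) := rfl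
    rw [this, pairing_const_mul_right] at h2
    exact (mul_eq_zero.1 h2).resolve_left (Real.sqrt_pos.2 two_pos).ne'
  have hint := fun {g : ℝ → ℝ} (hg : Continuous g) => integrable_mul_continuous (integrable_coe f) hg
  have h2 : ∀ m : ℕ, ∫ x in Ioo (0 : ℝ) 1,
      (f x * Real.cos (Real.pi / 2 * x)) * Real.cos (m * Real.pi * x) = 0 := by
    intro m
    rcases m with _ | m
    · have := h1 0
      simp only [CharP.cast_eq_zero, zero_add, show ((1 : ℝ) / 2) * Real.pi = Real.pi / 2 by ring]
        at this
      simpa using this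
    · have h3 := h1 (m + 1)
      have h4 := h1 m
      have h5 : ∀ x : ℝ, (f x * Real.cos (Real.pi / 2 * x)) * Real.cos ((m + 1 : ℕ) * Real.pi * x)
          = (1 / 2) * (f x * Real.cos ((((m + 1 : ℕ) : ℝ) + 1 / 2) * Real.pi * x))
          + (1 / 2) * (f x * Real.cos (((m : ℝ) + 1 / 2) * Real.pi * x)) := by
        intro x
        have e1 : (((m + 1 : ℕ) : ℝ) + 1 / 2) * Real.pi * x
          = (m + 1 : ℕ) * Real.pi * x + Real.pi / 2 * x := by ring
        have e2 : ((m : ℝ) + 1 / 2) * Real.pi * x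
          = (m + 1 : ℕ) * Real.pi * x - Real.pi / 2 * x := by push_cast; ring
        rw [e1, e2, Real.cos_add, Real.cos_sub]
        ring
      simp_rw [h5]
      rw [integral_add ((hint (by fun_prop)).const_mul _) ((hint (by fun_prop)).const_mul _),
        integral_const_mul, integral_const_mul, h3, h4]
      simp
  have := ae_eq_zero_of_integral_cos_eq_zero
    (hint (show Continuous fun x => Real.cos (Real.pi / 2 * x) by fun_prop)) h2
  refine (Lp.eq_zero_iff_ae_eq_zero).2 ?_
  filter_upwards [this, ae_restrict_mem measurableSet_Ioo] with x h3 hx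
  refine (mul_eq_zero.1 h3).resolve_right (Real.cos_pos_of_mem_Ioo ⟨?_, ?_⟩).ne'
  · have := Real.pi_pos; nlinarith [hx.1]
  · have := Real.pi_pos; nlinarith [hx.2]

/-- A complete orthonormal system of continuous functions is a Hilbert basis of `L²(0,1)`. -/
theorem exists_hilbertBasis {f : ℕ → ℝ → ℝ} (hf : ∀ n, Continuous (f n))
    (h : ∀ n k, pairing (f n) (f k) = if n = k then 1 else 0)
    (h0 : ∀ g : L2I, (∀ n, pairing g (f n) = 0) → g = 0) :
    ∃ b : HilbertBasis ℕ ℝ L2I, ∀ n, b n = toL2 (f n) := by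
  refine ⟨HilbertBasis.mkOfOrthogonalEqBot (orthonormal_toL2 hf h) ?_, fun n => by
    rw [HilbertBasis.coe_mkOfOrthogonalEqBot]⟩
  rw [Submodule.eq_bot_iff]
  intro g hg
  refine h0 g fun n => ?_
  rw [← inner_toL2_left g (hf n)]
  exact (Submodule.mem_orthogonal _ _).1 hg _ (Submodule.subset_span ⟨n, rfl⟩)

theorem hasSum_of_hilbertBasis {f : ℕ → ℝ → ℝ} (hf : ∀ n, Continuous (f n))
    (h : ∀ n k, pairing (f n) (f k) = if n = k then 1 else 0)
    (h0 : ∀ g : L2I, (∀ n, pairing g (f n) = 0) → g = 0) (x y : L2I) :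
    HasSum (fun n => pairing x (f n) * pairing y (f n)) (inner ℝ x y) := by
  obtain ⟨b, hb⟩ := exists_hilbertBasis hf h h0
  have := b.hasSum_inner_mul_inner x y
  simpa only [hb, inner_toL2_left _ (hf _), inner_toL2_right _ (hf _)] using this

theorem hasSum_phi1 (x y : L2I) :
    HasSum (fun n => pairing x (phi1 n) * pairing y (phi1 n)) (inner ℝ x y) :=
  hasSum_of_hilbertBasis continuous_phi1 pairing_phi1_phi1 (fun _ => eq_zero_of_pairing_phi1) x y

theorem hasSum_psi2 (x y : L2I) :
    HasSum (fun n => pairing x (psi2 n) * pairing y (psi2 n)) (inner ℝ x y) :=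
  hasSum_of_hilbertBasis continuous_psi2 pairing_psi2_psi2 (fun _ => eq_zero_of_pairing_psi2) x y

theorem hasSum_sq_phi1 (x : L2I) : HasSum (fun n => pairing x (phi1 n) ^ 2) (‖x‖ ^ 2) := by
  have := hasSum_phi1 x x
  rw [real_inner_self_eq_norm_sq] at this
  simpa only [sq] using this

theorem hasSum_sq_psi2 (x : L2I) : HasSum (fun n => pairing x (psi2 n) ^ 2) (‖x‖ ^ 2) := by
  have := hasSum_psi2 x x
  rw [real_inner_self_eq_norm_sq] at this
  simpa only [sq] using this

/-! ### `H¹(0,1)` through cosine coefficients -/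

theorem intervalIntegrable_coe (g : L2I) : IntervalIntegrable g volume 0 1 := by
  rw [intervalIntegrable_iff_integrableOn_Ioo_of_le zero_le_one]
  exact integrable_coe g

/-- Integration by parts against a continuously differentiable function. -/
theorem IsH1.integral_by_parts {f g : L2I} {F : ℝ → ℝ} (hf : IsH1 f F g) {h h' : ℝ → ℝ}
    (hh : ∀ x, HasDerivAt h (h' x) x) (hc : Continuous h') :
    pairing f h' = F 1 * h 1 - F 0 * h 0 - pairing g h := by
  have hg := intervalIntegrable_coe g
  have hmem : (0 : ℝ) ∈ uIcc (0 : ℝ) 1 := by simp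
  have hder : deriv h = h' := funext fun x => (hh x).deriv
  have hh1 : ContDiff ℝ 1 h := by
    rw [contDiff_one_iff_deriv]
    exact ⟨fun x => (hh x).differentiableAt, by rw [hder]; exact hc⟩
  have hac1 := hg.absolutelyContinuousOnInterval_intervalIntegral hmem
  have hac2 : AbsolutelyContinuousOnInterval h 0 1 := hh1.contDiffOn.absolutelyContinuousOnInterval
  have h1 := hac1.integral_mul_deriv_eq_deriv_mul hac2
  have h2 : ∫ x in (0 : ℝ)..1, deriv (fun x => ∫ t in (0 : ℝ)..x, g t) x * h x
      = ∫ x in (0 : ℝ)..1, g x * h x := by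
    refine intervalIntegral.integral_congr_ae ?_
    filter_upwards [hg.ae_hasDerivAt_integral] with x hx hx1
    rw [(hx (uIoc_subset_uIcc hx1) 0 hmem).deriv]
  have h3 : pairing f h' = ∫ x in (0 : ℝ)..1, (F 0 + ∫ t in (0 : ℝ)..x, g t) * h' x := by
    rw [← integral_Ioo_eq, pairing]
    refine integral_congr_ae ?_
    filter_upwards [hf.ae_eq, ae_restrict_mem measurableSet_Ioo] with x hx hx1
    rw [hx, hf.ftc x (Ioo_subset_Icc_self hx1)]
  have h4 : ∫ x in (0 : ℝ)..1, h' x = h 1 - h 0 :=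
    intervalIntegral.integral_eq_sub_of_hasDerivAt (fun x _ => hh x) (hc.intervalIntegrable _ _)
  have h5 : IntervalIntegrable (fun x => (∫ t in (0 : ℝ)..x, g t) * h' x) volume 0 1 :=
    (hac1.continuousOn.mul hc.continuousOn).intervalIntegrable
  rw [hder, h2] at h1
  simp only [add_mul] at h3
  rw [h3, intervalIntegral.integral_add ((hc.intervalIntegrable _ _).const_mul _) h5,
    intervalIntegral.integral_const_mul, h4, h1, pairing_eq_intervalIntegral,
    hf.ftc 1 (by simp)]
  simp
  ring

/-- The sines vanish at both ends, so no boundary condition on `f` is needed. In the next lemma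
`sin1` does not vanish at 1, whence the hypothesis `F 1 = 0`. -/
theorem IsH1.freq2_mul_pairing {f g : L2I} {F : ℝ → ℝ} (hf : IsH1 f F g) (m : ℕ) :
    (((m : ℝ) + 1) * Real.pi) * pairing f (psi2 (m + 1)) = - pairing g (sin2 m) := by
  have h := hf.integral_by_parts (h := sin2 m)
    (h' := fun x => (((m : ℝ) + 1) * Real.pi) * psi2 (m + 1) x) (fun x => by
      rw [psi2_of_ne_zero (Nat.succ_ne_zero m)]
      have := (((hasDerivAt_id x).const_mul (((m : ℝ) + 1) * Real.pi)).sin).const_mul (Real.sqrt 2)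
      refine this.congr_deriv ?_
      simp; ring) (by have := continuous_psi2 (m + 1); fun_prop)
  rw [pairing_const_mul_right] at h
  rw [h]
  have : sin2 m 1 = 0 := by
    have := Real.sin_nat_mul_pi (m + 1)
    push_cast at this
    simp [sin2, this]
  rw [this]
  simp [sin2]

theorem IsH1.freq1_mul_pairing {f g : L2I} {F : ℝ → ℝ} (hf : IsH1 f F g) (h1 : F 1 = 0) (n : ℕ) :
    freq1 n * pairing f (phi1 n) = - pairing g (sin1 n) := by
  have h := hf.integral_by_parts (h := sin1 n)
    (h' := fun x => freq1 n * phi1 n x) (fun x => by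
      have := (((hasDerivAt_id x).const_mul (freq1 n)).sin).const_mul (Real.sqrt 2)
      refine this.congr_deriv ?_
      simp [phi1, freq1]; ring) (by have := continuous_phi1 n; fun_prop)
  rw [pairing_const_mul_right] at h
  rw [h, h1]
  simp [sin1]

theorem summable_sq_pairing {f : ℕ → ℝ → ℝ} (hf : ∀ n, Continuous (f n))
    (h : ∀ n k, pairing (f n) (f k) = if n = k then 1 else 0) (g : L2I) :
    Summable (fun n => pairing g (f n) ^ 2) ∧ ∑' n, pairing g (f n) ^ 2 ≤ ‖g‖ ^ 2 := by
  have h1 := (orthonormal_toL2 hf h).inner_products_summable g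
  have h2 := (orthonormal_toL2 hf h).tsum_inner_products_le g
  simp only [inner_toL2_left _ (hf _), Real.norm_eq_abs, sq_abs] at h1 h2
  exact ⟨h1, h2⟩

theorem IsH1.summable_freq2 {f g : L2I} {F : ℝ → ℝ} (hf : IsH1 f F g) :
    Summable (fun m : ℕ => (((m : ℝ) * Real.pi) * pairing f (psi2 m)) ^ 2) ∧
      ∑' m : ℕ, (((m : ℝ) * Real.pi) * pairing f (psi2 m)) ^ 2 ≤ ‖g‖ ^ 2 := by
  obtain ⟨h1, h2⟩ := summable_sq_pairing continuous_sin2 pairing_sin2_sin2 g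
  have h3 : ∀ m : ℕ, pairing g (sin2 m) ^ 2
      = ((((m + 1 : ℕ) : ℝ) * Real.pi) * pairing f (psi2 (m + 1))) ^ 2 := by
    intro m
    push_cast
    rw [hf.freq2_mul_pairing, neg_sq]
  simp only [h3] at h1 h2
  have h4 := (summable_nat_add_iff (f := fun m : ℕ => (((m : ℝ) * Real.pi) * pairing f (psi2 m)) ^ 2) 1).1 h1
  refine ⟨h4, ?_⟩
  rw [h4.tsum_eq_zero_add]
  simpa using h2

theorem IsH1.summable_freq1 {f g : L2I} {F : ℝ → ℝ} (hf : IsH1 f F g) (hF : F 1 = 0) :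
    Summable (fun n : ℕ => (freq1 n * pairing f (phi1 n)) ^ 2) ∧
      ∑' n : ℕ, (freq1 n * pairing f (phi1 n)) ^ 2 ≤ ‖g‖ ^ 2 := by
  have := summable_sq_pairing continuous_sin1 pairing_sin1_sin1 g
  simpa only [hf.freq1_mul_pairing hF, neg_sq] using this

theorem exists_isH1_primitive (g : L2I) : ∃ F : ℝ → ℝ, Continuous F ∧ F 0 = 0 ∧
    ∀ k : ℝ, IsH1 (toL2 fun x => k + F x) (fun x => k + F x) g := by
  -- Extension by zero makes the primitive continuous on all of `ℝ`.
  set G : ℝ → ℝ := (Ioo (0 : ℝ) 1).indicator g with hG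
  have hGi : Integrable G := (integrable_indicator_iff measurableSet_Ioo).2 (integrable_coe g)
  have hc : Continuous fun x => ∫ t in (0 : ℝ)..x, G t :=
    intervalIntegral.continuous_primitive (fun a b => hGi.intervalIntegrable) 0
  refine ⟨_, hc, by simp, fun k => ⟨coeFn_toL2 (continuous_const.add hc), fun x hx => ?_⟩⟩
  simp only [intervalIntegral.integral_same, add_zero]
  congr 1
  rw [intervalIntegral.integral_of_le hx.1, intervalIntegral.integral_of_le hx.1,
    integral_Ioc_eq_integral_Ioo, integral_Ioc_eq_integral_Ioo]
  refine setIntegral_congr_fun measurableSet_Ioo fun y hy => ?_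
  simp only [hG]
  have hy1 : y ∈ Ioo (0 : ℝ) 1 := ⟨hy.1, hy.2.trans_le hx.2⟩
  rw [indicator_of_mem hy1]

/-- Riesz–Fischer; only orthonormality is needed, so completeness of the sine systems never has to
be proved. -/
theorem exists_of_summable_sq {f : ℕ → ℝ → ℝ} (hf : ∀ n, Continuous (f n))
    (h : ∀ n k, pairing (f n) (f k) = if n = k then 1 else 0) {a : ℕ → ℝ}
    (ha : Summable fun n => a n ^ 2) :
    ∃ g : L2I, (∀ n, pairing g (f n) = a n) ∧ ‖g‖ ^ 2 = ∑' n, a n ^ 2 := by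
  have ho := orthonormal_toL2 hf h
  have hl : Memℓp a 2 := by
    rw [memℓp_gen_iff (by norm_num)]
    simpa using ha
  let l : lp (fun _ : ℕ => ℝ) 2 := ⟨a, hl⟩
  refine ⟨ho.orthogonalFamily.linearIsometry l, fun n => ?_, ?_⟩
  · rw [← inner_toL2_left _ (hf n)]
    have h1 := ho.orthogonalFamily.hasSum_linearIsometry l
    have h2 := (innerSL ℝ (toL2 (f n))).hasSum h1
    have h3 : ∀ i, (innerSL ℝ (toL2 (f n))) ((LinearIsometry.toSpanSingleton ℝ L2I (ho.1 i)) (l i))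
        = if i = n then a n else 0 := by
      intro i
      simp only [LinearIsometry.toSpanSingleton_apply, innerSL_apply_apply, inner_smul_right]
      rw [inner_toL2_toL2 (hf n) (hf i), h]
      by_cases hi : i = n
      · subst hi; simp [l]
      · simp [hi, Ne.symm hi]
    simp only [h3] at h2
    exact h2.unique (hasSum_ite_eq n (a n))
  · rw [LinearIsometry.norm_map]
    have := lp.norm_rpow_eq_tsum (p := 2) (by norm_num) l
    simpa [l] using this

/-- Converse of `IsH1.summable_freq2`: sum the sine series of the would-be derivative, integrate it,
and recognise `f` by its cosine coefficients. Regularity of the state at time `t` is obtained from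
its modes in this way. -/
theorem exists_isH1_of_summable_freq2 {f : L2I}
    (hs : Summable (fun m : ℕ => (((m : ℝ) * Real.pi) * pairing f (psi2 m)) ^ 2)) :
    ∃ F g, IsH1 f F g ∧ ‖g‖ ^ 2 = ∑' m : ℕ, (((m : ℝ) * Real.pi) * pairing f (psi2 m)) ^ 2 := by
  have hs1 := (summable_nat_add_iff (f := fun m : ℕ =>
    (((m : ℝ) * Real.pi) * pairing f (psi2 m)) ^ 2) 1).2 hs
  obtain ⟨g, hg, hgn⟩ := exists_of_summable_sq continuous_sin2 pairing_sin2_sin2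
    (a := fun m => -((((m + 1 : ℕ) : ℝ) * Real.pi) * pairing f (psi2 (m + 1))))
    (by simpa only [neg_sq] using hs1)
  obtain ⟨F, hFc, hF0, hF⟩ := exists_isH1_primitive g
  -- The constant of integration is fixed by the coefficient of index 0, which the sine series does
  -- not see.
  set k := pairing f (psi2 0) - ∫ x in (0 : ℝ)..1, F x with hk
  have hH := hF k
  have hc : Continuous fun x => k + F x := continuous_const.add hFc
  have heq : toL2 (fun x => k + F x) = f := by
    rw [← sub_eq_zero]
    refine eq_zero_of_pairing_psi2 fun m => ?_
    rw [← inner_toL2_right _ (continuous_psi2 m), inner_sub_left, sub_eq_zero,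
      inner_toL2_right _ (continuous_psi2 m), inner_toL2_right _ (continuous_psi2 m)]
    rcases m with _ | m
    · rw [pairing_toL2_left hc, pairing_eq_intervalIntegral]
      simp only [psi2_zero, mul_one] at hk ⊢
      rw [intervalIntegral.integral_add (by simp) (hFc.intervalIntegrable _ _), hk]
      simp
    · have h1 := hH.freq2_mul_pairing m
      rw [hg, neg_neg] at h1
      push_cast at h1
      exact mul_left_cancel₀ (by have := Real.pi_pos; positivity) h1
  rw [heq] at hH
  refine ⟨_, g, hH, ?_⟩
  rw [hgn, hs.tsum_eq_zero_add]
  simp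

theorem freq1_pos (n : ℕ) : 0 < freq1 n := by
  have := Real.pi_pos
  unfold freq1; positivity

theorem exists_isH1_of_summable_freq1 {f : L2I}
    (hs : Summable (fun n : ℕ => (freq1 n * pairing f (phi1 n)) ^ 2)) :
    ∃ F g, IsH1 f F g ∧ F 1 = 0 ∧
      ‖g‖ ^ 2 = ∑' n : ℕ, (freq1 n * pairing f (phi1 n)) ^ 2 := by
  obtain ⟨g, hg, hgn⟩ := exists_of_summable_sq continuous_sin1 pairing_sin1_sin1
    (a := fun n => -(freq1 n * pairing f (phi1 n))) (by simpa only [neg_sq] using hs)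
  obtain ⟨F, hFc, hF0, hF⟩ := exists_isH1_primitive g
  -- Here the constant of integration is fixed by the condition at `x = 1`.
  have hH := hF (-F 1)
  have hc : Continuous fun x => -F 1 + F x := continuous_const.add hFc
  have heq : toL2 (fun x => -F 1 + F x) = f := by
    rw [← sub_eq_zero]
    refine eq_zero_of_pairing_phi1 fun n => ?_
    rw [← inner_toL2_right _ (continuous_phi1 n), inner_sub_left, sub_eq_zero,
      inner_toL2_right _ (continuous_phi1 n), inner_toL2_right _ (continuous_phi1 n)]
    have h1 := hH.freq1_mul_pairing (by simp) n
    rw [hg, neg_neg] at h1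
    exact mul_left_cancel₀ (freq1_pos n).ne' h1
  rw [heq] at hH
  refine ⟨_, g, hH, by simp, ?_⟩
  rw [hgn]
  simp

/-- Integration by parts against `x - 1`, which vanishes at 1, isolates the value at 0. -/
theorem IsH1.abs_zero_le {f g : L2I} {F : ℝ → ℝ} (hf : IsH1 f F g) : |F 0| ≤ ‖f‖ + ‖g‖ := by
  have h := hf.integral_by_parts (h := fun x => x - 1) (h' := fun _ => 1)
    (fun x => (hasDerivAt_id x).sub_const 1) continuous_const
  have h1 := abs_pairing_le f (continuous_const (y := (1 : ℝ)))
  have h2 := abs_pairing_le g (show Continuous fun x : ℝ => x - 1 by fun_prop)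
  have n1 : ‖toL2 fun _ => (1 : ℝ)‖ ≤ 1 := norm_toL2_le continuous_const zero_le_one (by simp)
  have n2 : ‖toL2 fun x : ℝ => x - 1‖ ≤ 1 := norm_toL2_le (by fun_prop) zero_le_one
    (fun x hx => by rw [abs_le]; constructor <;> linarith [hx.1, hx.2])
  have h3 : F 0 = pairing f (fun _ => 1) + pairing g (fun x => x - 1) := by
    rw [h]; ring
  rw [h3]
  refine (abs_add_le _ _).trans (add_le_add (h1.trans ?_) (h2.trans ?_))
  · exact mul_le_of_le_one_right (norm_nonneg _) n1
  · exact mul_le_of_le_one_right (norm_nonneg _) n2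

/-! ### Resonances -/

theorem mem_Delta_iff {a b : ℝ} {n m : ℕ} : (n, m) ∈ Delta a b ↔ lam1 a n = lam2 b m := by
  simp only [Delta, mem_ofPred_eq, lam1, lam2]
  constructor <;> intro h <;> linarith

/-- This and the next lemma allow the index chosen in `psi1` or `phi2` to be replaced by any known
resonant one. -/
theorem Delta_snd_unique {a b : ℝ} {n m k : ℕ} (h1 : (n, m) ∈ Delta a b) (h2 : (n, k) ∈ Delta a b) :
    m = k := by
  rw [mem_Delta_iff] at h1 h2
  have h3 : lam2 b m = lam2 b k := h1.symm.trans h2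
  simp only [lam2] at h3
  have hpi := Real.pi_pos
  have h4 : ((m : ℝ)) ^ 2 = (k : ℝ) ^ 2 := by
    have : (0 : ℝ) < Real.pi ^ 2 := by positivity
    exact mul_right_cancel₀ this.ne' (by linarith)
  have := (sq_eq_sq₀ (Nat.cast_nonneg m) (Nat.cast_nonneg k)).1 h4
  exact_mod_cast this

theorem Delta_fst_unique {a b : ℝ} {n k m : ℕ} (h1 : (n, m) ∈ Delta a b) (h2 : (k, m) ∈ Delta a b) :
    n = k := by
  rw [mem_Delta_iff] at h1 h2
  have h3 : lam1 a n = lam1 a k := h1.trans h2.symm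
  simp only [lam1] at h3
  have hpi := Real.pi_pos
  have h4 : ((n : ℝ) + 1 / 2) ^ 2 = ((k : ℝ) + 1 / 2) ^ 2 := by
    have : (0 : ℝ) < Real.pi ^ 2 := by positivity
    exact mul_right_cancel₀ this.ne' (by linarith)
  have := (sq_eq_sq₀ (by positivity) (by positivity)).1 h4
  have : (n : ℝ) = k := by linarith
  exact_mod_cast this

/-! ### Second order equations -/

/-- Green's formula on `(0,1)`. -/
theorem green {F F' F'' G G' G'' : ℝ → ℝ} (hF : ∀ x, HasDerivAt F (F' x) x)
    (hF' : ∀ x, HasDerivAt F' (F'' x) x) (hG : ∀ x, HasDerivAt G (G' x) x)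
    (hG' : ∀ x, HasDerivAt G' (G'' x) x) (cF : Continuous F'') (cG : Continuous G'') :
    pairing F'' G - pairing F G'' = (F' 1 * G 1 - F 1 * G' 1) - (F' 0 * G 0 - F 0 * G' 0) := by
  have c1 : Continuous F := continuous_iff_continuousAt.2 fun x => (hF x).continuousAt
  have c2 : Continuous G := continuous_iff_continuousAt.2 fun x => (hG x).continuousAt
  have i1 : IntervalIntegrable (fun x => F'' x * G x) volume 0 1 :=
    (cF.mul c2).intervalIntegrable _ _
  have i2 : IntervalIntegrable (fun x => F x * G'' x) volume 0 1 :=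
    (c1.mul cG).intervalIntegrable _ _
  rw [pairing_eq_intervalIntegral, pairing_eq_intervalIntegral,
    ← intervalIntegral.integral_sub i1 i2]
  refine intervalIntegral.integral_eq_sub_of_hasDerivAt (f := fun x => F' x * G x - F x * G' x)
    (fun x _ => ?_) (i1.sub i2)
  refine (((hF' x).mul (hG x)).sub ((hF x).mul (hG' x))).congr_deriv ?_
  ring

theorem hasDerivAt_sin_mul (p x : ℝ) :
    HasDerivAt (fun x => Real.sin (p * x)) (p * Real.cos (p * x)) x :=
  ((hasDerivAt_id x).const_mul p).sin.congr_deriv (by simp; ring)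

theorem hasDerivAt_cos_mul (p x : ℝ) :
    HasDerivAt (fun x => Real.cos (p * x)) (-(p * Real.sin (p * x))) x :=
  ((hasDerivAt_id x).const_mul p).cos.congr_deriv (by simp; ring)

theorem hasDerivAt_one_sub (x : ℝ) : HasDerivAt (fun x : ℝ => 1 - x) (-1) x :=
  (hasDerivAt_id x).const_sub 1

theorem hasDerivAt_mul_one_sub (p x : ℝ) : HasDerivAt (fun x : ℝ => p * (1 - x)) (-p) x :=
  ((hasDerivAt_one_sub x).const_mul p).congr_deriv (by ring)

theorem hasDerivAt_one_sub_mul_sin (p x : ℝ) :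
    HasDerivAt (fun x => (1 - x) * Real.sin (p * x))
      (-Real.sin (p * x) + (1 - x) * (p * Real.cos (p * x))) x :=
  ((hasDerivAt_one_sub x).mul (hasDerivAt_sin_mul p x)).congr_deriv (by ring)

theorem hasDerivAt_deriv_one_sub_mul_sin (p x : ℝ) :
    HasDerivAt (fun x => -Real.sin (p * x) + (1 - x) * (p * Real.cos (p * x)))
      (-p ^ 2 * ((1 - x) * Real.sin (p * x)) - 2 * p * Real.cos (p * x)) x :=
  ((hasDerivAt_sin_mul p x).neg.add ((hasDerivAt_one_sub x).mul
    ((hasDerivAt_cos_mul p x).const_mul p))).congr_deriv (by ring)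

/-- `∫₀¹ (1-x) sin(px) cos(px) dx` for `2p ∈ πℤ`. -/
theorem integral_one_sub_mul_sin_mul_cos {p : ℝ} (hp : p ≠ 0) (h : Real.sin (2 * p) = 0) :
    ∫ x in (0 : ℝ)..1, (1 - x) * Real.sin (p * x) * Real.cos (p * x) = 1 / (4 * p) := by
  have h1 : ∀ x : ℝ, HasDerivAt (fun x => (-(1 / (4 * p))) * ((1 - x) * Real.cos (2 * p * x))
      - 1 / (8 * p ^ 2) * Real.sin (2 * p * x)) ((1 - x) * Real.sin (p * x) * Real.cos (p * x)) x := by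
    intro x
    refine ((((hasDerivAt_one_sub x).mul (hasDerivAt_cos_mul (2 * p) x)).const_mul
      (-(1 / (4 * p)))).sub ((hasDerivAt_sin_mul (2 * p) x).const_mul (1 / (8 * p ^ 2)))).congr_deriv ?_
    have : Real.sin (2 * p * x) = 2 * Real.sin (p * x) * Real.cos (p * x) := by
      rw [mul_assoc, Real.sin_two_mul]
    rw [this]
    field_simp
    ring
  rw [intervalIntegral.integral_eq_sub_of_hasDerivAt (fun x _ => h1 x)
    (Continuous.intervalIntegrable (by fun_prop) _ _)]
  simp [h]

/-! ### The orthonormal families -/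

theorem hasDerivAt_phi1 (n : ℕ) (x : ℝ) :
    HasDerivAt (phi1 n) (-(freq1 n * sin1 n x)) x := by
  refine ((hasDerivAt_cos_mul (((n : ℝ) + 1 / 2) * Real.pi) x).const_mul (Real.sqrt 2)).congr_deriv ?_
  simp only [sin1, freq1]; ring

theorem hasDerivAt_deriv_phi1 (n : ℕ) (x : ℝ) :
    HasDerivAt (fun x => -(freq1 n * sin1 n x)) (-(freq1 n) ^ 2 * phi1 n x) x := by
  refine (((hasDerivAt_sin_mul (freq1 n) x).const_mul (Real.sqrt 2)).const_mul (freq1 n)).neg.congr_deriv ?_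
  simp only [phi1, freq1]; ring

theorem hasDerivAt_psi2 (m : ℕ) (x : ℝ) :
    HasDerivAt (psi2 m) (-(mu m * ((m : ℝ) * Real.pi * Real.sin ((m : ℝ) * Real.pi * x)))) x := by
  refine ((hasDerivAt_cos_mul ((m : ℝ) * Real.pi) x).const_mul (mu m)).congr_deriv ?_
  ring

theorem hasDerivAt_deriv_psi2 (m : ℕ) (x : ℝ) :
    HasDerivAt (fun x => -(mu m * ((m : ℝ) * Real.pi * Real.sin ((m : ℝ) * Real.pi * x))))
      (-((m : ℝ) * Real.pi) ^ 2 * psi2 m x) x := by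
  refine (((hasDerivAt_sin_mul ((m : ℝ) * Real.pi) x).const_mul ((m : ℝ) * Real.pi)).const_mul
    (mu m)).neg.congr_deriv ?_
  simp only [psi2]; ring

theorem cos_freq1 (n : ℕ) : Real.cos (freq1 n) = 0 := by
  rw [Real.cos_eq_zero_iff]
  exact ⟨n, by unfold freq1; push_cast; ring⟩

theorem abs_sin_freq1 (n : ℕ) : |Real.sin (freq1 n)| = 1 := by
  have h := Real.sin_sq_add_cos_sq (freq1 n)
  rw [cos_freq1] at h
  rw [← sq_eq_sq₀ (abs_nonneg _) zero_le_one, sq_abs]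
  linarith

theorem phi1_one (n : ℕ) : phi1 n 1 = 0 := by
  have := cos_freq1 n
  unfold freq1 at this
  simp only [phi1, mul_one, this, mul_zero]

theorem phi1_zero (n : ℕ) : phi1 n 0 = Real.sqrt 2 := by simp [phi1]
theorem sin1_zero (n : ℕ) : sin1 n 0 = 0 := by simp [sin1]
theorem psi2_apply_zero (m : ℕ) : psi2 m 0 = mu m := by simp [psi2]

theorem lam1_eq (a : ℝ) (n : ℕ) : lam1 a n = a - freq1 n ^ 2 := by
  unfold lam1 freq1; ring

theorem lam2_eq (b : ℝ) (m : ℕ) : lam2 b m = b - ((m : ℝ) * Real.pi) ^ 2 := by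
  unfold lam2; ring

theorem contDiff_phi1 (n : ℕ) : ContDiff ℝ ∞ (phi1 n) := by
  unfold phi1; fun_prop

theorem contDiff_psi2 (m : ℕ) : ContDiff ℝ ∞ (psi2 m) := by
  unfold psi2; fun_prop

/-! ### The functions `phi2` and `psi1` -/

theorem phi2_of_mem {a b s : ℝ} {k m : ℕ} (h : (k, m) ∈ Delta a b) :
    phi2 a b s m = fun x => s * mu m / freq1 k * ((1 - x) * Real.sin (freq1 k * x)) := by
  ext x
  have hex : ∃ k : ℕ, (k, m) ∈ Delta a b := ⟨k, h⟩
  have hk : hex.choose = k := Delta_fst_unique hex.choose_spec h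
  rw [phi2, dif_pos hex, hk]
  simp only [freq1]; ring

/-- The common description of the four formulas for `phi2`, the only one used off resonance. The
residue `R` is zero off resonance and a multiple of `phi1 k` when `(k, m) ∈ Delta a b`, so it is
orthogonal to every `phi1 n` not resonant with `m`. -/
theorem exists_phi2_ode (a b s : ℝ) (m : ℕ) : ∃ F' R : ℝ → ℝ,
    (∀ x, HasDerivAt (phi2 a b s m) (F' x) x) ∧
    (∀ x, HasDerivAt F' ((lam2 b m - a) * phi2 a b s m x + R x) x) ∧ Continuous R ∧
    phi2 a b s m 1 = 0 ∧ F' 0 = s * mu m ∧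
    ∀ n, (n, m) ∉ Delta a b → pairing R (phi1 n) = 0 := by
  by_cases h : ∃ k : ℕ, (k, m) ∈ Delta a b
  · obtain ⟨k, hk⟩ := h
    have hp := (freq1_pos k).ne'
    have hlam : lam2 b m - a = -freq1 k ^ 2 := by
      rw [← mem_Delta_iff.1 hk, lam1_eq]; ring
    rw [phi2_of_mem hk]
    refine ⟨fun x => s * mu m / freq1 k * (-Real.sin (freq1 k * x)
      + (1 - x) * (freq1 k * Real.cos (freq1 k * x))),
      fun x => -(Real.sqrt 2 * s * mu m) * phi1 k x,
      fun x => (hasDerivAt_one_sub_mul_sin _ x).const_mul _,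
      fun x => ((hasDerivAt_deriv_one_sub_mul_sin _ x).const_mul _).congr_deriv ?_,
      by have := continuous_phi1 k; fun_prop, by simp, ?_, fun n hn => ?_⟩
    · rw [hlam]
      have := Real.mul_self_sqrt (show (0 : ℝ) ≤ 2 by norm_num)
      simp only [phi1]
      rw [← freq1]
      field_simp
      linear_combination (s * mu m * Real.cos (freq1 k * x)) * this
    · simp; field_simp
    · rw [pairing_comm, pairing_const_mul_right, pairing_phi1_phi1, if_neg, mul_zero]
      rintro rfl; exact hn hk
  · have hR : ∀ n, (n, m) ∉ Delta a b → pairing (fun _ => (0 : ℝ)) (phi1 n) = 0 := by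
      intro n _; simp [pairing]
    by_cases h0 : lam2 b m - a = 0
    · have he : phi2 a b s m = fun x => s * mu m * (-1 + x) := by
        ext x; rw [phi2, dif_neg h, if_pos h0]
      rw [he, h0]
      refine ⟨fun _ => s * mu m, fun _ => 0, fun x => ?_, fun x => ?_, continuous_const, by simp,
        rfl, hR⟩
      · exact (((hasDerivAt_id x).const_add (-1)).const_mul (s * mu m)).congr_deriv (by ring)
      · simpa using hasDerivAt_const x (s * mu m)
    by_cases h1 : 0 < lam2 b m - a
    · set r := Real.sqrt (lam2 b m - a) with hr
      have hr0 : r ≠ 0 := (Real.sqrt_pos.2 h1).ne'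
      have hr2 : lam2 b m - a = r ^ 2 := (Real.sq_sqrt h1.le).symm
      have hch := (Real.cosh_pos r).ne'
      have he : phi2 a b s m = fun x => -(s * mu m / (r * Real.cosh r)) * Real.sinh (r * (1 - x)) := by
        ext x; rw [phi2, dif_neg h, if_neg h0, if_pos h1]
      rw [he, hr2]
      refine ⟨fun x => (s * mu m / (r * Real.cosh r)) * (r * Real.cosh (r * (1 - x))), fun _ => 0,
        fun x => ?_, fun x => ?_, continuous_const, by simp, by simp; field_simp, hR⟩
      · exact ((hasDerivAt_mul_one_sub r x).sinh.const_mul _).congr_deriv (by ring)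
      · exact (((hasDerivAt_mul_one_sub r x).cosh.const_mul r).const_mul _).congr_deriv (by ring)
    · have h2 : 0 < a - lam2 b m := by
        rcases lt_or_gt_of_ne h0 with h3 | h3
        · linarith
        · exact absurd h3 h1
      set r := Real.sqrt (a - lam2 b m) with hr
      have hrp : 0 < r := Real.sqrt_pos.2 h2
      have hr0 : r ≠ 0 := hrp.ne'
      have hr2 : a - lam2 b m = r ^ 2 := (Real.sq_sqrt h2.le).symm
      have hr3 : lam2 b m - a = - r ^ 2 := by linarith
      -- A zero of `cos` at `r > 0` would force `r = freq1 k`, that is, a resonance.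
      have hch : Real.cos r ≠ 0 := by
        intro hc
        obtain ⟨k, hk⟩ := Real.cos_eq_zero_iff.1 hc
        have hpi := Real.pi_pos
        have hk0 : 0 ≤ k := by
          by_contra hneg
          have h3 : (k : ℝ) ≤ -1 := by exact_mod_cast (by omega : k ≤ -1)
          nlinarith
        lift k to ℕ using hk0
        refine h ⟨k, mem_Delta_iff.2 ?_⟩
        have : r = freq1 k := by rw [hk, freq1]; push_cast; ring
        rw [lam1_eq, ← this, ← hr2]; ring
      have he : phi2 a b s m = fun x => -(s * mu m / (r * Real.cos r)) * Real.sin (r * (1 - x)) := by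
        ext x; rw [phi2, dif_neg h, if_neg h0, if_neg h1]
      rw [he, hr3]
      refine ⟨fun x => (s * mu m / (r * Real.cos r)) * (r * Real.cos (r * (1 - x))), fun _ => 0,
        fun x => ?_, fun x => ?_, continuous_const, by simp, by simp; field_simp, hR⟩
      · exact ((hasDerivAt_mul_one_sub r x).sin.const_mul _).congr_deriv (by ring)
      · exact (((hasDerivAt_mul_one_sub r x).cos.const_mul r).const_mul _).congr_deriv (by ring)

theorem psi1_of_mem_zero {a b s : ℝ} {n : ℕ} (h : (n, 0) ∈ Delta a b) :
    psi1 a b s n = fun x => -(s * Real.sqrt 2 * (1 / 3 + 1 / ((2 * (n : ℝ) + 1) ^ 2 * Real.pi ^ 2)))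
        + Real.sqrt 2 * s * x - Real.sqrt 2 / 2 * s * x ^ 2 := by
  ext x
  have hex : ∃ k : ℕ, (n, k) ∈ Delta a b := ⟨0, h⟩
  have hk : hex.choose = 0 := Delta_snd_unique hex.choose_spec h
  rw [psi1, dif_pos hex, if_pos hk]

theorem psi1_of_mem {a b s : ℝ} {n k : ℕ} (h : (n, k) ∈ Delta a b) (hk : k ≠ 0) :
    psi1 a b s n = fun x => Real.sqrt 2 * s / ((k : ℝ) * Real.pi) *
        ((1 - x) * Real.sin ((k : ℝ) * Real.pi * x))
      + -(2 * s / Real.pi ^ 2 * (1 / (2 * (n : ℝ) + 1) ^ 2 + 1 / (4 * (k : ℝ) ^ 2))) * psi2 k x := by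
  ext x
  have hex : ∃ k : ℕ, (n, k) ∈ Delta a b := ⟨k, h⟩
  have hk' : hex.choose = k := Delta_snd_unique hex.choose_spec h
  rw [psi1, dif_pos hex, hk', if_neg hk, psi2_of_ne_zero hk]
  ring

/-- The same device for `psi1`. The boundary values are those that make (`phi1 n`, `psi1 n`) a test
pair, and the residue `R` produces the off-diagonal entries of `A₁`. -/
theorem exists_psi1_ode (a b s : ℝ) (n : ℕ) : ∃ G' R : ℝ → ℝ,
    ContDiff ℝ ∞ (psi1 a b s n) ∧
    (∀ x, HasDerivAt (psi1 a b s n) (G' x) x) ∧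
    (∀ x, HasDerivAt G' ((lam1 a n - b) * psi1 a b s n x + R x) x) ∧ Continuous R ∧
    G' 1 = 0 ∧ G' 0 = s * Real.sqrt 2 ∧
    ((∃ k, (n, k) ∈ Delta a b ∧ R = fun x => -(Real.sqrt 2 * s * mu k) * psi2 k x) ∨
      ((∀ k, (n, k) ∉ Delta a b) ∧ R = fun _ => 0)) := by
  by_cases h : ∃ k : ℕ, (n, k) ∈ Delta a b
  · obtain ⟨k, hk⟩ := h
    have hlam : lam1 a n - b = -((k : ℝ) * Real.pi) ^ 2 := by
      rw [mem_Delta_iff.1 hk, lam2_eq]; ring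
    rw [hlam]
    rcases eq_or_ne k 0 with rfl | hk0
    · rw [psi1_of_mem_zero hk]
      refine ⟨fun x => Real.sqrt 2 * s - Real.sqrt 2 * s * x, _, by fun_prop, fun x => ?_,
        fun x => ?_, ?_, by ring, by ring, Or.inl ⟨0, hk, rfl⟩⟩
      · exact ((((hasDerivAt_id x).const_mul (Real.sqrt 2 * s)).const_add _).sub
          ((hasDerivAt_pow 2 x).const_mul (Real.sqrt 2 / 2 * s))).congr_deriv (by
            simp; ring)
      · exact (((hasDerivAt_id x).const_mul (Real.sqrt 2 * s)).const_sub _).congr_deriv (by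
          simp [psi2_zero, mu])
      · have := continuous_psi2 0; fun_prop
    · rw [psi1_of_mem hk hk0]
      set q : ℝ := (k : ℝ) * Real.pi with hq
      have hq0 : q ≠ 0 := mul_ne_zero (by exact_mod_cast hk0) Real.pi_ne_zero
      refine ⟨fun x => Real.sqrt 2 * s / q * (-Real.sin (q * x)
        + (1 - x) * (q * Real.cos (q * x))) + _ * -(mu k * (q * Real.sin (q * x))), _, ?_,
        fun x => ((hasDerivAt_one_sub_mul_sin q x).const_mul _).add
          ((hasDerivAt_psi2 k x).const_mul _),
        fun x => (((hasDerivAt_deriv_one_sub_mul_sin q x).const_mul _).add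
          ((hasDerivAt_deriv_psi2 k x).const_mul _)).congr_deriv ?_,
        ?_, ?_, ?_, Or.inl ⟨k, hk, rfl⟩⟩
      · have := contDiff_psi2 k
        fun_prop
      · have := Real.mul_self_sqrt (show (0 : ℝ) ≤ 2 by norm_num)
        simp only [psi2_of_ne_zero hk0, mu, if_neg hk0]
        rw [← hq]
        field_simp
        linear_combination (4 * (2 * (n : ℝ) + 1) ^ 2 * s * k ^ 2 * Real.pi ^ 2 *
          Real.cos (q * x)) * this
      · have := continuous_psi2 k; fun_prop
      · have : Real.sin (q * 1) = 0 := by rw [mul_one, hq, Real.sin_nat_mul_pi]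
        simp only [this]; ring
      · simp; field_simp
  · have hnot : ∀ k, (n, k) ∉ Delta a b := fun k hk => h ⟨k, hk⟩
    by_cases h1 : 0 < lam1 a n - b
    · set r := Real.sqrt (lam1 a n - b) with hr
      have hrp : 0 < r := Real.sqrt_pos.2 h1
      have hr0 : r ≠ 0 := hrp.ne'
      have hr2 : lam1 a n - b = r ^ 2 := (Real.sq_sqrt h1.le).symm
      have hch : Real.sinh r ≠ 0 := (Real.sinh_pos_iff.2 hrp).ne'
      have he : psi1 a b s n = fun x => -(Real.sqrt 2 * s / (r * Real.sinh r))
          * Real.cosh (r * (1 - x)) := by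
        ext x; rw [psi1, dif_neg h, if_pos h1]
      rw [he, hr2]
      refine ⟨fun x => (Real.sqrt 2 * s / (r * Real.sinh r)) * (r * Real.sinh (r * (1 - x))),
        fun _ => 0, ?_, fun x => ?_, fun x => ?_, continuous_const, by simp,
        by simp; field_simp, Or.inr ⟨hnot, rfl⟩⟩
      · exact contDiff_const.mul (Real.contDiff_cosh.comp (by fun_prop))
      · exact ((hasDerivAt_mul_one_sub r x).cosh.const_mul _).congr_deriv (by ring)
      · exact (((hasDerivAt_mul_one_sub r x).sinh.const_mul r).const_mul _).congr_deriv (by ring)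
    · have hr2' : 0 ≤ b - lam1 a n := by linarith
      set r := Real.sqrt (b - lam1 a n) with hr
      have hr2 : b - lam1 a n = r ^ 2 := (Real.sq_sqrt hr2').symm
      have hrn : 0 ≤ r := Real.sqrt_nonneg _
      -- A zero would force `r = kπ`, a resonance. The value `k = 0` covers `lam1 a n = b`, so
      -- `psi1` needs no separate branch for `r = 0`.
      have hch : Real.sin r ≠ 0 := by
        intro hc
        obtain ⟨k, hk⟩ := Real.sin_eq_zero_iff.1 hc
        have hpi := Real.pi_pos
        have hk0 : 0 ≤ k := by
          by_contra hneg
          have h3 : (k : ℝ) ≤ -1 := by exact_mod_cast (by omega : k ≤ -1)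
          nlinarith
        lift k to ℕ using hk0
        refine h ⟨k, mem_Delta_iff.2 ?_⟩
        push_cast at hk
        rw [lam2_eq, hk, ← hr2]; ring
      have hr0 : r ≠ 0 := by
        intro h0; rw [h0] at hch; simp at hch
      have he : psi1 a b s n = fun x => Real.sqrt 2 * s / (r * Real.sin r)
          * Real.cos (r * (1 - x)) := by
        ext x; rw [psi1, dif_neg h, if_neg h1]
      have hr3 : lam1 a n - b = - r ^ 2 := by linarith
      rw [he, hr3]
      refine ⟨fun x => (Real.sqrt 2 * s / (r * Real.sin r)) * (r * Real.sin (r * (1 - x))),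
        fun _ => 0, by fun_prop, fun x => ?_, fun x => ?_, continuous_const, by simp,
        by simp; field_simp, Or.inr ⟨hnot, rfl⟩⟩
      · exact ((hasDerivAt_mul_one_sub r x).cos.const_mul _).congr_deriv (by ring)
      · exact (((hasDerivAt_mul_one_sub r x).sin.const_mul r).const_mul _).congr_deriv (by ring)

theorem contDiff_psi1 (a b s : ℝ) (n : ℕ) : ContDiff ℝ ∞ (psi1 a b s n) := by
  obtain ⟨_, _, h, _⟩ := exists_psi1_ode a b s n
  exact h

theorem continuous_psi1 (a b s : ℝ) (n : ℕ) : Continuous (psi1 a b s n) :=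
  (contDiff_psi1 a b s n).continuous

theorem continuous_phi2 (a b s : ℝ) (m : ℕ) : Continuous (phi2 a b s m) := by
  obtain ⟨_, _, h, _⟩ := exists_phi2_ode a b s m
  exact continuous_iff_continuousAt.2 fun x => (h x).continuousAt

/-! ### Biorthogonality -/

theorem continuous_coeff_add {f R : ℝ → ℝ} (c : ℝ) (hf : Continuous f) (hR : Continuous R) :
    Continuous fun x => c * f x + R x := by fun_prop

theorem pairing_add_of_continuous {f g h : ℝ → ℝ} (hf : Continuous f) (hg : Continuous g)
    (hh : Continuous h) : pairing f (fun x => g x + h x) = pairing f g + pairing f h := by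
  rw [← pairing_toL2_left hf, ← pairing_toL2_left hf, ← pairing_toL2_left hf,
    pairing_add_right _ hg hh]

theorem pairing_lincomb_left {f g h : ℝ → ℝ} (c : ℝ) (hf : Continuous f) (hg : Continuous g)
    (hh : Continuous h) : pairing (fun x => c * g x + h x) f = c * pairing g f + pairing h f := by
  rw [pairing_comm, pairing_add_of_continuous hf (by fun_prop) hh, pairing_const_mul_right,
    pairing_comm f g, pairing_comm f h]

/-- In Green's formula only the boundary term `F'(0) * phi1 n 0` survives. -/
theorem pairing_phi2_phi1_of_not_mem {a b s : ℝ} {n m : ℕ} (h : (n, m) ∉ Delta a b) :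
    (lam2 b m - lam1 a n) * pairing (phi2 a b s m) (phi1 n) = -(s * mu m * Real.sqrt 2) := by
  obtain ⟨F', R, hF, hF', hR, h1, h0, hor⟩ := exists_phi2_ode a b s m
  have cF := continuous_phi2 a b s m
  have cphi := continuous_phi1 n
  have hg := green hF hF' (hasDerivAt_phi1 n) (hasDerivAt_deriv_phi1 n)
    (continuous_coeff_add _ cF hR) (by fun_prop)
  rw [pairing_lincomb_left _ cphi cF hR, hor n h, pairing_const_mul_right, h0, h1, phi1_one,
    phi1_zero, sin1_zero] at hg
  rw [lam1_eq]
  linear_combination hg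

theorem pairing_psi1_psi2_of_not_mem {a b s : ℝ} {n m : ℕ} (h : (n, m) ∉ Delta a b) :
    (lam1 a n - lam2 b m) * pairing (psi1 a b s n) (psi2 m) = -(s * mu m * Real.sqrt 2) := by
  obtain ⟨G', R, -, hG, hG', hR, h1, h0, hor⟩ := exists_psi1_ode a b s n
  have cG := continuous_psi1 a b s n
  have cpsi := continuous_psi2 m
  have hg := green hG hG' (hasDerivAt_psi2 m) (hasDerivAt_deriv_psi2 m)
    (continuous_coeff_add _ cG hR) (by fun_prop)
  have hRo : pairing R (psi2 m) = 0 := by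
    rcases hor with ⟨k, hk, rfl⟩ | ⟨-, rfl⟩
    · rw [pairing_comm, pairing_const_mul_right, pairing_psi2_psi2, if_neg, mul_zero]
      rintro rfl; exact h hk
    · simp [pairing]
  have hs1 : Real.sin ((m : ℝ) * Real.pi * 1) = 0 := by rw [mul_one, Real.sin_nat_mul_pi]
  rw [pairing_lincomb_left _ cpsi cG hR, hRo, pairing_const_mul_right, h0, h1, psi2_apply_zero,
    hs1] at hg
  rw [lam2_eq]
  simp only [mul_zero, Real.sin_zero] at hg
  linear_combination hg

theorem sin_two_mul_freq1 (n : ℕ) : Real.sin (2 * freq1 n) = 0 := by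
  rw [Real.sin_two_mul, cos_freq1, mul_zero]

theorem freq1_sq (n : ℕ) : (2 * (n : ℝ) + 1) ^ 2 * Real.pi ^ 2 = 4 * freq1 n ^ 2 := by
  unfold freq1; ring

/-- At resonance the factor `lam2 b m - lam1 a n` vanishes and Green's formula carries no
information, so the integral is computed explicitly. -/
theorem pairing_phi2_phi1_of_mem {a b s : ℝ} {n m : ℕ} (h : (n, m) ∈ Delta a b) :
    pairing (phi2 a b s m) (phi1 n) = Real.sqrt 2 * s * mu m / (4 * freq1 n ^ 2) := by
  have hp := (freq1_pos n).ne'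
  have hi := integral_one_sub_mul_sin_mul_cos hp (sin_two_mul_freq1 n)
  have : ∀ x, s * mu m / freq1 n * ((1 - x) * Real.sin (freq1 n * x)) * phi1 n x
      = s * mu m / freq1 n * Real.sqrt 2 *
        ((1 - x) * Real.sin (freq1 n * x) * Real.cos (freq1 n * x)) := by
    intro x; simp only [phi1, freq1]; ring
  rw [pairing_eq_intervalIntegral, phi2_of_mem h]
  simp only [this]
  rw [intervalIntegral.integral_const_mul, hi]
  field_simp

/-- The multiple of `psi2 m` contained in `psi1` is tuned to give exactly this value, opposite to
the one of `pairing_phi2_phi1_of_mem`. -/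
theorem pairing_psi1_psi2_of_mem {a b s : ℝ} {n m : ℕ} (h : (n, m) ∈ Delta a b) :
    pairing (psi1 a b s n) (psi2 m) = -(Real.sqrt 2 * s * mu m / (4 * freq1 n ^ 2)) := by
  have hp := (freq1_pos n).ne'
  have h2 := Real.mul_self_sqrt (show (0 : ℝ) ≤ 2 by norm_num)
  rcases eq_or_ne m 0 with rfl | hm
  · rw [psi1_of_mem_zero h, psi2_zero, pairing_eq_intervalIntegral, freq1_sq]
    have hd : ∀ x : ℝ, HasDerivAt (fun x => -(s * Real.sqrt 2 * (1 / 3 + 1 / (4 * freq1 n ^ 2))) * x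
        + Real.sqrt 2 * s / 2 * x ^ 2 - Real.sqrt 2 / 6 * s * x ^ 3)
        ((-(s * Real.sqrt 2 * (1 / 3 + 1 / (4 * freq1 n ^ 2)))
          + Real.sqrt 2 * s * x - Real.sqrt 2 / 2 * s * x ^ 2) * 1) x := by
      intro x
      refine ((((hasDerivAt_id x).const_mul _).add ((hasDerivAt_pow 2 x).const_mul _)).sub
        ((hasDerivAt_pow 3 x).const_mul _)).congr_deriv ?_
      simp; ring
    rw [intervalIntegral.integral_eq_sub_of_hasDerivAt (fun x _ => hd x)
      (Continuous.intervalIntegrable (by fun_prop) _ _)]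
    simp only [mu, if_true]
    field_simp
    ring
  · have hm' : (m : ℝ) ≠ 0 := by exact_mod_cast hm
    have hpi := Real.pi_ne_zero
    have hq0 : (m : ℝ) * Real.pi ≠ 0 := mul_ne_zero hm' hpi
    have hsin : Real.sin (2 * ((m : ℝ) * Real.pi)) = 0 := by
      rw [Real.sin_two_mul, Real.sin_nat_mul_pi]; ring
    have hi := integral_one_sub_mul_sin_mul_cos hq0 hsin
    have h1 : pairing (fun x => (1 - x) * Real.sin ((m : ℝ) * Real.pi * x)) (psi2 m)
        = Real.sqrt 2 * (1 / (4 * ((m : ℝ) * Real.pi))) := by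
      rw [← hi, pairing_eq_intervalIntegral, ← intervalIntegral.integral_const_mul,
        psi2_of_ne_zero hm]
      refine intervalIntegral.integral_congr fun x _ => ?_
      ring
    have cpsi := continuous_psi2 m
    rw [psi1_of_mem h hm, pairing_lincomb_left _ cpsi (by fun_prop) (by fun_prop), h1,
      pairing_comm, pairing_const_mul_right, pairing_psi2_psi2, if_pos rfl]
    have hf : freq1 n = (2 * (n : ℝ) + 1) * Real.pi / 2 := by unfold freq1; ring
    have hn : (2 * (n : ℝ) + 1) ≠ 0 := by positivity
    rw [hf, mu, if_neg hm]
    field_simp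
    linear_combination (s * (4 * (m : ℝ) ^ 2 + (2 * (n : ℝ) + 1) ^ 2)) * h2

/-- Orthogonality of the vectors (`phi2`, `psi2 m`) and (`phi1 n`, `psi1`), written componentwise.
It identifies `c2` in `exists_measurement`. -/
theorem biorthogonal (a b s : ℝ) (n m : ℕ) :
    pairing (psi1 a b s n) (psi2 m) = -pairing (phi2 a b s m) (phi1 n) := by
  by_cases h : (n, m) ∈ Delta a b
  · rw [pairing_phi2_phi1_of_mem h, pairing_psi1_psi2_of_mem h]
  · have h1 := pairing_phi2_phi1_of_not_mem (s := s) h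
    have h2 := pairing_psi1_psi2_of_not_mem (s := s) h
    have h3 : lam1 a n - lam2 b m ≠ 0 := fun h0 => h (mem_Delta_iff.2 (sub_eq_zero.1 h0))
    refine mul_left_cancel₀ h3 ?_
    linear_combination h2 - h1

/-! ### Asymptotics of `psi1` -/

theorem add_one_le_freq1 (n : ℕ) : (n : ℝ) + 1 ≤ freq1 n := by
  have := Real.pi_gt_three
  have hn : (0 : ℝ) ≤ n := Nat.cast_nonneg n
  unfold freq1; nlinarith

theorem freq1_le (n : ℕ) : freq1 n ≤ 4 * ((n : ℝ) + 1) := by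
  have := Real.pi_le_four
  have hn : (0 : ℝ) ≤ n := Nat.cast_nonneg n
  unfold freq1; nlinarith

/-- Since `ρ² = freq1 n ^ 2 + b - a`, the frequency `ρ` approaches `freq1 n`, where `|sin| = 1`. The
denominator `ρ sin ρ` of `psi1` thus grows linearly. -/
theorem exists_psi1_eq_cos {a b : ℝ} (s : ℝ) {N₀ : ℕ} (hΔ : ∀ n m, (n, m) ∈ Delta a b → n ≤ N₀) :
    ∃ n₁ : ℕ, ∀ n, n₁ ≤ n → ∃ ρ A : ℝ, (psi1 a b s n = fun x => A * Real.cos (ρ * (1 - x))) ∧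
      (n : ℝ) + 1 ≤ ρ ∧ |A| ≤ 2 * Real.sqrt 2 * |s| / ((n : ℝ) + 1) := by
  -- The term `N₀ + 1` excludes resonance; the other gives `ρ + freq1 n ≥ 2|b - a|`, hence `|ρ -
  -- freq1 n| ≤ 1/2` and `|sin ρ| ≥ 1/2`.
  refine ⟨N₀ + 1 + ⌈2 * |b - a|⌉₊, fun n hn => ?_⟩
  have hn1 : 2 * |b - a| ≤ n := (Nat.le_ceil _).trans (by exact_mod_cast (by omega))
  have hnot : ¬ ∃ k, (n, k) ∈ Delta a b := by
    rintro ⟨k, hk⟩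
    have := hΔ n k hk; omega
  have hba := abs_nonneg (b - a)
  have hn0 : (0 : ℝ) ≤ n := Nat.cast_nonneg n
  have hp : 3 * ((n : ℝ) + 1 / 2) ≤ freq1 n := by
    have := Real.pi_gt_three
    unfold freq1; nlinarith
  have hlow := neg_abs_le (b - a)
  have hsq : ((n : ℝ) + 1) ^ 2 ≤ b - lam1 a n := by
    rw [lam1_eq]
    have : (3 * ((n : ℝ) + 1 / 2)) ^ 2 ≤ freq1 n ^ 2 := pow_le_pow_left₀ (by positivity) hp 2
    nlinarith
  have hpos : 0 < b - lam1 a n := lt_of_lt_of_le (by positivity) hsq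
  set ρ := Real.sqrt (b - lam1 a n) with hρ
  have hρ1 : (n : ℝ) + 1 ≤ ρ := Real.le_sqrt_of_sq_le hsq
  have hρ2 : ρ ^ 2 = b - lam1 a n := Real.sq_sqrt hpos.le
  have hdiff : |ρ - freq1 n| ≤ 1 / 2 := by
    have h1 : (ρ - freq1 n) * (ρ + freq1 n) = b - a := by
      rw [lam1_eq] at hρ2; linear_combination hρ2
    have h2 : |ρ - freq1 n| * (ρ + freq1 n) = |b - a| := by
      rw [← h1, abs_mul, abs_of_pos (show 0 < ρ + freq1 n by linarith)]
    have h3 : 2 * |b - a| ≤ ρ + freq1 n := by linarith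
    by_contra hc
    push Not at hc
    nlinarith [freq1_pos n]
  have hsin : 1 / 2 ≤ |Real.sin ρ| := by
    have h1 := Real.abs_sin_sub_sin_le (freq1 n) ρ
    rw [abs_sub_comm (freq1 n)] at h1
    have h2 := abs_sub_abs_le_abs_sub (Real.sin (freq1 n)) (Real.sin ρ)
    rw [abs_sin_freq1] at h2
    linarith
  refine ⟨ρ, Real.sqrt 2 * s / (ρ * Real.sin ρ), ?_, hρ1, ?_⟩
  · ext x
    rw [psi1, dif_neg hnot, if_neg (by linarith)]
  · have hρ0 : 0 < ρ := by linarith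
    rw [abs_div, abs_mul, abs_mul, abs_of_pos hρ0, abs_of_nonneg (Real.sqrt_nonneg 2),
      div_le_div_iff₀ (by positivity) (by positivity)]
    have h3 : ((n : ℝ) + 1) ≤ 2 * (ρ * |Real.sin ρ|) := by nlinarith
    have := mul_le_mul_of_nonneg_left h3 (show 0 ≤ Real.sqrt 2 * |s| by positivity)
    linarith

theorem exists_bound_of_eventually {B : ℕ → ℝ} {C : ℝ} (j n₁ : ℕ)
    (h : ∀ n, n₁ ≤ n → B n ≤ C / ((n : ℝ) + 1) ^ j) :
    ∃ C', 0 ≤ C' ∧ ∀ n, B n ≤ C' / ((n : ℝ) + 1) ^ j := by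
  have hs : ∀ n ∈ Finset.range n₁, 0 ≤ |B n| * ((n : ℝ) + 1) ^ j := fun n _ => by positivity
  refine ⟨|C| + ∑ n ∈ Finset.range n₁, |B n| * ((n : ℝ) + 1) ^ j,
    add_nonneg (abs_nonneg _) (Finset.sum_nonneg hs), fun n => ?_⟩
  rcases le_or_gt n₁ n with hn | hn
  · refine (h n hn).trans ?_
    gcongr
    linarith [le_abs_self C, Finset.sum_nonneg hs]
  · rw [le_div_iff₀ (by positivity)]
    have h1 := Finset.single_le_sum hs (Finset.mem_range.2 hn)
    have h2 : B n * ((n : ℝ) + 1) ^ j ≤ |B n| * ((n : ℝ) + 1) ^ j := by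
      gcongr; exact le_abs_self _
    linarith [abs_nonneg C]

theorem exists_norm_psi1_le {a b : ℝ} (s : ℝ) {N₀ : ℕ} (hΔ : ∀ n m, (n, m) ∈ Delta a b → n ≤ N₀) :
    ∃ C, 0 ≤ C ∧ ∀ n : ℕ, ‖toL2 (psi1 a b s n)‖ ≤ C / ((n : ℝ) + 1) := by
  obtain ⟨n₁, h⟩ := exists_psi1_eq_cos s hΔ
  obtain ⟨C, hC, hb⟩ := exists_bound_of_eventually (B := fun n => ‖toL2 (psi1 a b s n)‖)
    (C := 2 * Real.sqrt 2 * |s|) 1 n₁ (fun n hn => by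
      obtain ⟨ρ, A, he, -, hA⟩ := h n hn
      refine norm_toL2_le (continuous_psi1 a b s n) (by positivity) fun x _ => ?_
      rw [he, abs_mul, pow_one]
      exact (mul_le_of_le_one_right (abs_nonneg _) (Real.abs_cos_le_one _)).trans hA)
  exact ⟨C, hC, fun n => by simpa using hb n⟩

theorem exists_psi1_zero_le {a b : ℝ} (s : ℝ) {N₀ : ℕ} (hΔ : ∀ n m, (n, m) ∈ Delta a b → n ≤ N₀) :
    ∃ C, 0 ≤ C ∧ ∀ n : ℕ, |psi1 a b s n 0| ≤ C := by
  obtain ⟨n₁, h⟩ := exists_psi1_eq_cos s hΔ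
  obtain ⟨C, hC, hb⟩ := exists_bound_of_eventually (B := fun n => |psi1 a b s n 0|)
    (C := 2 * Real.sqrt 2 * |s|) 0 n₁ (fun n hn => by
      obtain ⟨ρ, A, he, -, hA⟩ := h n hn
      simp only [he, abs_mul, pow_zero, div_one]
      refine (mul_le_of_le_one_right (abs_nonneg _) (Real.abs_cos_le_one _)).trans (hA.trans ?_)
      exact div_le_self (by positivity) (by linarith [Nat.cast_nonneg (α := ℝ) n]))
  exact ⟨C, hC, fun n => by simpa using hb n⟩

/-- Against an `H¹` function one integration by parts gains a second factor `1/ρ`. The primitive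
`sin(ρ(1 - x))` vanishes at 1, and `IsH1.abs_zero_le` controls the value at 0. After multiplication
by `freq1 n` the bound is still square summable, as the `H¹` estimate of `y` requires. -/
theorem exists_pairing_psi1_le {a b : ℝ} (s : ℝ) {N₀ : ℕ}
    (hΔ : ∀ n m, (n, m) ∈ Delta a b → n ≤ N₀) :
    ∃ C, 0 ≤ C ∧ ∀ (n : ℕ) (z g : L2I) (Z : ℝ → ℝ), IsH1 z Z g →
      |pairing z (psi1 a b s n)| ≤ C / ((n : ℝ) + 1) ^ 2 * (‖z‖ + ‖g‖) := by
  obtain ⟨n₁, h⟩ := exists_psi1_eq_cos s hΔ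
  -- For the finitely many small `n` the crude bound by the `L²` norm is used.
  obtain ⟨C, hC, hb⟩ := exists_bound_of_eventually
    (B := fun n => if n < n₁ then ‖toL2 (psi1 a b s n)‖ else
      4 * Real.sqrt 2 * |s| / ((n : ℝ) + 1) ^ 2)
    (C := 4 * Real.sqrt 2 * |s|) 2 n₁ (fun n hn => by simp [not_lt.2 hn])
  refine ⟨C, hC, fun n z g Z hz => ?_⟩
  have hsum : 0 ≤ ‖z‖ + ‖g‖ := by positivity
  refine le_trans ?_ (mul_le_mul_of_nonneg_right (hb n) hsum)
  split_ifs with hn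
  · refine (abs_pairing_le z (continuous_psi1 a b s n)).trans ?_
    rw [mul_comm]
    gcongr
    linarith [norm_nonneg g]
  · obtain ⟨ρ, A, he, hρ, hA⟩ := h n (not_lt.1 hn)
    have hn0 : (0 : ℝ) < (n : ℝ) + 1 := by positivity
    have hρ0 : 0 < ρ := by linarith
    have hd : ∀ x : ℝ, HasDerivAt (fun x => -(A / ρ) * Real.sin (ρ * (1 - x)))
        (A * Real.cos (ρ * (1 - x))) x := by
      intro x
      refine ((hasDerivAt_mul_one_sub ρ x).sin.const_mul _).congr_deriv ?_
      field_simp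
    have hibp := hz.integral_by_parts hd (by fun_prop)
    have hbd : ∀ x : ℝ, |-(A / ρ) * Real.sin (ρ * (1 - x))|
        ≤ 2 * Real.sqrt 2 * |s| / ((n : ℝ) + 1) ^ 2 := by
      intro x
      rw [abs_mul, abs_neg, abs_div, abs_of_pos hρ0]
      refine (mul_le_of_le_one_right (by positivity) (Real.abs_sin_le_one _)).trans ?_
      rw [sq, ← div_div]
      exact div_le_div₀ (by positivity) hA hn0 hρ
    have h1 := abs_pairing_le g (show Continuous fun x => -(A / ρ) * Real.sin (ρ * (1 - x)) by fun_prop)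
    have h2 := norm_toL2_le (show Continuous fun x => -(A / ρ) * Real.sin (ρ * (1 - x)) by fun_prop)
      (by positivity) (fun x _ => hbd x)
    have h3 := hz.abs_zero_le
    have h4 := hbd 0
    rw [he, hibp]
    simp only [sub_self, mul_zero, Real.sin_zero, zero_sub]
    set D := 2 * Real.sqrt 2 * |s| / ((n : ℝ) + 1) ^ 2 with hD
    have hD0 : 0 ≤ D := by positivity
    have e4 : 4 * Real.sqrt 2 * |s| / ((n : ℝ) + 1) ^ 2 = 2 * D := by rw [hD]; ring
    rw [e4]
    have h5 : |Z 0 * (-(A / ρ) * Real.sin (ρ * (1 - 0)))| ≤ (‖z‖ + ‖g‖) * D := by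
      rw [abs_mul]; exact mul_le_mul h3 h4 (abs_nonneg _) hsum
    have h6 : ‖g‖ * ‖toL2 fun x => -(A / ρ) * Real.sin (ρ * (1 - x))‖ ≤ ‖g‖ * D :=
      mul_le_mul_of_nonneg_left h2 (norm_nonneg _)
    refine (abs_sub _ _).trans ?_
    rw [abs_neg]
    nlinarith [mul_nonneg (norm_nonneg z) hD0, h1.trans h6]

/-! ### The input coefficients -/

theorem continuous_alpha (b : ℝ) : Continuous (alpha b) := by unfold alpha; fun_prop
theorem continuous_beta : Continuous beta := by unfold beta; fun_prop

/-- Green's formula for the lifting function, which satisfies `φ(0) = φ'(1) = 0` and `φ'(0) = 1`.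
The value `G 0` is the boundary term of the weak formulation, so this identity trades the boundary
control for the inputs `α u + β v`. -/
theorem pairing_alpha {b κ : ℝ} {G G' R : ℝ → ℝ} (hG : ∀ x, HasDerivAt G (G' x) x)
    (hG' : ∀ x, HasDerivAt G' ((κ - b) * G x + R x) x) (hR : Continuous R) (h1 : G' 1 = 0) :
    pairing (alpha b) G = -κ * pairing beta G - pairing beta R - G 0 := by
  have cG : Continuous G := continuous_iff_continuousAt.2 fun x => (hG x).continuousAt
  have d1 : ∀ x, HasDerivAt beta (-(1 - x)) x := fun x =>
    ((hasDerivAt_id x).sub ((hasDerivAt_pow 2 x).div_const 2)).neg.congr_deriv (by simp)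
  have d2 : ∀ x : ℝ, HasDerivAt (fun x : ℝ => -(1 - x)) 1 x := fun x =>
    (hasDerivAt_one_sub x).neg.congr_deriv (by simp)
  have hg := green d1 d2 hG hG' continuous_const (continuous_coeff_add _ cG hR)
  rw [pairing_add_of_continuous continuous_beta (by fun_prop) hR, pairing_const_mul_right, h1] at hg
  have ha : alpha b = fun x => -b * beta x + -1 := by
    ext x; simp only [alpha, beta]; ring
  have h2 : pairing (fun _ => (-1 : ℝ)) G = -pairing (fun _ => 1) G := by
    rw [pairing_comm, show (fun _ : ℝ => (-1 : ℝ)) = fun _ => (-1 : ℝ) * 1 by simp,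
      pairing_const_mul_right, pairing_comm]; ring
  rw [ha, pairing_lincomb_left _ cG continuous_beta continuous_const, h2]
  have b1 : beta 0 = 0 := by simp [beta]
  rw [b1] at hg
  linear_combination -hg

theorem alpha1_of_mem {a b : ℝ} (s : ℝ) {n k : ℕ} (h : (n, k) ∈ Delta a b) :
    alpha1 a b s n = -lam1 a n * beta1 a b s n + Real.sqrt 2 * s * mu k * beta2 k
      - psi1 a b s n 0 := by
  obtain ⟨G', R, -, hG, hG', hR, h1, h0, hor⟩ := exists_psi1_ode a b s n
  rw [alpha1, pairing_alpha hG hG' hR h1]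
  rcases hor with ⟨j, hj, rfl⟩ | ⟨hn, -⟩
  · obtain rfl := Delta_snd_unique h hj
    rw [pairing_const_mul_right, beta1, beta2]; ring
  · exact absurd h (hn k)

theorem alpha1_of_not_mem {a b : ℝ} (s : ℝ) {n : ℕ} (h : ∀ k, (n, k) ∉ Delta a b) :
    alpha1 a b s n = -lam1 a n * beta1 a b s n - psi1 a b s n 0 := by
  obtain ⟨G', R, -, hG, hG', hR, h1, h0, hor⟩ := exists_psi1_ode a b s n
  rw [alpha1, pairing_alpha hG hG' hR h1]
  rcases hor with ⟨j, hj, rfl⟩ | ⟨-, rfl⟩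
  · exact absurd hj (h j)
  · rw [pairing_zero_right, beta1]; ring

theorem alpha2_eq (b : ℝ) (m : ℕ) : alpha2 b m = -lam2 b m * beta2 m - mu m := by
  have hs : Real.sin ((m : ℝ) * Real.pi * 1) = 0 := by rw [mul_one, Real.sin_nat_mul_pi]
  rw [alpha2, pairing_alpha (κ := lam2 b m) (R := fun _ => 0) (hasDerivAt_psi2 m) (fun x =>
    (hasDerivAt_deriv_psi2 m x).congr_deriv (by rw [lam2_eq]; ring)) continuous_const
    (by simp only [hs]; ring), pairing_zero_right, psi2_apply_zero, beta2]
  ring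

theorem norm_toL2_psi2 (m : ℕ) : ‖toL2 (psi2 m)‖ = 1 :=
  (orthonormal_toL2 continuous_psi2 pairing_psi2_psi2).1 m

theorem exists_input1_le {a b : ℝ} (s : ℝ) {N₀ : ℕ}
    (hΔ : ∀ n m, (n, m) ∈ Delta a b → n ≤ N₀) :
    ∃ C, 0 ≤ C ∧ ∀ n : ℕ, |alpha1 a b s n| ≤ C ∧ |beta1 a b s n| ≤ C := by
  obtain ⟨C, hC, h⟩ := exists_norm_psi1_le s hΔ
  have key : ∀ (f : ℝ → ℝ), Continuous f → ∀ n, |pairing f (psi1 a b s n)| ≤ ‖toL2 f‖ * C := by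
    intro f hf n
    rw [← pairing_toL2_left hf]
    refine (abs_pairing_le _ (continuous_psi1 a b s n)).trans ?_
    gcongr
    exact (h n).trans (div_le_self hC (by linarith [Nat.cast_nonneg (α := ℝ) n]))
  refine ⟨(‖toL2 (alpha b)‖ + ‖toL2 beta‖) * C, by positivity, fun n => ⟨?_, ?_⟩⟩
  · refine (key _ (continuous_alpha b) n).trans ?_
    gcongr; linarith [norm_nonneg (toL2 beta)]
  · refine (key _ continuous_beta n).trans ?_
    gcongr; linarith [norm_nonneg (toL2 (alpha b))]

theorem exists_input2_le (b : ℝ) :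
    ∃ C, 0 ≤ C ∧ ∀ m : ℕ, |alpha2 b m| ≤ C ∧ |beta2 m| ≤ C := by
  have key : ∀ (f : ℝ → ℝ), Continuous f → ∀ m, |pairing f (psi2 m)| ≤ ‖toL2 f‖ := by
    intro f hf m
    rw [← pairing_toL2_left hf]
    refine (abs_pairing_le _ (continuous_psi2 m)).trans ?_
    rw [norm_toL2_psi2, mul_one]
  refine ⟨‖toL2 (alpha b)‖ + ‖toL2 beta‖, by positivity, fun m => ⟨?_, ?_⟩⟩
  · exact (key _ (continuous_alpha b) m).trans (by linarith [norm_nonneg (toL2 beta)])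
  · exact (key _ continuous_beta m).trans (by linarith [norm_nonneg (toL2 (alpha b))])

/-! ### Growth of the spectral gaps -/

/-- The gaps `-λ - δ` grow quadratically once they are positive. -/
theorem exists_gap1 {a δ : ℝ} {N₀ : ℕ} (h : lam1 a (N₀ + 1) < -δ) :
    ∃ C, 0 ≤ C ∧ ∀ n : ℕ, N₀ < n → lam1 a n < -δ ∧
      1 / (-lam1 a n - δ) ≤ C / ((n : ℝ) + 1) ^ 2 := by
  set d := -lam1 a (N₀ + 1) - δ with hd
  have hd0 : 0 < d := by linarith
  refine ⟨1 + |a + δ| / d, by positivity, fun n hn => ?_⟩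
  have hmono : lam1 a n ≤ lam1 a (N₀ + 1) := by
    rw [lam1_eq, lam1_eq]
    have h1 : freq1 (N₀ + 1) ≤ freq1 n := by
      have : ((N₀ + 1 : ℕ) : ℝ) ≤ n := by exact_mod_cast hn
      have := Real.pi_pos
      unfold freq1; gcongr
    have := pow_le_pow_left₀ (freq1_pos _).le h1 2
    linarith
  have hq : d ≤ -lam1 a n - δ := by linarith
  refine ⟨by linarith, ?_⟩
  rw [div_le_div_iff₀ (by linarith) (by positivity), one_mul]
  have h2 := pow_le_pow_left₀ (by positivity) (add_one_le_freq1 n) 2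
  have h3 : freq1 n ^ 2 = (-lam1 a n - δ) + (a + δ) := by rw [lam1_eq]; ring
  have h4 : |a + δ| ≤ |a + δ| / d * (-lam1 a n - δ) := by
    rw [div_mul_eq_mul_div, le_div_iff₀ hd0]; gcongr
  linarith [le_abs_self (a + δ)]

theorem exists_gap2 {b δ : ℝ} {M₀ : ℕ} (h : lam2 b (M₀ + 1) < -δ) :
    ∃ C, 0 ≤ C ∧ ∀ m : ℕ, M₀ < m → lam2 b m < -δ ∧
      1 / (-lam2 b m - δ) ≤ C / ((m : ℝ) + 1) ^ 2 := by
  set d := -lam2 b (M₀ + 1) - δ with hd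
  have hd0 : 0 < d := by linarith
  refine ⟨1 + |b + δ| / d, by positivity, fun m hm => ?_⟩
  have hm1 : ((M₀ + 1 : ℕ) : ℝ) ≤ m := by exact_mod_cast hm
  have hpi := Real.pi_gt_three
  have hmono : lam2 b m ≤ lam2 b (M₀ + 1) := by
    rw [lam2_eq, lam2_eq]
    have h1 : ((M₀ + 1 : ℕ) : ℝ) * Real.pi ≤ m * Real.pi := by gcongr
    have := pow_le_pow_left₀ (by positivity) h1 2
    linarith
  have hq : d ≤ -lam2 b m - δ := by linarith
  refine ⟨by linarith, ?_⟩
  rw [div_le_div_iff₀ (by linarith) (by positivity), one_mul]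
  have h0 : (m : ℝ) + 1 ≤ m * Real.pi := by
    push_cast at hm1
    nlinarith [Nat.cast_nonneg (α := ℝ) M₀]
  have h2 := pow_le_pow_left₀ (by positivity) h0 2
  have h3 : ((m : ℝ) * Real.pi) ^ 2 = (-lam2 b m - δ) + (b + δ) := by rw [lam2_eq]; ring
  have h4 : |b + δ| ≤ |b + δ| / d * (-lam2 b m - δ) := by
    rw [div_mul_eq_mul_div, le_div_iff₀ hd0]; gcongr
  linarith [le_abs_self (b + δ)]

/-- A coefficient `x` with `λ x` bounded decays like the inverse gap. -/
theorem abs_le_of_abs_mul_le {κ δ x D g : ℝ} (hδ : 0 < δ) (hκ : κ < -δ) (h : |κ * x| ≤ D)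
    (hg : 1 / (-κ - δ) ≤ g) : |x| ≤ D * g := by
  have h1 : 0 < -κ - δ := by linarith
  have h2 : (-κ - δ) * |x| ≤ D := by
    rw [abs_mul, abs_of_neg (by linarith)] at h
    nlinarith [abs_nonneg x]
  have hD : 0 ≤ D := (abs_nonneg _).trans h
  calc |x| = ((-κ - δ) * |x|) * (1 / (-κ - δ)) := by field_simp
    _ ≤ D * g := mul_le_mul h2 hg (by positivity) hD

/-- `lam1 a n * beta1 a b s n = -(alpha1 a b s n + psi1 a b s n 0)` is bounded for nonresonant `n`,
while `lam1 a n` grows quadratically. This decay is what allows the lifting to be removed again in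
the `H¹` estimate. -/
theorem exists_beta1_le {a b δ : ℝ} (s : ℝ) {N₀ : ℕ} (hδ : 0 < δ) (h : lam1 a (N₀ + 1) < -δ)
    (hΔ : ∀ n m, (n, m) ∈ Delta a b → n ≤ N₀) :
    ∃ C, 0 ≤ C ∧ ∀ n : ℕ, |beta1 a b s n| ≤ C / ((n : ℝ) + 1) ^ 2 := by
  obtain ⟨C1, hC1, h1⟩ := exists_input1_le s hΔ
  obtain ⟨C2, hC2, h2⟩ := exists_psi1_zero_le s hΔ
  obtain ⟨C3, hC3, h3⟩ := exists_gap1 h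
  refine exists_bound_of_eventually (C := (C1 + C2) * C3) 2 (N₀ + 1) fun n hn => ?_
  have hnot : ∀ k, (n, k) ∉ Delta a b := fun k hk => by have := hΔ n k hk; omega
  have h4 := alpha1_of_not_mem s hnot
  obtain ⟨h5, h6⟩ := h3 n hn
  have h7 : |lam1 a n * beta1 a b s n| ≤ C1 + C2 := by
    have : lam1 a n * beta1 a b s n = -(alpha1 a b s n + psi1 a b s n 0) := by rw [h4]; ring
    rw [this, abs_neg]
    exact (abs_add_le _ _).trans (add_le_add (h1 n).1 (h2 n))
  have := abs_le_of_abs_mul_le hδ h5 h7 h6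
  rwa [mul_div_assoc]

theorem abs_mu_le (m : ℕ) : |mu m| ≤ 2 := by
  have : Real.sqrt 2 ≤ 2 := by
    rw [Real.sqrt_le_left (by norm_num)]; norm_num
  unfold mu
  split_ifs
  · norm_num
  · rw [abs_of_nonneg (Real.sqrt_nonneg _)]; exact this

theorem exists_beta2_le {b δ : ℝ} {M₀ : ℕ} (hδ : 0 < δ) (h : lam2 b (M₀ + 1) < -δ) :
    ∃ C, 0 ≤ C ∧ ∀ m : ℕ, |beta2 m| ≤ C / ((m : ℝ) + 1) ^ 2 := by
  obtain ⟨C1, hC1, h1⟩ := exists_input2_le b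
  obtain ⟨C3, hC3, h3⟩ := exists_gap2 h
  refine exists_bound_of_eventually (C := (C1 + 2) * C3) 2 (M₀ + 1) fun m hm => ?_
  obtain ⟨h5, h6⟩ := h3 m hm
  have h7 : |lam2 b m * beta2 m| ≤ C1 + 2 := by
    have : lam2 b m * beta2 m = -(alpha2 b m + mu m) := by rw [alpha2_eq]; ring
    rw [this, abs_neg]
    exact (abs_add_le _ _).trans (add_le_add (h1 m).1 (abs_mu_le m))
  have := abs_le_of_abs_mul_le hδ h5 h7 h6
  rwa [mul_div_assoc]

/-! ### Modal coordinates of the plant -/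

/-- Coordinate of `(y, z)` along the mode `(1, n)`. -/
noncomputable def coord1 (a b s : ℝ) (y z : ℝ → L2I) (n : ℕ) (t : ℝ) : ℝ :=
  pairing (y t) (phi1 n) + pairing (z t) (psi1 a b s n)

/-- Coordinate of `(y, z)` along the mode `(2, m)`. -/
noncomputable def coord2 (z : ℝ → L2I) (m : ℕ) (t : ℝ) : ℝ := pairing (z t) (psi2 m)

/-- Coordinate along the mode `(1, n)` after the lifting of the boundary control. -/
noncomputable def mode1 (a b s : ℝ) (u : ℝ → ℝ) (y z : ℝ → L2I) (n : ℕ) (t : ℝ) : ℝ :=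
  coord1 a b s y z n t + u t * beta1 a b s n

/-- Coordinate along the mode `(2, m)` after the lifting of the boundary control. -/
noncomputable def mode2 (u : ℝ → ℝ) (z : ℝ → L2I) (m : ℕ) (t : ℝ) : ℝ :=
  coord2 z m t + u t * beta2 m

theorem continuousOn_pairing {y : ℝ → L2I} {S : Set ℝ} (hy : ContinuousOn y S) {f : ℝ → ℝ}
    (hf : Continuous f) : ContinuousOn (fun t => pairing (y t) f) S := by
  simp only [← inner_toL2_right _ hf]
  exact hy.inner continuousOn_const

/-- The integrand of the weak formulation is continuous in time, so the fundamental theorem of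
calculus gives a pointwise derivative. -/
theorem IsWeakSolution.hasDerivWithinAt {a b s : ℝ} {u : ℝ → ℝ} {y z : ℝ → L2I}
    (h : IsWeakSolution a b s u y z) (hu : ContinuousOn u (Ici 0)) {f g f₂ g₂ : ℝ → ℝ}
    (hfg : IsTestPair s f g) (hf : ∀ x, deriv (deriv f) x + a * f x = f₂ x)
    (hg : ∀ x, deriv (deriv g) x + b * g x = g₂ x) (hf₂ : Continuous f₂) (hg₂ : Continuous g₂)
    {t : ℝ} (ht : 0 ≤ t) :
    HasDerivWithinAt (fun t => pairing (y t) f + pairing (z t) g)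
      (pairing (y t) f₂ + pairing (z t) g₂ - u t * g 0) (Ici 0) t := by
  set k : ℝ → ℝ := fun τ => pairing (y τ) f₂ + pairing (z τ) g₂ - u τ * g 0 with hk
  have hc : ContinuousOn k (Ici 0) :=
    ((continuousOn_pairing h.cont_fst hf₂).add (continuousOn_pairing h.cont_snd hg₂)).sub
      (hu.mul continuousOn_const)
  -- Freezing the integrand for negative times makes it continuous on `ℝ`, so the two-sided theorem
  -- also applies at `t = 0`.
  have hc' : Continuous fun τ => k (max τ 0) := by
    refine hc.comp_continuous (by fun_prop) fun τ => mem_Ici.2 (le_max_right _ _)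
  have hw : ∀ r ∈ Ici (0 : ℝ), pairing (y r) f + pairing (z r) g
      = (pairing (y 0) f + pairing (z 0) g) + ∫ τ in (0 : ℝ)..r, k (max τ 0) := by
    intro r hr
    rw [h.weak f g hfg r hr]
    congr 1
    refine intervalIntegral.integral_congr fun τ hτ => ?_
    rw [uIcc_of_le hr] at hτ
    simp only [max_eq_left hτ.1, hk, funext hf, funext hg]
  have hd := ((hc'.integral_hasStrictDerivAt 0 t).hasDerivAt.const_add
    (pairing (y 0) f + pairing (z 0) g)).hasDerivWithinAt (s := Ici 0)
  have := hd.congr hw (hw t ht)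
  rwa [max_eq_left ht] at this

theorem deriv_eq_of_hasDerivAt {f f' : ℝ → ℝ} (h : ∀ x, HasDerivAt f (f' x) x) : deriv f = f' :=
  funext fun x => (h x).deriv

theorem IsWeakSolution.hasDerivWithinAt_coord1 {a b s : ℝ} {u : ℝ → ℝ} {y z : ℝ → L2I}
    (h : IsWeakSolution a b s u y z) (hu : ContinuousOn u (Ici 0)) (n : ℕ) {t : ℝ} (ht : 0 ≤ t) :
    ∃ R : ℝ → ℝ, HasDerivWithinAt (coord1 a b s y z n)
      (lam1 a n * coord1 a b s y z n t + pairing (z t) R - u t * psi1 a b s n 0) (Ici 0) t ∧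
      ((∃ k, (n, k) ∈ Delta a b ∧ R = fun x => -(Real.sqrt 2 * s * mu k) * psi2 k x) ∨
      ((∀ k, (n, k) ∉ Delta a b) ∧ R = fun _ => 0)) := by
  obtain ⟨G', R, hsm, hG, hG', hR, h1, h0, hor⟩ := exists_psi1_ode a b s n
  have e1 := deriv_eq_of_hasDerivAt hG
  have e2 := deriv_eq_of_hasDerivAt hG'
  have e3 := deriv_eq_of_hasDerivAt (hasDerivAt_phi1 n)
  have e4 := deriv_eq_of_hasDerivAt (hasDerivAt_deriv_phi1 n)
  have ht1 : IsTestPair s (phi1 n) (psi1 a b s n) :=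
    ⟨contDiff_phi1 n, hsm, phi1_one n, by rw [e3]; simp [sin1_zero], by rw [e1, h1],
      by rw [e1, h0, phi1_zero]⟩
  have cphi := continuous_phi1 n
  have cpsi := continuous_psi1 a b s n
  refine ⟨R, ?_, hor⟩
  have := h.hasDerivWithinAt hu ht1 (f₂ := fun x => lam1 a n * phi1 n x)
    (g₂ := fun x => lam1 a n * psi1 a b s n x + R x)
    (fun x => by rw [e3, e4, lam1_eq]; ring) (fun x => by rw [e1, e2]; ring)
    (by fun_prop) (by fun_prop) ht
  refine this.congr_deriv ?_
  rw [pairing_const_mul_right, pairing_add_right _ (by fun_prop) hR, pairing_const_mul_right]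
  simp only [coord1]; ring

theorem isTestPair_psi2 (s : ℝ) (m : ℕ) : IsTestPair s (fun _ => 0) (psi2 m) := by
  have e1 := deriv_eq_of_hasDerivAt (hasDerivAt_psi2 m)
  have hs : Real.sin ((m : ℝ) * Real.pi * 1) = 0 := by rw [mul_one, Real.sin_nat_mul_pi]
  refine ⟨contDiff_const, contDiff_psi2 m, rfl, by simp, ?_, ?_⟩
  · rw [e1]; simp only [hs]; ring
  · rw [e1]; simp

theorem IsWeakSolution.hasDerivWithinAt_mode2 {a b s : ℝ} {u v : ℝ → ℝ} {y z : ℝ → L2I}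
    (h : IsWeakSolution a b s u y z)
    (hu : ∀ t, 0 ≤ t → HasDerivWithinAt u (v t) (Ici 0) t) (m : ℕ) {t : ℝ} (ht : 0 ≤ t) :
    HasDerivWithinAt (mode2 u z m)
      (lam2 b m * mode2 u z m t + alpha2 b m * u t + beta2 m * v t) (Ici 0) t := by
  have e1 := deriv_eq_of_hasDerivAt (hasDerivAt_psi2 m)
  have e2 := deriv_eq_of_hasDerivAt (hasDerivAt_deriv_psi2 m)
  have cpsi := continuous_psi2 m
  have h1 := h.hasDerivWithinAt (fun t ht => (hu t ht).continuousWithinAt) (isTestPair_psi2 s m)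
    (f₂ := fun _ => 0) (g₂ := fun x => lam2 b m * psi2 m x)
    (fun x => by simp) (fun x => by rw [e1, e2, lam2_eq]; ring)
    (by fun_prop) (by fun_prop) ht
  simp only [pairing_zero_right, zero_add, psi2_apply_zero] at h1
  refine (h1.add ((hu t ht).mul_const (beta2 m))).congr_deriv ?_
  rw [pairing_const_mul_right, alpha2_eq]
  simp only [mode2, coord2]; ring

/-- The residue of `psi1 n` pairs with `z` to a multiple of `coord2 z k`; the extra `beta2 k` term
in `alpha1_of_mem` completes it to the lifted `mode2 u z k`. -/
theorem IsWeakSolution.hasDerivWithinAt_mode1_of_mem {a b s : ℝ} {u v : ℝ → ℝ} {y z : ℝ → L2I}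
    (h : IsWeakSolution a b s u y z)
    (hu : ∀ t, 0 ≤ t → HasDerivWithinAt u (v t) (Ici 0) t) {n k : ℕ} (hk : (n, k) ∈ Delta a b)
    {t : ℝ} (ht : 0 ≤ t) :
    HasDerivWithinAt (mode1 a b s u y z n)
      (lam1 a n * mode1 a b s u y z n t + -(Real.sqrt 2 * s * mu k) * mode2 u z k t
        + alpha1 a b s n * u t + beta1 a b s n * v t) (Ici 0) t := by
  obtain ⟨R, h1, hor⟩ := h.hasDerivWithinAt_coord1 (fun t ht => (hu t ht).continuousWithinAt) n ht
  refine (h1.add ((hu t ht).mul_const (beta1 a b s n))).congr_deriv ?_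
  rcases hor with ⟨j, hj, rfl⟩ | ⟨hn, -⟩
  · obtain rfl := Delta_snd_unique hk hj
    rw [pairing_const_mul_right, alpha1_of_mem s hk]
    simp only [mode1, mode2, coord2]; ring
  · exact absurd hk (hn k)

theorem IsWeakSolution.hasDerivWithinAt_mode1_of_not_mem {a b s : ℝ} {u v : ℝ → ℝ}
    {y z : ℝ → L2I} (h : IsWeakSolution a b s u y z)
    (hu : ∀ t, 0 ≤ t → HasDerivWithinAt u (v t) (Ici 0) t) {n : ℕ}
    (hn : ∀ k, (n, k) ∉ Delta a b) {t : ℝ} (ht : 0 ≤ t) :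
    HasDerivWithinAt (mode1 a b s u y z n)
      (lam1 a n * mode1 a b s u y z n t + alpha1 a b s n * u t + beta1 a b s n * v t)
      (Ici 0) t := by
  obtain ⟨R, h1, hor⟩ := h.hasDerivWithinAt_coord1 (fun t ht => (hu t ht).continuousWithinAt) n ht
  refine (h1.add ((hu t ht).mul_const (beta1 a b s n))).congr_deriv ?_
  rcases hor with ⟨j, hj, -⟩ | ⟨-, rfl⟩
  · exact absurd hj (hn j)
  · rw [pairing_zero_right, alpha1_of_not_mem s hn]
    simp only [mode1]; ring

/-- The modes of low frequency. -/
noncomputable def lowModes (a b s : ℝ) (N₀ M₀ : ℕ) (u : ℝ → ℝ) (y z : ℝ → L2I) (t : ℝ) :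
    Idx N₀ M₀ → ℝ :=
  Sum.elim (fun n => mode1 a b s u y z n t) (fun m => mode2 u z m t)

/-- The system is closed because `hΔ` keeps the resonant partner of every retained mode inside the
truncation. -/
theorem IsWeakSolution.hasDerivWithinAt_lowModes {a b s : ℝ} {N₀ M₀ : ℕ} {u v : ℝ → ℝ}
    {y z : ℝ → L2I} (hΔ : ∀ n m : ℕ, (n, m) ∈ Delta a b → n ≤ N₀ ∧ m ≤ M₀)
    (h : IsWeakSolution a b s u y z)
    (hu : ∀ t, 0 ≤ t → HasDerivWithinAt u (v t) (Ici 0) t) {t : ℝ} (ht : 0 ≤ t) :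
    HasDerivWithinAt (lowModes a b s N₀ M₀ u y z)
      (Matrix.mulVec (A₁ a b s N₀ M₀) (lowModes a b s N₀ M₀ u y z t)
        + u t • B₁u a b s N₀ M₀ + v t • B₁v a b s N₀ M₀) (Ici 0) t := by
  rw [hasDerivWithinAt_pi]
  rintro (n | m)
  · by_cases hn : ∃ k : ℕ, ((n : ℕ), k) ∈ Delta a b
    · obtain ⟨k, hk⟩ := hn
      refine (h.hasDerivWithinAt_mode1_of_mem hu hk ht).congr_deriv ?_
      have hkM : k < M₀ + 1 := Nat.lt_succ_of_le (hΔ _ _ hk).2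
      have hmem : ∀ m : Fin (M₀ + 1), ((n : ℕ), (m : ℕ)) ∈ Delta a b ↔ m = ⟨k, hkM⟩ := by
        intro m
        constructor
        · intro hm; exact Fin.ext (Delta_snd_unique hm hk)
        · rintro rfl; exact hk
      simp [A₁, lowModes, B₁u, B₁v, Matrix.fromBlocks_mulVec,
        Matrix.mulVec, dotProduct, hmem, Matrix.diagonal_apply]
      ring
    · push Not at hn
      refine (h.hasDerivWithinAt_mode1_of_not_mem hu hn ht).congr_deriv ?_
      simp [A₁, lowModes, B₁u, B₁v, Matrix.fromBlocks_mulVec,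
        Matrix.mulVec, dotProduct, hn, Matrix.diagonal_apply]
      ring
  · refine (h.hasDerivWithinAt_mode2 hu m ht).congr_deriv ?_
    simp [A₁, lowModes, B₁u, B₁v, Matrix.fromBlocks_mulVec,
        Matrix.mulVec, dotProduct, Matrix.diagonal_apply]
    ring

/-! ### The measurement -/

theorem summable_one_div_sq : Summable fun n : ℕ => 1 / ((n : ℝ) + 1) ^ 2 := by
  have := (summable_nat_add_iff (f := fun n : ℕ => 1 / (n : ℝ) ^ 2) 1).2
    (Real.summable_one_div_nat_pow.2 one_lt_two)
  simpa using this

/-- The Cauchy-Schwarz inequality for series. -/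
theorem summable_abs_mul_abs {c p : ℕ → ℝ} {A B : ℝ} (hA : 0 ≤ A) (hB : 0 ≤ B)
    (hc : Summable fun n => c n ^ 2) (hcA : ∑' n, c n ^ 2 ≤ A ^ 2)
    (hp : Summable fun n => p n ^ 2) (hpB : ∑' n, p n ^ 2 ≤ B ^ 2) :
    Summable (fun n => |c n| * |p n|) ∧ ∑' n, |c n| * |p n| ≤ A * B := by
  have key : ∀ F : Finset ℕ, ∑ n ∈ F, |c n| * |p n| ≤ A * B := by
    intro F
    have h1 := Finset.sum_mul_sq_le_sq_mul_sq F (fun n => |c n|) (fun n => |p n|)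
    simp only [sq_abs] at h1
    have h2 : ∑ n ∈ F, c n ^ 2 ≤ A ^ 2 := (hc.sum_le_tsum F fun n _ => sq_nonneg _).trans hcA
    have h3 : ∑ n ∈ F, p n ^ 2 ≤ B ^ 2 := (hp.sum_le_tsum F fun n _ => sq_nonneg _).trans hpB
    have h4 : (∑ n ∈ F, |c n| * |p n|) ^ 2 ≤ (A * B) ^ 2 := by
      rw [mul_pow]
      exact h1.trans (mul_le_mul h2 h3 (Finset.sum_nonneg fun n _ => sq_nonneg _) (sq_nonneg _))
    exact (abs_le_of_sq_le_sq' h4 (mul_nonneg hA hB)).2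
  have h0 : ∀ n, 0 ≤ |c n| * |p n| := fun n => by positivity
  exact ⟨summable_of_sum_le h0 key, Real.tsum_le_of_sum_le h0 key⟩

/-- With `d = ∑ c1 c n • psi1 n`, the first family of modes sums to the measurement plus `⟨d, w⟩`
and the second to `-⟨d, w⟩`. Adding them recovers `∫ c y`, whatever `w` is; it will be the lifted
second component. -/
theorem exists_measurement {a b : ℝ} (s : ℝ) (c : L2I) {N₀ : ℕ}
    (hΔ : ∀ n m, (n, m) ∈ Delta a b → n ≤ N₀) :
    ∃ d : L2I, (∀ m, c2 a b s c m = -pairing d (psi2 m)) ∧ ∀ y w : L2I,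
      HasSum (fun n => c1 c n * (pairing y (phi1 n) + pairing w (psi1 a b s n)))
        (pairing c y + inner ℝ d w) ∧
      HasSum (fun m => c2 a b s c m * pairing w (psi2 m)) (-inner ℝ d w) := by
  obtain ⟨C, hC, hpsi⟩ := exists_norm_psi1_le s hΔ
  -- Convergence in norm: `c1 c` is square summable and `‖psi1 n‖ = O(1/n)`.
  have hsum : Summable fun n => c1 c n • toL2 (psi1 a b s n) := by
    refine Summable.of_norm_bounded (g := fun n : ℕ => C * (|c1 c n| * |1 / ((n : ℝ) + 1)|)) ?_ ?_
    · refine ((summable_abs_mul_abs (norm_nonneg c) (Real.sqrt_nonneg _)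
        (hasSum_sq_phi1 c).summable (hasSum_sq_phi1 c).tsum_eq.le ?_
        (Real.sq_sqrt (tsum_nonneg fun n => sq_nonneg _)).ge).1).mul_left C
      simpa using summable_one_div_sq
    · intro n
      rw [norm_smul, Real.norm_eq_abs, abs_of_pos (show (0 : ℝ) < 1 / ((n : ℝ) + 1) by positivity)]
      calc _ ≤ |c1 c n| * (C / ((n : ℝ) + 1)) := by gcongr; exact hpsi n
        _ = _ := by ring
  set d : L2I := ∑' n, c1 c n • toL2 (psi1 a b s n) with hd
  have hdw : ∀ w : L2I, HasSum (fun n => c1 c n * pairing w (psi1 a b s n)) (inner ℝ d w) := by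
    intro w
    have h1 := (innerSL ℝ w).hasSum hsum.hasSum
    simp only [innerSL_apply_apply, inner_smul_right, inner_toL2_right _ (continuous_psi1 a b s _)]
      at h1
    rwa [real_inner_comm] at h1
  -- Parseval for `⟨c, phi2 m⟩` in the basis `phi1`, rewritten termwise by `biorthogonal`.
  have hc2 : ∀ m, c2 a b s c m = -pairing d (psi2 m) := by
    intro m
    have h1 := hdw (toL2 (psi2 m))
    rw [inner_toL2_right _ (continuous_psi2 m)] at h1
    have h2 := hasSum_phi1 c (toL2 (phi2 a b s m))
    rw [inner_toL2_right _ (continuous_phi2 a b s m)] at h2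
    have h3 : ∀ n, c1 c n * pairing (toL2 (psi2 m)) (psi1 a b s n)
        = -(pairing c (phi1 n) * pairing (toL2 (phi2 a b s m)) (phi1 n)) := by
      intro n
      rw [pairing_toL2_left (continuous_psi2 m), pairing_toL2_left (continuous_phi2 a b s m),
        pairing_comm (psi2 m), biorthogonal, c1]
      ring
    simp only [h3] at h1
    rw [c2, h1.unique h2.neg, neg_neg]
  refine ⟨d, hc2, fun y w => ⟨?_, ?_⟩⟩
  · have h1 := (hasSum_phi1 c y).add (hdw w)
    rw [inner_eq_pairing] at h1
    simpa only [c1, mul_add] using h1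
  · have h1 := (hasSum_psi2 d w).neg
    simpa only [hc2, neg_mul] using h1

/-! ### Finite-dimensional part of the closed loop -/

section Core

variable {ι : Type} [Fintype ι]

theorem abs_dotProduct_le (C v : ι → ℝ) : |C ⬝ᵥ v| ≤ (∑ i, |C i|) * ‖v‖ := by
  rw [dotProduct, Finset.sum_mul]
  refine (Finset.abs_sum_le_sum_abs _ _).trans (Finset.sum_le_sum fun i _ => ?_)
  rw [abs_mul]
  gcongr
  exact norm_le_pi_norm v i

/-- Observer-based feedback of a finite-dimensional plant whose measurement is perturbed by `η`:
estimate in exponentially weighted supremum norms. -/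
theorem exists_observer_feedback_bound [DecidableEq ι] {A : Matrix ι ι ℝ} {Bu Bv L C Kx : ι → ℝ} {ku δ : ℝ}
    (hK : SpectralAbscissaLT (Matrix.fromBlocks A (Matrix.of fun i _ => Bu i) 0 0
      - Matrix.vecMulVec (Sum.elim Bv (fun _ : Unit => 1)) (Sum.elim Kx (fun _ : Unit => ku))) δ)
    (hL : SpectralAbscissaLT (A - Matrix.vecMulVec L C) δ) :
    ∃ κ : ℝ, 0 ≤ κ ∧ ∀ (T H : ℝ) (X P : ℝ → ι → ℝ) (u v η : ℝ → ℝ),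
      (∀ t, 0 ≤ t → v t = -(Kx ⬝ᵥ X t) - ku * u t) →
      (∀ t, 0 ≤ t → HasDerivWithinAt u (v t) (Ici 0) t) →
      (∀ t, 0 ≤ t → HasDerivWithinAt X (Matrix.mulVec A (X t) + u t • Bu + v t • Bv
        + (C ⬝ᵥ (P t - X t) + η t) • L) (Ici 0) t) →
      (∀ t, 0 ≤ t → HasDerivWithinAt P (Matrix.mulVec A (P t) + u t • Bu + v t • Bv) (Ici 0) t) →
      (∀ t, 0 ≤ t → t ≤ T → |η t| ≤ H * Real.exp (-δ * t)) →
      ∀ t, 0 ≤ t → t ≤ T →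
        ‖X t‖ ≤ κ * (‖X 0‖ + |u 0| + ‖P 0 - X 0‖ + H) * Real.exp (-δ * t) ∧
        |u t| ≤ κ * (‖X 0‖ + |u 0| + ‖P 0 - X 0‖ + H) * Real.exp (-δ * t) ∧
        |v t| ≤ κ * (‖X 0‖ + |u 0| + ‖P 0 - X 0‖ + H) * Real.exp (-δ * t) ∧
        ‖P t‖ ≤ κ * (‖X 0‖ + |u 0| + ‖P 0 - X 0‖ + H) * Real.exp (-δ * t) := by
  obtain ⟨K₁, hK₁, h₁⟩ := hK.exists_decay
  obtain ⟨K₂, hK₂, h₂⟩ := hL.exists_decay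
  set Cn := ∑ i, |C i| with hCn
  have hCn0 : 0 ≤ Cn := Finset.sum_nonneg fun i _ => abs_nonneg _
  set Kn := ∑ i, |Kx i| + |ku| with hKn
  have hKn0 : 0 ≤ Kn := add_nonneg (Finset.sum_nonneg fun i _ => abs_nonneg _) (abs_nonneg _)
  set κE := K₂ * (1 + ‖L‖) with hκE
  set κS := K₁ * (1 + ‖L‖ * (Cn * κE + 1)) with hκS
  have hκE0 : 0 ≤ κE := by positivity
  have hκS0 : 0 ≤ κS := by positivity
  refine ⟨κS * (1 + Kn) + κE, by positivity, fun T H X P u v η hv hu hX hP hη t ht hT => ?_⟩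
  set I := ‖X 0‖ + |u 0| + ‖P 0 - X 0‖ + H with hI
  have hH : 0 ≤ H := by
    have h1 := hη 0 le_rfl (ht.trans hT)
    simp at h1; exact (abs_nonneg _).trans h1
  have hI0 : 0 ≤ I := by positivity
  have hx0 := norm_nonneg (X 0)
  have hu0 := abs_nonneg (u 0)
  have he0 := norm_nonneg (P 0 - X 0)
  -- In the difference of plant and observer the control cancels: the error obeys `A - L C`, forced
  -- only by `-η L`.
  have hE : ∀ t, 0 ≤ t → t ≤ T → ‖P t - X t‖ ≤ κE * I * Real.exp (-δ * t) := by
    intro t ht hT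
    have h3 := h₂ T (H * ‖L‖) (fun t => P t - X t) (fun t => -(η t) • L)
      (fun t h1 h2 => by
        refine ((hP t h1).sub (hX t h1)).congr_deriv ?_
        rw [Matrix.sub_mulVec, Matrix.vecMulVec_mulVec, Matrix.mulVec_sub]
        ext i
        simp
        ring)
      (fun t h1 h2 => by
        rw [norm_smul, norm_neg, Real.norm_eq_abs]
        calc _ ≤ (H * Real.exp (-δ * t)) * ‖L‖ := by gcongr; exact hη t h1 h2
          _ = _ := by ring) t ht hT
    refine h3.trans ?_
    have h4 : K₂ * (‖P 0 - X 0‖ + H * ‖L‖) ≤ κE * I := by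
      rw [hκE, mul_assoc]
      gcongr
      have : H * ‖L‖ ≤ I * ‖L‖ := by gcongr; linarith
      linarith
    gcongr
  -- The pair `(X, u)` obeys the closed-loop matrix forced by `(C (P - X) + η) L`, which the bound
  -- on the error already controls.
  have hS : ∀ t, 0 ≤ t → t ≤ T →
      ‖(Sum.elim (X t) (fun _ : Unit => u t))‖ ≤ κS * I * Real.exp (-δ * t) := by
    intro t ht hT
    have h3 := h₁ T (‖L‖ * (Cn * κE + 1) * I) (fun t => Sum.elim (X t) (fun _ : Unit => u t))
      (fun t => Sum.elim ((C ⬝ᵥ (P t - X t) + η t) • L) (fun _ => 0))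
      (fun t h1 h2 => by
        rw [hasDerivWithinAt_pi]
        rintro (i | i)
        · refine ((hasDerivWithinAt_pi.1 (hX t h1)) i).congr_deriv ?_
          rw [Matrix.sub_mulVec, Matrix.vecMulVec_mulVec, Matrix.fromBlocks_mulVec, hv t h1]
          simp [Matrix.mulVec, dotProduct]
          ring
        · refine (hu t h1).congr_deriv ?_
          rw [Matrix.sub_mulVec, Matrix.vecMulVec_mulVec, Matrix.fromBlocks_mulVec, hv t h1]
          simp [dotProduct]
          ring)
      (fun t h1 h2 => by
        have h5 : |C ⬝ᵥ (P t - X t) + η t| ≤ (Cn * κE + 1) * I * Real.exp (-δ * t) := by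
          refine (abs_add_le _ _).trans ?_
          have h6 := abs_dotProduct_le C (P t - X t)
          have h7 := mul_le_mul_of_nonneg_left (hE t h1 h2) hCn0
          have h8 := hη t h1 h2
          have h9 : H * Real.exp (-δ * t) ≤ I * Real.exp (-δ * t) := by
            gcongr; linarith
          calc _ ≤ Cn * (κE * I * Real.exp (-δ * t)) + I * Real.exp (-δ * t) :=
                add_le_add (h6.trans h7) (h8.trans h9)
            _ = _ := by ring
        have h10 : 0 ≤ ‖L‖ * (Cn * κE + 1) * I * Real.exp (-δ * t) := by positivity
        rw [pi_norm_le_iff_of_nonneg h10]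
        rintro (i | i)
        · simp only [Sum.elim_inl, Pi.smul_apply, smul_eq_mul, norm_mul, Real.norm_eq_abs]
          have h11 : |L i| ≤ ‖L‖ := norm_le_pi_norm L i
          calc _ ≤ ((Cn * κE + 1) * I * Real.exp (-δ * t)) * ‖L‖ :=
                mul_le_mul h5 h11 (abs_nonneg _) (by positivity)
            _ = _ := by ring
        · simpa using h10) t ht hT
    refine h3.trans ?_
    have h12 : ‖(Sum.elim (X 0) (fun _ : Unit => u 0))‖ ≤ I := by
      rw [pi_norm_le_iff_of_nonneg hI0]
      rintro (i | i)
      · have := norm_le_pi_norm (X 0) i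
        simp only [Sum.elim_inl]; linarith
      · simp only [Sum.elim_inr, Real.norm_eq_abs]; linarith
    have h13 : K₁ * (‖(Sum.elim (X 0) (fun _ : Unit => u 0))‖ + ‖L‖ * (Cn * κE + 1) * I)
        ≤ κS * I := by
      rw [hκS, mul_assoc K₁]
      refine mul_le_mul_of_nonneg_left ?_ hK₁
      linarith
    gcongr
  have hp := Real.exp_pos (-δ * t)
  have hSt := hS t ht hT
  have hb0 : 0 ≤ κS * I * Real.exp (-δ * t) := by positivity
  have hX1 : ‖X t‖ ≤ κS * I * Real.exp (-δ * t) := by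
    rw [pi_norm_le_iff_of_nonneg hb0]
    intro i
    exact (norm_le_pi_norm (Sum.elim (X t) (fun _ : Unit => u t)) (Sum.inl i)).trans hSt
  have hu1 : |u t| ≤ κS * I * Real.exp (-δ * t) :=
    (norm_le_pi_norm (Sum.elim (X t) (fun _ : Unit => u t)) (Sum.inr ())).trans hSt
  have hv1 : |v t| ≤ Kn * (κS * I * Real.exp (-δ * t)) := by
    rw [hv t ht]
    refine (abs_sub _ _).trans ?_
    rw [abs_neg, abs_mul, hKn, add_mul]
    exact add_le_add ((abs_dotProduct_le Kx (X t)).trans (by gcongr)) (by gcongr)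
  have hP1 : ‖P t‖ ≤ κE * I * Real.exp (-δ * t) + κS * I * Real.exp (-δ * t) := by
    calc ‖P t‖ = ‖(P t - X t) + X t‖ := by rw [sub_add_cancel]
      _ ≤ _ := (norm_add_le _ _).trans (add_le_add (hE t ht hT) hX1)
  have e1 : (κS * (1 + Kn) + κE) * I * Real.exp (-δ * t) = κS * I * Real.exp (-δ * t)
      + Kn * (κS * I * Real.exp (-δ * t)) + κE * I * Real.exp (-δ * t) := by ring
  have e2 : 0 ≤ κE * I * Real.exp (-δ * t) := by positivity
  have e3 : 0 ≤ Kn * (κS * I * Real.exp (-δ * t)) := by positivity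
  rw [e1]
  refine ⟨by linarith, by linarith, by linarith, by linarith⟩

end Core

/-! ### Tails of the measurement -/

/-- The gain of the modes above `N` in the measurement. -/
noncomputable def tailGain (c : ℕ → ℝ) (N : ℕ) : ℝ :=
  ∑' k : ℕ, |c (k + (N + 1))| * (1 / (((k + (N + 1) : ℕ) : ℝ) + 1) ^ 2)

/-- No summability is needed: if the series diverges, all its tails are zero by the convention for
`tsum`. -/
theorem tendsto_tailGain (c : ℕ → ℝ) :
    Filter.Tendsto (tailGain c) Filter.atTop (nhds 0) :=
  (tendsto_sum_nat_add (fun n : ℕ => |c n| * (1 / ((n : ℝ) + 1) ^ 2))).comp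
    (Filter.tendsto_add_atTop_nat 1)

theorem summable_abs_mul_one_div_sq {c : ℕ → ℝ} (hc : Summable fun n => c n ^ 2) :
    Summable fun n : ℕ => |c n| * (1 / ((n : ℝ) + 1) ^ 2) := by
  refine Summable.of_nonneg_of_le (fun n => by positivity) (fun n => ?_)
    ((summable_abs_mul_abs (p := fun n : ℕ => 1 / ((n : ℝ) + 1)) (Real.sqrt_nonneg _)
      (Real.sqrt_nonneg _) hc (Real.sq_sqrt (tsum_nonneg fun n => sq_nonneg _)).ge
      (by simpa using summable_one_div_sq) (Real.sq_sqrt (tsum_nonneg fun n => sq_nonneg _)).ge).1)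
  have hn : (1 : ℝ) ≤ (n : ℝ) + 1 := by linarith [Nat.cast_nonneg (α := ℝ) n]
  rw [abs_of_pos (show (0 : ℝ) < 1 / ((n : ℝ) + 1) by positivity)]
  gcongr
  nlinarith

/-- The remainder has two parts. The initial data are bounded by the whole series, which need not be
small; only the response to the control, of size `D`, receives the factor `tailGain`. -/
theorem abs_sub_sum_range_le {c p p0 : ℕ → ℝ} {S e D : ℝ} {N : ℕ}
    (hS : HasSum (fun n => c n * p n) S) (hc : Summable fun n => c n ^ 2)
    (h0 : Summable fun n => |c n| * |p0 n|) (he : 0 ≤ e)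
    (h : ∀ n, N < n → |p n| ≤ e * (|p0 n| + D * (1 / ((n : ℝ) + 1) ^ 2))) :
    |S - ∑ n ∈ Finset.range (N + 1), c n * p n|
      ≤ e * (∑' n, |c n| * |p0 n| + D * tailGain c N) := by
  have h1 : S - ∑ n ∈ Finset.range (N + 1), c n * p n = ∑' k, c (k + (N + 1)) * p (k + (N + 1)) := by
    rw [← hS.tsum_eq, ← hS.summable.sum_add_tsum_nat_add (N + 1)]; ring
  have s0 := (summable_nat_add_iff (N + 1)).2 h0
  have s1 := (summable_nat_add_iff (N + 1)).2 (summable_abs_mul_one_div_sq hc)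
  have s2 := (s0.add (s1.mul_left D)).mul_left e
  have h2 : ∑' k, |c (k + (N + 1))| * |p0 (k + (N + 1))| ≤ ∑' n, |c n| * |p0 n| := by
    rw [← h0.sum_add_tsum_nat_add (N + 1)]
    have : 0 ≤ ∑ n ∈ Finset.range (N + 1), |c n| * |p0 n| :=
      Finset.sum_nonneg fun n _ => by positivity
    linarith
  rw [h1, ← Real.norm_eq_abs]
  refine (tsum_of_norm_bounded s2.hasSum fun k => ?_).trans ?_
  · rw [norm_mul, Real.norm_eq_abs, Real.norm_eq_abs]
    calc _ ≤ |c (k + (N + 1))| * (e * (|p0 (k + (N + 1))|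
          + D * (1 / (((k + (N + 1) : ℕ) : ℝ) + 1) ^ 2))) := by
          gcongr; exact h _ (by omega)
      _ = _ := by ring
  · rw [tsum_mul_left, Summable.tsum_add s0 (s1.mul_left D), tsum_mul_left]
    have := mul_nonneg he (sub_nonneg.2 h2)
    rw [tailGain]
    linarith

theorem sum_range_eq_fin_add_Ioc (f : ℕ → ℝ) {N₀ N : ℕ} (h : N₀ ≤ N) :
    ∑ n ∈ Finset.range (N + 1), f n
      = ∑ n : Fin (N₀ + 1), f n + ∑ n ∈ Finset.Ioc N₀ N, f n := by
  rw [Fin.sum_univ_eq_sum_range, Finset.range_eq_Ico, Finset.range_eq_Ico,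
    ← Finset.sum_Ico_consecutive f (Nat.zero_le (N₀ + 1)) (Nat.succ_le_succ h)]
  congr 2
  ext n
  simp only [Finset.mem_Ico, Finset.mem_Ioc]
  omega

/-! ### Initial data -/

/-- The second component of the state after the lifting of the boundary control. -/
noncomputable def lifted (u : ℝ → ℝ) (z : ℝ → L2I) (t : ℝ) : L2I := z t + u t • toL2 beta

theorem pairing_lifted (u : ℝ → ℝ) (z : ℝ → L2I) (t : ℝ) {f : ℝ → ℝ} (hf : Continuous f) :
    pairing (lifted u z t) f = pairing (z t) f + u t * pairing beta f := by
  rw [← inner_toL2_left _ hf, lifted, inner_add_right, inner_smul_right, inner_toL2_left _ hf,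
    inner_toL2_left _ hf, pairing_toL2_left continuous_beta]

theorem mode1_eq (a b s : ℝ) (u : ℝ → ℝ) (y z : ℝ → L2I) (n : ℕ) (t : ℝ) :
    mode1 a b s u y z n t
      = pairing (y t) (phi1 n) + pairing (lifted u z t) (psi1 a b s n) := by
  rw [pairing_lifted _ _ _ (continuous_psi1 a b s n), mode1, coord1, beta1]; ring

theorem mode2_eq (u : ℝ → ℝ) (z : ℝ → L2I) (m : ℕ) (t : ℝ) :
    mode2 u z m t = pairing (lifted u z t) (psi2 m) := by
  rw [pairing_lifted _ _ _ (continuous_psi2 m), mode2, coord2, beta2]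

theorem exists_tsum_mode1_le {a b : ℝ} (s : ℝ) {N₀ : ℕ}
    (hΔ : ∀ n m, (n, m) ∈ Delta a b → n ≤ N₀) :
    ∃ K, 0 ≤ K ∧ ∀ y w : L2I,
      Summable (fun n => (pairing y (phi1 n) + pairing w (psi1 a b s n)) ^ 2) ∧
      ∑' n, (pairing y (phi1 n) + pairing w (psi1 a b s n)) ^ 2 ≤ (K * (‖y‖ + ‖w‖)) ^ 2 := by
  obtain ⟨C, hC, hpsi⟩ := exists_norm_psi1_le s hΔ
  set Q : ℝ := ∑' n : ℕ, 1 / ((n : ℝ) + 1) ^ 2 with hQ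
  have hQ0 : 0 ≤ Q := tsum_nonneg fun n => by positivity
  refine ⟨2 + 2 * C ^ 2 * Q, by positivity, fun y w => ?_⟩
  have hb : ∀ n, (pairing y (phi1 n) + pairing w (psi1 a b s n)) ^ 2
      ≤ 2 * pairing y (phi1 n) ^ 2 + 2 * C ^ 2 * ‖w‖ ^ 2 * (1 / ((n : ℝ) + 1) ^ 2) := by
    intro n
    have h1 : |pairing w (psi1 a b s n)| ≤ ‖w‖ * (C / ((n : ℝ) + 1)) :=
      (abs_pairing_le w (continuous_psi1 a b s n)).trans (by gcongr; exact hpsi n)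
    have h2 : pairing w (psi1 a b s n) ^ 2 ≤ (‖w‖ * (C / ((n : ℝ) + 1))) ^ 2 := by
      rw [← sq_abs]; exact pow_le_pow_left₀ (abs_nonneg _) h1 2
    have h3 : 2 * C ^ 2 * ‖w‖ ^ 2 * (1 / ((n : ℝ) + 1) ^ 2) = 2 * (‖w‖ * (C / ((n : ℝ) + 1))) ^ 2 := by
      field_simp
    rw [h3]
    nlinarith [sq_nonneg (pairing y (phi1 n) - pairing w (psi1 a b s n))]
  have hs := ((hasSum_sq_phi1 y).mul_left 2).add
    (summable_one_div_sq.hasSum.mul_left (2 * C ^ 2 * ‖w‖ ^ 2))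
  have hsum := Summable.of_nonneg_of_le (fun n => sq_nonneg _) hb hs.summable
  refine ⟨hsum, (hsum.tsum_le_tsum hb hs.summable).trans ?_⟩
  rw [hs.tsum_eq, ← hQ]
  have hy := norm_nonneg y
  have hw := norm_nonneg w
  have hk : 0 ≤ 2 * C ^ 2 * Q := by positivity
  set k := 2 * C ^ 2 * Q with hkd
  have e1 : 2 * C ^ 2 * ‖w‖ ^ 2 * Q = k * ‖w‖ ^ 2 := by rw [hkd]; ring
  rw [e1]
  have h5 : ‖y‖ ^ 2 ≤ (‖y‖ + ‖w‖) ^ 2 := by gcongr; linarith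
  have h6 : ‖w‖ ^ 2 ≤ (‖y‖ + ‖w‖) ^ 2 := by gcongr; linarith
  have h7 : 2 + k ≤ (2 + k) ^ 2 := by nlinarith
  calc 2 * ‖y‖ ^ 2 + k * ‖w‖ ^ 2 ≤ 2 * (‖y‖ + ‖w‖) ^ 2 + k * (‖y‖ + ‖w‖) ^ 2 := by gcongr
    _ = (2 + k) * (‖y‖ + ‖w‖) ^ 2 := by ring
    _ ≤ (2 + k) ^ 2 * (‖y‖ + ‖w‖) ^ 2 := by gcongr
    _ = _ := by ring

theorem abs_le_of_tsum_sq_le {p : ℕ → ℝ} {B : ℝ} (hB : 0 ≤ B) (hp : Summable fun n => p n ^ 2)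
    (h : ∑' n, p n ^ 2 ≤ B ^ 2) (n : ℕ) : |p n| ≤ B :=
  abs_le_of_sq_le_sq ((hp.le_tsum n fun _ _ => sq_nonneg _).trans h) hB

/-! ### The small-gain argument -/

theorem abs_input_le {α β u v C U e : ℝ} (hα : |α| ≤ C) (hβ : |β| ≤ C) (hu : |u| ≤ U * e)
    (hv : |v| ≤ U * e) : |α * u + β * v| ≤ 2 * C * U * e := by
  have h0 : 0 ≤ C := (abs_nonneg _).trans hα
  refine (abs_add_le _ _).trans ?_
  rw [abs_mul, abs_mul]
  have h1 := mul_le_mul hα hu (abs_nonneg _) h0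
  have h2 := mul_le_mul hβ hv (abs_nonneg _) h0
  linarith

/-- A stable mode driven by exponentially decaying inputs. -/
theorem abs_le_of_driven_mode {κ δ C g U T α β : ℝ} {n : ℕ} (hκ : κ < -δ)
    (hgap : 1 / (-κ - δ) ≤ g / ((n : ℝ) + 1) ^ 2) (hα : |α| ≤ C) (hβ : |β| ≤ C) {x u v : ℝ → ℝ}
    (hx : ∀ t, 0 ≤ t → HasDerivWithinAt x (κ * x t + α * u t + β * v t) (Ici 0) t)
    (hU : ∀ t, 0 ≤ t → t ≤ T → |u t| ≤ U * Real.exp (-δ * t) ∧ |v t| ≤ U * Real.exp (-δ * t))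
    {t : ℝ} (ht : 0 ≤ t) (hT : t ≤ T) :
    |x t| ≤ Real.exp (-δ * t) * (|x 0| + 2 * C * g * U * (1 / ((n : ℝ) + 1) ^ 2)) := by
  have hC : 0 ≤ C := (abs_nonneg _).trans hα
  have hU0 : 0 ≤ U := by
    have := (hU 0 le_rfl (ht.trans hT)).1
    simp at this; exact (abs_nonneg _).trans this
  refine (abs_le_of_scalar_ode hκ (G := 2 * C * U) (g := fun t => α * u t + β * v t) (T := T)
    (fun t h3 _ => (hx t h3).congr_deriv (by ring))
    (fun t h3 h4 => abs_input_le hα hβ (hU t h3 h4).1 (hU t h3 h4).2) ht hT).trans ?_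
  gcongr
  calc 2 * C * U / (-κ - δ) = 2 * C * U * (1 / (-κ - δ)) := by ring
    _ ≤ 2 * C * U * (g / ((n : ℝ) + 1) ^ 2) := by gcongr
    _ = _ := by ring

/-- `G` depends neither on the mode nor on `U` and `T`. Plant modes and observer states satisfy the
same equation, so `x` can be either. -/
theorem exists_mode1_decay {a b δ : ℝ} (s : ℝ) {N₀ : ℕ} (hN₀ : lam1 a (N₀ + 1) < -δ)
    (hΔ : ∀ n m, (n, m) ∈ Delta a b → n ≤ N₀) :
    ∃ G, 0 ≤ G ∧ ∀ (u v x : ℝ → ℝ) (U T : ℝ),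
      (∀ t, 0 ≤ t → t ≤ T → |u t| ≤ U * Real.exp (-δ * t) ∧ |v t| ≤ U * Real.exp (-δ * t)) →
      ∀ n, N₀ < n → (∀ t, 0 ≤ t → HasDerivWithinAt x
        (lam1 a n * x t + alpha1 a b s n * u t + beta1 a b s n * v t) (Ici 0) t) →
      ∀ t, 0 ≤ t → t ≤ T →
        |x t| ≤ Real.exp (-δ * t) * (|x 0| + G * U * (1 / ((n : ℝ) + 1) ^ 2)) := by
  obtain ⟨C, hC, hin⟩ := exists_input1_le s hΔ
  obtain ⟨g, hg, hgap⟩ := exists_gap1 hN₀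
  exact ⟨2 * C * g, by positivity, fun u v x U T hU n hn hx t ht hT =>
    abs_le_of_driven_mode (hgap n hn).1 (hgap n hn).2 (hin n).1 (hin n).2 hx hU ht hT⟩

theorem exists_mode2_decay {b δ : ℝ} {M₀ : ℕ} (hM₀ : lam2 b (M₀ + 1) < -δ) :
    ∃ G, 0 ≤ G ∧ ∀ (u v x : ℝ → ℝ) (U T : ℝ),
      (∀ t, 0 ≤ t → t ≤ T → |u t| ≤ U * Real.exp (-δ * t) ∧ |v t| ≤ U * Real.exp (-δ * t)) →
      ∀ m, M₀ < m → (∀ t, 0 ≤ t → HasDerivWithinAt x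
        (lam2 b m * x t + alpha2 b m * u t + beta2 m * v t) (Ici 0) t) →
      ∀ t, 0 ≤ t → t ≤ T →
        |x t| ≤ Real.exp (-δ * t) * (|x 0| + G * U * (1 / ((m : ℝ) + 1) ^ 2)) := by
  obtain ⟨C, hC, hin⟩ := exists_input2_le b
  obtain ⟨g, hg, hgap⟩ := exists_gap2 hM₀
  exact ⟨2 * C * g, by positivity, fun u v x U T hU m hm hx t ht hT =>
    abs_le_of_driven_mode (hgap m hm).1 (hgap m hm).2 (hin m).1 (hin m).2 hx hU ht hT⟩

/-- Plant and observer receive the same inputs, so their difference solves the free equation. -/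
theorem abs_observation_error_le {κ δ : ℝ} (hκ : κ < -δ) {p x u v : ℝ → ℝ} {α β : ℝ}
    (hp : ∀ t, 0 ≤ t → HasDerivWithinAt p (κ * p t + α * u t + β * v t) (Ici 0) t)
    (hx : ∀ t, 0 ≤ t → HasDerivWithinAt x (κ * x t + α * u t + β * v t) (Ici 0) t)
    {t : ℝ} (ht : 0 ≤ t) : |p t - x t| ≤ Real.exp (-δ * t) * |p 0 - x 0| := by
  have := abs_le_of_scalar_ode hκ (x := fun t => p t - x t) (g := fun _ => 0) (G := 0) (T := t)
    (fun r h1 _ => ((hp r h1).sub (hx r h1)).congr_deriv (by ring)) (by simp) ht le_rfl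
  simpa using this

theorem norm_le_of_sum_sq_le {ι : Type} [Fintype ι] {X : ι → ℝ} {R : ℝ} (hR : 0 ≤ R)
    (h : ∑ i, X i ^ 2 ≤ R ^ 2) : ‖X‖ ≤ R := by
  rw [pi_norm_le_iff_of_nonneg hR]
  intro i
  exact abs_le_of_sq_le_sq
    ((Finset.single_le_sum (f := fun i => X i ^ 2) (fun _ _ => sq_nonneg _) (Finset.mem_univ i)).trans h) hR

/-- Bounds for the initial data in terms of the energy. -/
theorem initial_bounds {N₀ M₀ N M : ℕ} {y z : ℝ → L2I} {u : ℝ → ℝ} {X : ℝ → Idx N₀ M₀ → ℝ}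
    {x1 x2 : ℕ → ℝ → ℝ} {R : ℝ} (hR : 0 ≤ R)
    (h : ‖y 0‖ ^ 2 + ‖z 0‖ ^ 2 + controllerNormSq N₀ M₀ N M u X x1 x2 0 ≤ R ^ 2) :
    ‖y 0‖ ≤ R ∧ ‖z 0‖ ≤ R ∧ |u 0| ≤ R ∧ ‖X 0‖ ≤ R ∧
      (∀ n ∈ Finset.Ioc N₀ N, |x1 n 0| ≤ R) ∧ (∀ m ∈ Finset.Ioc M₀ M, |x2 m 0| ≤ R) := by
  unfold controllerNormSq at h
  have h1 : 0 ≤ ∑ i, X 0 i ^ 2 := Finset.sum_nonneg fun _ _ => sq_nonneg _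
  have h2 : 0 ≤ ∑ n ∈ Finset.Ioc N₀ N, x1 n 0 ^ 2 := Finset.sum_nonneg fun _ _ => sq_nonneg _
  have h3 : 0 ≤ ∑ m ∈ Finset.Ioc M₀ M, x2 m 0 ^ 2 := Finset.sum_nonneg fun _ _ => sq_nonneg _
  have h4 := sq_nonneg ‖y 0‖
  have h5 := sq_nonneg ‖z 0‖
  have h6 := sq_nonneg (u 0)
  refine ⟨(abs_le_of_sq_le_sq' (by linarith) hR).2, (abs_le_of_sq_le_sq' (by linarith) hR).2,
    abs_le_of_sq_le_sq (by linarith) hR, norm_le_of_sum_sq_le hR (by linarith), fun n hn => ?_,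
    fun m hm => ?_⟩
  · have := Finset.single_le_sum (f := fun n => x1 n 0 ^ 2) (fun _ _ => sq_nonneg _) hn
    exact abs_le_of_sq_le_sq (by linarith) hR
  · have := Finset.single_le_sum (f := fun m => x2 m 0 ^ 2) (fun _ _ => sq_nonneg _) hm
    exact abs_le_of_sq_le_sq (by linarith) hR

theorem norm_lifted_le {u : ℝ → ℝ} {z : ℝ → L2I} {R t : ℝ} (hz : ‖z t‖ ≤ R) (hu : |u t| ≤ R) :
    ‖lifted u z t‖ ≤ (1 + ‖toL2 beta‖) * R := by
  refine (norm_add_le _ _).trans ?_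
  rw [norm_smul, Real.norm_eq_abs]
  have := mul_le_mul_of_nonneg_right hu (norm_nonneg (toL2 beta))
  linarith

theorem dotProduct_C₁ (a b s : ℝ) (c : L2I) (N₀ M₀ : ℕ) (u : ℝ → ℝ) (y z : ℝ → L2I) (t : ℝ) :
    C₁ a b s c N₀ M₀ ⬝ᵥ lowModes a b s N₀ M₀ u y z t
      = ∑ n : Fin (N₀ + 1), c1 c n * mode1 a b s u y z n t
        + ∑ m : Fin (M₀ + 1), c2 a b s c m * mode2 u z m t := by
  simp [C₁, lowModes, dotProduct, Fintype.sum_sum_type]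

/-- A weighted sum of quantities that decay. -/
theorem abs_sum_mul_le {S : Finset ℕ} {c f : ℕ → ℝ} {D e : ℝ}
    (h : ∀ n ∈ S, |f n| ≤ e * D) : |∑ n ∈ S, c n * f n| ≤ e * ((∑ n ∈ S, |c n|) * D) := by
  refine (Finset.abs_sum_le_sum_abs _ _).trans ?_
  rw [Finset.sum_mul, Finset.mul_sum]
  refine Finset.sum_le_sum fun n hn => ?_
  rw [abs_mul]
  calc _ ≤ |c n| * (e * D) := by gcongr; exact h n hn
    _ = _ := by ring

section SmallGain

variable {a b s : ℝ} {c : L2I} {δ : ℝ} {N₀ M₀ : ℕ}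

/-- The loop is closed on a fixed interval `[0, T]`, where the weighted maximum `U` of the control
is finite by compactness. The result is a bound on `U` independent of `T`, evaluated at the final
time. -/
theorem exists_lowModes_decay
    (hN₀ : lam1 a (N₀ + 1) < -δ) (hM₀ : lam2 b (M₀ + 1) < -δ)
    (hΔ : ∀ n m : ℕ, (n, m) ∈ Delta a b → n ≤ N₀ ∧ m ≤ M₀)
    {Kx : Idx N₀ M₀ → ℝ} {ku : ℝ} {L : Idx N₀ M₀ → ℝ}
    (hK : SpectralAbscissaLT (A₁a a b s N₀ M₀
      - Matrix.vecMulVec (B₁a a b s N₀ M₀) (Sum.elim Kx (fun _ : Unit => ku))) δ)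
    (hL : SpectralAbscissaLT (A₁ a b s N₀ M₀ - Matrix.vecMulVec L (C₁ a b s c N₀ M₀)) δ) :
    ∃ N₁ M₁ : ℕ, ∀ N M : ℕ, N₀ ≤ N → N₁ ≤ N → M₀ ≤ M → M₁ ≤ M →
      ∃ K : ℝ, 0 ≤ K ∧
        ∀ (y z : ℝ → L2I) (u v : ℝ → ℝ) (X : ℝ → Idx N₀ M₀ → ℝ) (x1 x2 : ℕ → ℝ → ℝ),
          IsClosedLoopSolution a b s c N₀ M₀ N M Kx ku L y z u v X x1 x2 →
          ∀ R : ℝ, 0 ≤ R →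
          ‖y 0‖ ^ 2 + ‖z 0‖ ^ 2 + controllerNormSq N₀ M₀ N M u X x1 x2 0 ≤ R ^ 2 →
          ∀ t : ℝ, 0 ≤ t →
            ‖X t‖ ≤ K * R * Real.exp (-δ * t) ∧ |u t| ≤ K * R * Real.exp (-δ * t) ∧
            |v t| ≤ K * R * Real.exp (-δ * t) ∧
            ‖lowModes a b s N₀ M₀ u y z t‖ ≤ K * R * Real.exp (-δ * t) := by
  have hΔ1 : ∀ n m : ℕ, (n, m) ∈ Delta a b → n ≤ N₀ := fun n m h => (hΔ n m h).1
  obtain ⟨κ, hκ, hcore⟩ := exists_observer_feedback_bound hK hL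
  obtain ⟨G1, hG1, hm1⟩ := exists_mode1_decay s hN₀ hΔ1
  obtain ⟨G2, hG2, hm2⟩ := exists_mode2_decay hM₀
  obtain ⟨d, hcd, hmeas⟩ := exists_measurement s c hΔ1
  obtain ⟨Kp, hKp, hinit⟩ := exists_tsum_mode1_le s hΔ1
  obtain ⟨g1, -, hgap1⟩ := exists_gap1 hN₀
  obtain ⟨g2, -, hgap2⟩ := exists_gap2 hM₀
  -- A quarter for each of the two families leaves a total gain of one half.
  have hev : ∀ (c : ℕ → ℝ) (G : ℝ), ∃ N₁ : ℕ, ∀ N, N₁ ≤ N → κ * (G * tailGain c N) ≤ 1 / 4 := by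
    intro c G
    have h1 := ((tendsto_tailGain c).const_mul G).const_mul κ
    rw [mul_zero, mul_zero] at h1
    obtain ⟨N₁, h2⟩ := Filter.eventually_atTop.1 (h1.eventually (gt_mem_nhds (by norm_num :
      (0 : ℝ) < 1 / 4)))
    exact ⟨N₁, fun N hN => (h2 N hN).le⟩
  obtain ⟨N₁, hN₁⟩ := hev (c1 c) G1
  obtain ⟨M₁, hM₁⟩ := hev (c2 a b s c) G2
  refine ⟨N₁, M₁, fun N M hNN hN hMM hM => ?_⟩
  -- `W * R` bounds the lifted second component at time 0, and `B * R` the `ℓ²` norm of the initial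
  -- values of the first family. `J1` and `J2` collect the observer errors of the intermediate
  -- modes, and `J` everything that multiplies the initial size `R`.
  set W := 1 + ‖toL2 beta‖ with hW
  set B := Kp * (1 + W) with hB
  have hW0 : 0 ≤ W := by positivity
  have hB0 : 0 ≤ B := by positivity
  set J1 := (∑ n ∈ Finset.Ioc N₀ N, |c1 c n|) * (B + 1) with hJ1
  set J2 := (∑ m ∈ Finset.Ioc M₀ M, |c2 a b s c m|) * (W + 1) with hJ2
  have hJ10 : 0 ≤ J1 := mul_nonneg (Finset.sum_nonneg fun _ _ => abs_nonneg _) (by linarith)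
  have hJ20 : 0 ≤ J2 := mul_nonneg (Finset.sum_nonneg fun _ _ => abs_nonneg _) (by linarith)
  set J := (3 + B + W) + J1 + J2 + (‖c‖ * B + ‖d‖ * W) with hJ
  have hJ0 : 0 ≤ J := by positivity
  refine ⟨2 * κ * J, by positivity, fun y z u v X x1 x2 hsol R hR hE T hT => ?_⟩
  obtain ⟨hy0, hz0, hu0, hX0, hx10, hx20⟩ := initial_bounds hR hE
  have hctr := hsol.controller
  have hpl := hsol.plant
  have hdu := hctr.deriv_u
  have hw0 : ‖lifted u z 0‖ ≤ W * R := norm_lifted_le hz0 hu0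
  set p1 := mode1 a b s u y z with hp1
  set p2 := mode2 u z with hp2
  set P := lowModes a b s N₀ M₀ u y z with hP
  -- initial data of the modes
  have hs1 : Summable (fun n => p1 n 0 ^ 2) ∧ ∑' n, p1 n 0 ^ 2 ≤ (B * R) ^ 2 := by
    simp only [hp1, mode1_eq]
    obtain ⟨h1, h2⟩ := hinit (y 0) (lifted u z 0)
    refine ⟨h1, h2.trans (pow_le_pow_left₀ (by positivity) ?_ 2)⟩
    rw [hB, mul_assoc]
    gcongr
    linarith
  have hs2 : Summable (fun m => p2 m 0 ^ 2) ∧ ∑' m, p2 m 0 ^ 2 ≤ (W * R) ^ 2 := by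
    simp only [hp2, mode2_eq]
    have h1 := hasSum_sq_psi2 (lifted u z 0)
    refine ⟨h1.summable, ?_⟩
    rw [h1.tsum_eq]
    exact pow_le_pow_left₀ (norm_nonneg _) hw0 2
  have hBR : 0 ≤ B * R := by positivity
  have hWR : 0 ≤ W * R := by positivity
  have hb1 := abs_le_of_tsum_sq_le hBR hs1.1 hs1.2
  have hb2 := abs_le_of_tsum_sq_le hWR hs2.1 hs2.2
  have hc1s : Summable fun n => c1 c n ^ 2 := (hasSum_sq_phi1 c).summable
  have hc2s : HasSum (fun m => c2 a b s c m ^ 2) (‖d‖ ^ 2) := by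
    simpa only [hcd, neg_sq] using hasSum_sq_psi2 d
  obtain ⟨hz1, hz1'⟩ := summable_abs_mul_abs (norm_nonneg c) hBR hc1s
    (hasSum_sq_phi1 c).tsum_eq.le hs1.1 hs1.2
  obtain ⟨hz2, hz2'⟩ := summable_abs_mul_abs (norm_nonneg d) hWR hc2s.summable
    hc2s.tsum_eq.le hs2.1 hs2.2
  have hP0 : ‖P 0‖ ≤ (B + W) * R := by
    rw [pi_norm_le_iff_of_nonneg (by positivity)]
    rintro (n | m)
    · exact (hb1 n).trans (by linarith)
    · exact (hb2 m).trans (by linarith)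
  have hPX0 : ‖P 0 - X 0‖ ≤ (B + W + 1) * R := by
    refine (norm_sub_le _ _).trans ?_
    linarith
  -- the supremum of the control
  have hXc : ContinuousOn X (Icc 0 T) := fun t ht =>
    ((hctr.deriv_X t ht.1).continuousWithinAt).mono Icc_subset_Ici_self
  have huc : ContinuousOn u (Icc 0 T) := fun t ht =>
    ((hdu t ht.1).continuousWithinAt).mono Icc_subset_Ici_self
  have hvc : ContinuousOn v (Icc 0 T) := by
    have h1 : ContinuousOn (fun t => -(Kx ⬝ᵥ X t) - ku * u t) (Icc 0 T) := by
      refine ContinuousOn.sub (ContinuousOn.neg ?_) (continuousOn_const.mul huc)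
      simp only [dotProduct]
      exact continuousOn_finsetSum _ fun i _ => continuousOn_const.mul (continuousOn_pi.1 hXc i)
    exact h1.congr fun t ht => hctr.feedback t ht.1
  have hfc : ContinuousOn (fun t => max |u t| |v t| * Real.exp (δ * t)) (Icc 0 T) :=
    (ContinuousOn.sup (ContinuousOn.abs huc) (ContinuousOn.abs hvc)).mul (by fun_prop)
  obtain ⟨t₀, ht₀, hmax⟩ := isCompact_Icc.exists_isMaxOn (nonempty_Icc.2 hT) hfc
  set U := max |u t₀| |v t₀| * Real.exp (δ * t₀) with hU
  have hU0 : 0 ≤ U := by positivity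
  have hexp : ∀ t : ℝ, Real.exp (δ * t) * Real.exp (-δ * t) = 1 := by
    intro t; rw [← Real.exp_add]; ring_nf; simp
  have hUb : ∀ t, 0 ≤ t → t ≤ T → |u t| ≤ U * Real.exp (-δ * t) ∧ |v t| ≤ U * Real.exp (-δ * t) := by
    intro t h1 h2
    have h3 : max |u t| |v t| * Real.exp (δ * t) ≤ U := hmax ⟨h1, h2⟩
    have h4 := mul_le_mul_of_nonneg_right h3 (Real.exp_pos (-δ * t)).le
    rw [mul_assoc, hexp, mul_one] at h4
    exact ⟨(le_max_left _ _).trans h4, (le_max_right _ _).trans h4⟩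
  -- the perturbation of the measurement
  set H := J1 * R + J2 * R + (‖c‖ * (B * R) + ‖d‖ * (W * R))
    + (G1 * tailGain (c1 c) N + G2 * tailGain (c2 a b s c) M) * U with hH
  set η : ℝ → ℝ := fun t => pairing c (y t) - C₁ a b s c N₀ M₀ ⬝ᵥ P t
    - ∑ n ∈ Finset.Ioc N₀ N, c1 c n * x1 n t - ∑ m ∈ Finset.Ioc M₀ M, c2 a b s c m * x2 m t with hη
  have hηb : ∀ t, 0 ≤ t → t ≤ T → |η t| ≤ H * Real.exp (-δ * t) := by
    intro t h1 h2
    set e := Real.exp (-δ * t) with he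
    have he0 : 0 ≤ e := (Real.exp_pos _).le
    obtain ⟨hS1, hS2⟩ := hmeas (y t) (lifted u z t)
    simp only [← mode1_eq, ← mode2_eq, ← hp1, ← hp2] at hS1 hS2
    have t1 := abs_sub_sum_range_le (D := G1 * U) hS1 hc1s hz1 he0
      (fun n hn => hm1 u v (p1 n) U T hUb n (lt_of_le_of_lt hNN hn) (fun r hr =>
        hpl.hasDerivWithinAt_mode1_of_not_mem hdu
          (fun k hk => by have := hΔ1 n k hk; omega) hr) t h1 h2)
    have t2 := abs_sub_sum_range_le (D := G2 * U) hS2 hc2s.summable hz2 he0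
      (fun m hm => hm2 u v (p2 m) U T hUb m (lt_of_le_of_lt hMM hm) (fun r hr =>
        hpl.hasDerivWithinAt_mode2 hdu m hr) t h1 h2)
    have t3 : |∑ n ∈ Finset.Ioc N₀ N, c1 c n * (p1 n t - x1 n t)| ≤ e * (J1 * R) := by
      have := abs_sum_mul_le (S := Finset.Ioc N₀ N) (c := c1 c) (f := fun n => p1 n t - x1 n t)
        (D := (B + 1) * R) (e := e) (fun n hn => by
          have hn' := (Finset.mem_Ioc.1 hn).1
          have hnot : ∀ k, (n, k) ∉ Delta a b := fun k hk => by have := hΔ1 n k hk; omega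
          refine (abs_observation_error_le (hgap1 n hn').1
            (fun r hr => hpl.hasDerivWithinAt_mode1_of_not_mem hdu hnot hr)
            (fun r hr => hctr.deriv_x1 n hn r hr) h1).trans ?_
          gcongr
          refine (abs_sub _ _).trans ?_
          have := hb1 n
          have := hx10 n hn
          linarith)
      rwa [← mul_assoc (∑ n ∈ Finset.Ioc N₀ N, |c1 c n|)] at this
    have t4 : |∑ m ∈ Finset.Ioc M₀ M, c2 a b s c m * (p2 m t - x2 m t)| ≤ e * (J2 * R) := by
      have := abs_sum_mul_le (S := Finset.Ioc M₀ M) (c := c2 a b s c)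
        (f := fun m => p2 m t - x2 m t)
        (D := (W + 1) * R) (e := e) (fun m hm => by
          have hm' := (Finset.mem_Ioc.1 hm).1
          refine (abs_observation_error_le (hgap2 m hm').1
            (fun r hr => hpl.hasDerivWithinAt_mode2 hdu m hr)
            (fun r hr => hctr.deriv_x2 m hm r hr) h1).trans ?_
          gcongr
          refine (abs_sub _ _).trans ?_
          have := hb2 m
          have := hx20 m hm
          linarith)
      rwa [← mul_assoc (∑ m ∈ Finset.Ioc M₀ M, |c2 a b s c m|)] at this
    rw [sum_range_eq_fin_add_Ioc _ hNN] at t1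
    rw [sum_range_eq_fin_add_Ioc _ hMM] at t2
    have hdot := dotProduct_C₁ a b s c N₀ M₀ u y z t
    rw [← hP, ← hp1, ← hp2] at hdot
    simp only [mul_sub, Finset.sum_sub_distrib] at t3 t4
    -- In order: the neglected modes of each family, then the observer errors of the intermediate
    -- modes of each family. The two terms in `d` cancel.
    have hsplit : η t = (pairing c (y t) + inner ℝ d (lifted u z t)
          - (∑ n : Fin (N₀ + 1), c1 c n * p1 n t + ∑ n ∈ Finset.Ioc N₀ N, c1 c n * p1 n t))
        + (-inner ℝ d (lifted u z t) - (∑ m : Fin (M₀ + 1), c2 a b s c m * p2 m t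
          + ∑ m ∈ Finset.Ioc M₀ M, c2 a b s c m * p2 m t))
        + (∑ n ∈ Finset.Ioc N₀ N, c1 c n * p1 n t - ∑ n ∈ Finset.Ioc N₀ N, c1 c n * x1 n t)
        + (∑ m ∈ Finset.Ioc M₀ M, c2 a b s c m * p2 m t
          - ∑ m ∈ Finset.Ioc M₀ M, c2 a b s c m * x2 m t) := by
      simp only [hη, hdot]; ring
    rw [hsplit]
    refine (abs_add_le _ _).trans ?_
    refine (add_le_add ((abs_add_le _ _).trans (add_le_add (abs_add_le _ _) le_rfl)) le_rfl).trans ?_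
    have q1 := mul_le_mul_of_nonneg_left hz1' he0
    have q2 := mul_le_mul_of_nonneg_left hz2' he0
    calc _ ≤ e * (∑' n, |c1 c n| * |p1 n 0| + G1 * U * tailGain (c1 c) N)
          + e * (∑' m, |c2 a b s c m| * |p2 m 0| + G2 * U * tailGain (c2 a b s c) M)
          + e * (J1 * R) + e * (J2 * R) := add_le_add (add_le_add (add_le_add t1 t2) t3) t4
      _ ≤ H * e := by rw [hH]; linarith
  have hcoreT := hcore T H X P u v η hctr.feedback hdu
    (fun t h1 => (hctr.deriv_X t h1).congr_deriv (by
      rw [sub_eq_add_neg, ← neg_smul]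
      congr 2
      simp only [hη, dotProduct_sub]
      ring))
    (fun t h1 => hpl.hasDerivWithinAt_lowModes hΔ hdu h1) hηb
  set I := ‖X 0‖ + |u 0| + ‖P 0 - X 0‖ + H with hI
  -- The choice of `N₁` and `M₁` turns the coefficient of `U` into one half; with `hUle` below, `U`
  -- is absorbed and the factor 2 in the constant appears.
  have hIle : κ * I ≤ κ * (J * R) + 1 / 2 * U := by
    have h1 := mul_le_mul_of_nonneg_right (hN₁ N hN) hU0
    have h2 := mul_le_mul_of_nonneg_right (hM₁ M hM) hU0
    have h3 : I ≤ J * R + (G1 * tailGain (c1 c) N + G2 * tailGain (c2 a b s c) M) * U := by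
      rw [hI, hH, hJ]; linarith
    have h4 := mul_le_mul_of_nonneg_left h3 hκ
    linarith
  -- The finite-dimensional estimate is read at the time `t₀` where the weighted maximum is
  -- attained.
  have hUle : U ≤ κ * I := by
    obtain ⟨-, h1, h2, -⟩ := hcoreT t₀ ht₀.1 ht₀.2
    have h3 := mul_le_mul_of_nonneg_right (max_le h1 h2) (Real.exp_pos (δ * t₀)).le
    rw [mul_assoc (κ * I), mul_comm (Real.exp (-δ * t₀)), hexp, mul_one] at h3
    exact h3
  have hfin : κ * I ≤ 2 * κ * J * R := by linarith
  obtain ⟨h1, h2, h3, h4⟩ := hcoreT T hT le_rfl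
  have h5 := mul_le_mul_of_nonneg_right hfin (Real.exp_pos (-δ * T)).le
  exact ⟨h1.trans h5, h2.trans h5, h3.trans h5, h4.trans h5⟩

end SmallGain

/-! ### Decay of all modes -/

/-- Once the control decays, each high mode and each observer state is a stable mode with known
input. The lifting is then removed, so that the bounds concern `y` and `z` themselves. -/
theorem exists_modal_decay {a b s : ℝ} {c : L2I} {δ : ℝ} {N₀ M₀ : ℕ} (hδ : 0 < δ)
    (hN₀ : lam1 a (N₀ + 1) < -δ) (hM₀ : lam2 b (M₀ + 1) < -δ)
    (hΔ : ∀ n m : ℕ, (n, m) ∈ Delta a b → n ≤ N₀ ∧ m ≤ M₀)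
    {Kx : Idx N₀ M₀ → ℝ} {ku : ℝ} {L : Idx N₀ M₀ → ℝ}
    (hK : SpectralAbscissaLT (A₁a a b s N₀ M₀
      - Matrix.vecMulVec (B₁a a b s N₀ M₀) (Sum.elim Kx (fun _ : Unit => ku))) δ)
    (hL : SpectralAbscissaLT (A₁ a b s N₀ M₀ - Matrix.vecMulVec L (C₁ a b s c N₀ M₀)) δ) :
    ∃ N₁ M₁ : ℕ, ∀ N M : ℕ, N₀ ≤ N → N₁ ≤ N → M₀ ≤ M → M₁ ≤ M →
      ∃ K : ℝ, 0 ≤ K ∧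
        ∀ (y z : ℝ → L2I) (u v : ℝ → ℝ) (X : ℝ → Idx N₀ M₀ → ℝ) (x1 x2 : ℕ → ℝ → ℝ),
          IsClosedLoopSolution a b s c N₀ M₀ N M Kx ku L y z u v X x1 x2 →
          ∀ R : ℝ, 0 ≤ R →
          ‖y 0‖ ^ 2 + ‖z 0‖ ^ 2 + controllerNormSq N₀ M₀ N M u X x1 x2 0 ≤ R ^ 2 →
          ∀ t : ℝ, 0 ≤ t →
            controllerNormSq N₀ M₀ N M u X x1 x2 t ≤ K * R ^ 2 * Real.exp (-δ * t) ^ 2 ∧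
            (∀ n, |coord1 a b s y z n t| ≤ Real.exp (-δ * t) *
              (|coord1 a b s y z n 0| + K * R * (1 / ((n : ℝ) + 1) ^ 2))) ∧
            ∀ m, |coord2 z m t| ≤ Real.exp (-δ * t) *
              (|coord2 z m 0| + K * R * (1 / ((m : ℝ) + 1) ^ 2)) := by
  have hΔ1 : ∀ n m : ℕ, (n, m) ∈ Delta a b → n ≤ N₀ := fun n m h => (hΔ n m h).1
  obtain ⟨N₁, M₁, hlow⟩ := exists_lowModes_decay hN₀ hM₀ hΔ hK hL
  obtain ⟨G1, hG1, hm1⟩ := exists_mode1_decay s hN₀ hΔ1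
  obtain ⟨G2, hG2, hm2⟩ := exists_mode2_decay hM₀
  obtain ⟨b1, hb1, hbeta1⟩ := exists_beta1_le s hδ hN₀ hΔ1
  obtain ⟨b2, hb2, hbeta2⟩ := exists_beta2_le hδ hM₀
  refine ⟨N₁, M₁, fun N M hNN hN hMM hM => ?_⟩
  obtain ⟨K, hK0, hlow⟩ := hlow N M hNN hN hMM hM
  set Kc := K ^ 2 + Fintype.card (Idx N₀ M₀) * K ^ 2
    + (Finset.Ioc N₀ N).card * (1 + G1 * K) ^ 2 + (Finset.Ioc M₀ M).card * (1 + G2 * K) ^ 2 with hKc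
  set K1 := K * ((N₀ : ℝ) + 1) ^ 2 + G1 * K + b1 + K * b1 with hK1
  set K2 := K * ((M₀ : ℝ) + 1) ^ 2 + G2 * K + b2 + K * b2 with hK2
  have hKc0 : 0 ≤ Kc := by positivity
  have hK10 : 0 ≤ K1 := by positivity
  have hK20 : 0 ≤ K2 := by positivity
  refine ⟨Kc + K1 + K2, by positivity, fun y z u v X x1 x2 hsol R hR hE t ht => ?_⟩
  obtain ⟨hy0, hz0, hu0, hX0, hx10, hx20⟩ := initial_bounds hR hE
  have hctr := hsol.controller
  have hpl := hsol.plant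
  have hdu := hctr.deriv_u
  have hUb : ∀ r, 0 ≤ r → r ≤ t →
      |u r| ≤ K * R * Real.exp (-δ * r) ∧ |v r| ≤ K * R * Real.exp (-δ * r) := fun r hr _ =>
    ⟨(hlow y z u v X x1 x2 hsol R hR hE r hr).2.1, (hlow y z u v X x1 x2 hsol R hR hE r hr).2.2.1⟩
  obtain ⟨hX, hu, hv, hP⟩ := hlow y z u v X x1 x2 hsol R hR hE t ht
  set e := Real.exp (-δ * t) with he
  have he0 : 0 ≤ e := (Real.exp_pos _).le
  have hKR : 0 ≤ K * R := mul_nonneg hK0 hR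
  -- One computation for both families, with `p` the lifted coordinate and `q` the original one. For
  -- `n ≤ n₀` the factor `(n₀ + 1)²` compensates the weight `1/(n+1)²`; `B` and `K * B` pay for the
  -- lifting at time 0 and at time `t`.
  have aux : ∀ (p p0 q q0 β B G K' : ℝ) (n n₀ : ℕ), 0 ≤ B → 0 ≤ G →
      p = q + u t * β → p0 = q0 + u 0 * β →
      |β| ≤ B / ((n : ℝ) + 1) ^ 2 →
      K * ((n₀ : ℝ) + 1) ^ 2 + G * K + B + K * B ≤ K' →
      (n ≤ n₀ → |p| ≤ K * R * e) →
      (n₀ < n → |p| ≤ e * (|p0| + G * (K * R) * (1 / ((n : ℝ) + 1) ^ 2))) →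
      |q| ≤ e * (|q0| + K' * R * (1 / ((n : ℝ) + 1) ^ 2)) := by
    intro p p0 q q0 β B G K' n n₀ hB hG hp hp0 hβ hK' hlo hhi
    set w : ℝ := 1 / ((n : ℝ) + 1) ^ 2 with hw
    have hw0 : 0 ≤ w := by positivity
    have hβ' : |β| ≤ B * w := by rw [hw, mul_one_div]; exact hβ
    have hq : |q| ≤ |p| + K * R * e * (B * w) := by
      have h1 : q = p - u t * β := by rw [hp]; ring
      rw [h1]
      refine (abs_sub _ _).trans (add_le_add le_rfl ?_)
      rw [abs_mul]
      exact mul_le_mul hu hβ' (abs_nonneg _) (by positivity)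
    have hp0' : |p0| ≤ |q0| + R * (B * w) := by
      rw [hp0]
      refine (abs_add_le _ _).trans (add_le_add le_rfl ?_)
      rw [abs_mul]
      exact mul_le_mul hu0 hβ' (abs_nonneg _) hR
    have hpb : |p| ≤ e * (|q0| + (K * ((n₀ : ℝ) + 1) ^ 2 + G * K + B) * R * w) := by
      have hq0 := abs_nonneg q0
      rcases le_or_gt n n₀ with hn | hn
      · have h1 : 1 ≤ ((n₀ : ℝ) + 1) ^ 2 * w := by
          rw [hw, mul_one_div, one_le_div (by positivity)]
          have : (n : ℝ) ≤ n₀ := by exact_mod_cast hn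
          gcongr
        have h2 : K * R * e ≤ K * R * e * (((n₀ : ℝ) + 1) ^ 2 * w) :=
          le_mul_of_one_le_right (by positivity) h1
        have h3 : 0 ≤ e * (|q0| + (G * K + B) * R * w) := by positivity
        linarith [hlo hn]
      · have h1 := mul_le_mul_of_nonneg_left hp0' he0
        have h2 : 0 ≤ e * (K * ((n₀ : ℝ) + 1) ^ 2 * R * w) := by positivity
        linarith [hhi hn]
    have h4 : (K * ((n₀ : ℝ) + 1) ^ 2 + G * K + B + K * B) * (e * R * w) ≤ K' * (e * R * w) := by
      gcongr
    linarith
  have hdu0 : ∀ n, N₀ < n → ∀ k, (n, k) ∉ Delta a b := fun n hn k hk => by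
    have := hΔ1 n k hk; omega
  refine ⟨?_, fun n => ?_, fun m => ?_⟩
  · have hbd : ∀ {x D : ℝ}, |x| ≤ D * R * e → x ^ 2 ≤ D ^ 2 * R ^ 2 * e ^ 2 := by
      intro x D h
      rw [← sq_abs]
      calc |x| ^ 2 ≤ (D * R * e) ^ 2 := pow_le_pow_left₀ (abs_nonneg _) h 2
        _ = _ := by ring
    have s1 : ∑ i, X t i ^ 2 ≤ Fintype.card (Idx N₀ M₀) * (K ^ 2 * R ^ 2 * e ^ 2) := by
      have := Finset.sum_le_card_nsmul Finset.univ (fun i => X t i ^ 2) (K ^ 2 * R ^ 2 * e ^ 2)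
        (fun i _ => hbd ((norm_le_pi_norm (X t) i).trans hX))
      simpa only [nsmul_eq_mul, Finset.card_univ] using this
    have wle : ∀ n : ℕ, 1 / ((n : ℝ) + 1) ^ 2 ≤ 1 := fun n => by
      rw [div_le_one (by positivity)]
      exact one_le_pow₀ (by linarith [Nat.cast_nonneg (α := ℝ) n])
    have hxb : ∀ {x0 G : ℝ} {n : ℕ}, |x0| ≤ R → 0 ≤ G →
        e * (|x0| + G * (K * R) * (1 / ((n : ℝ) + 1) ^ 2)) ≤ (1 + G * K) * R * e := by
      intro x0 G n h0 hG
      have : G * (K * R) * (1 / ((n : ℝ) + 1) ^ 2) ≤ G * (K * R) * 1 := by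
        gcongr; exact wle n
      calc _ ≤ e * (R + G * (K * R) * 1) := by gcongr
        _ = _ := by ring
    have s2 : ∑ n ∈ Finset.Ioc N₀ N, x1 n t ^ 2
        ≤ (Finset.Ioc N₀ N).card * ((1 + G1 * K) ^ 2 * R ^ 2 * e ^ 2) := by
      have := Finset.sum_le_card_nsmul (Finset.Ioc N₀ N) (fun n => x1 n t ^ 2)
        ((1 + G1 * K) ^ 2 * R ^ 2 * e ^ 2) (fun n hn => hbd
          ((hm1 u v (x1 n) (K * R) t hUb n (Finset.mem_Ioc.1 hn).1 (hctr.deriv_x1 n hn) t ht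
            le_rfl).trans (hxb (hx10 n hn) hG1)))
      simpa only [nsmul_eq_mul] using this
    have s3 : ∑ m ∈ Finset.Ioc M₀ M, x2 m t ^ 2
        ≤ (Finset.Ioc M₀ M).card * ((1 + G2 * K) ^ 2 * R ^ 2 * e ^ 2) := by
      have := Finset.sum_le_card_nsmul (Finset.Ioc M₀ M) (fun m => x2 m t ^ 2)
        ((1 + G2 * K) ^ 2 * R ^ 2 * e ^ 2) (fun m hm => hbd
          ((hm2 u v (x2 m) (K * R) t hUb m (Finset.mem_Ioc.1 hm).1 (hctr.deriv_x2 m hm) t ht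
            le_rfl).trans (hxb (hx20 m hm) hG2)))
      simpa only [nsmul_eq_mul] using this
    have s0 := hbd hu
    unfold controllerNormSq
    have h6 : 0 ≤ (K1 + K2) * (R ^ 2 * e ^ 2) := by positivity
    have h7 : Kc * (R ^ 2 * e ^ 2) = K ^ 2 * R ^ 2 * e ^ 2
      + Fintype.card (Idx N₀ M₀) * (K ^ 2 * R ^ 2 * e ^ 2)
      + (Finset.Ioc N₀ N).card * ((1 + G1 * K) ^ 2 * R ^ 2 * e ^ 2)
      + (Finset.Ioc M₀ M).card * ((1 + G2 * K) ^ 2 * R ^ 2 * e ^ 2) := by rw [hKc]; ring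
    linarith
  · refine aux (mode1 a b s u y z n t) (mode1 a b s u y z n 0) _ _ (beta1 a b s n) b1 G1 _ n N₀ hb1
      hG1 rfl rfl (hbeta1 n) (by linarith) (fun hn => ?_) (fun hn => ?_)
    · exact (norm_le_pi_norm (lowModes a b s N₀ M₀ u y z t)
        (Sum.inl ⟨n, Nat.lt_succ_of_le hn⟩)).trans hP
    · exact hm1 u v (mode1 a b s u y z n) (K * R) t hUb n hn
        (fun r hr => hpl.hasDerivWithinAt_mode1_of_not_mem hdu (hdu0 n hn) hr) t ht le_rfl
  · refine aux (mode2 u z m t) (mode2 u z m 0) _ _ (beta2 m) b2 G2 _ m M₀ hb2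
      hG2 rfl rfl (hbeta2 m) (by linarith) (fun hm => ?_) (fun hm => ?_)
    · exact (norm_le_pi_norm (lowModes a b s N₀ M₀ u y z t)
        (Sum.inr ⟨m, Nat.lt_succ_of_le hm⟩)).trans hP
    · exact hm2 u v (mode2 u z m) (K * R) t hUb m hm
        (fun r hr => hpl.hasDerivWithinAt_mode2 hdu m hr) t ht le_rfl

/-! ### From the modes to the state -/

theorem tsum_sq_le_of_decay {f g : ℕ → ℝ} {e D B : ℝ} (hg : Summable fun n => g n ^ 2)
    (hB : ∑' n, g n ^ 2 ≤ B) (h : ∀ n : ℕ, |f n| ≤ e * (|g n| + D * (1 / ((n : ℝ) + 1)))) :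
    Summable (fun n => f n ^ 2) ∧ ∑' n, f n ^ 2
      ≤ e ^ 2 * (2 * B + 2 * D ^ 2 * ∑' n : ℕ, 1 / ((n : ℝ) + 1) ^ 2) := by
  have hb : ∀ n, f n ^ 2 ≤ e ^ 2 * (2 * g n ^ 2 + 2 * D ^ 2 * (1 / ((n : ℝ) + 1) ^ 2)) := by
    intro n
    rw [← sq_abs]
    refine (pow_le_pow_left₀ (abs_nonneg _) (h n) 2).trans ?_
    rw [mul_pow]
    gcongr
    rw [← sq_abs (g n)]
    have : (1 / ((n : ℝ) + 1) ^ 2) = (1 / ((n : ℝ) + 1)) ^ 2 := by rw [div_pow, one_pow]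
    rw [this]
    nlinarith [sq_nonneg (|g n| - D * (1 / ((n : ℝ) + 1)))]
  have hs := ((hg.hasSum.mul_left 2).add
    (summable_one_div_sq.hasSum.mul_left (2 * D ^ 2))).mul_left (e ^ 2)
  have hsum := Summable.of_nonneg_of_le (fun n => sq_nonneg _) hb hs.summable
  refine ⟨hsum, (hsum.tsum_le_tsum hb hs.summable).trans ?_⟩
  rw [hs.tsum_eq]
  gcongr

theorem one_div_sq_le (n : ℕ) : 1 / ((n : ℝ) + 1) ^ 2 ≤ 1 / ((n : ℝ) + 1) := by
  have : (1 : ℝ) ≤ (n : ℝ) + 1 := by linarith [Nat.cast_nonneg (α := ℝ) n]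
  gcongr
  nlinarith

theorem le_sqrt_mul {x S R e : ℝ} (hS : 0 ≤ S) (hR : 0 ≤ R) (he : 0 ≤ e)
    (h : x ^ 2 ≤ e ^ 2 * (S * R ^ 2)) : x ≤ e * (Real.sqrt S * R) := by
  refine (abs_le_of_sq_le_sq' (h.trans_eq ?_) (by positivity)).2
  rw [mul_pow, mul_pow, Real.sq_sqrt hS]

/-- `z` comes first, by Parseval for `psi2`. Then the coefficients of `y` are `coord1` minus
pairings of `z` with `psi1 n`, which are `O(‖z‖/n)` and hence square summable. -/
theorem exists_L2_decay {a b : ℝ} (s : ℝ) {N₀ : ℕ} (hΔ : ∀ n m, (n, m) ∈ Delta a b → n ≤ N₀)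
    {K : ℝ} (hK : 0 ≤ K) :
    ∃ C, 0 ≤ C ∧ ∀ (y z : ℝ → L2I) (R t e : ℝ), 0 ≤ e → 0 ≤ R → ‖y 0‖ ≤ R → ‖z 0‖ ≤ R →
      (∀ n, |coord1 a b s y z n t| ≤ e *
        (|coord1 a b s y z n 0| + K * R * (1 / ((n : ℝ) + 1) ^ 2))) →
      (∀ m, |coord2 z m t| ≤ e * (|coord2 z m 0| + K * R * (1 / ((m : ℝ) + 1) ^ 2))) →
      ‖y t‖ ^ 2 + ‖z t‖ ^ 2 ≤ e ^ 2 * (C * R ^ 2) := by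
  obtain ⟨C, hC, hpsi⟩ := exists_norm_psi1_le s hΔ
  set Q : ℝ := ∑' n : ℕ, 1 / ((n : ℝ) + 1) ^ 2 with hQ
  have hQ0 : 0 ≤ Q := tsum_nonneg fun n => by positivity
  set S := 2 + 2 * K ^ 2 * Q with hS
  have hS0 : 0 ≤ S := by positivity
  -- The three terms come from the response to the control, from `z t` and from `z 0`.
  set D := K + C * Real.sqrt S + C with hD
  have hD0 : 0 ≤ D := by positivity
  refine ⟨(2 + 2 * D ^ 2 * Q) + S, by positivity, fun y z R t e he hR hy hz h1 h2 => ?_⟩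
  have hy2 : ‖y 0‖ ^ 2 ≤ R ^ 2 := by gcongr
  have hz2 : ‖z 0‖ ^ 2 ≤ R ^ 2 := by gcongr
  have hzt : ‖z t‖ ^ 2 ≤ e ^ 2 * (S * R ^ 2) := by
    have h3 := (tsum_sq_le_of_decay (f := fun m => pairing (z t) (psi2 m)) (D := K * R)
      (hasSum_sq_psi2 (z 0)).summable ((hasSum_sq_psi2 (z 0)).tsum_eq.le.trans hz2)
      (fun m => (h2 m).trans (by gcongr ?_ * (?_ + ?_ * ?_); exacts [le_rfl, one_div_sq_le m]))).2
    rw [(hasSum_sq_psi2 (z t)).tsum_eq] at h3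
    refine h3.trans_eq ?_
    rw [hS, hQ]; ring
  have hzt' := le_sqrt_mul hS0 hR he hzt
  have hpz : ∀ (w : L2I) (n : ℕ), |pairing w (psi1 a b s n)| ≤ ‖w‖ * (C * (1 / ((n : ℝ) + 1))) := by
    intro w n
    refine (abs_pairing_le w (continuous_psi1 a b s n)).trans ?_
    rw [mul_one_div]
    gcongr; exact hpsi n
  have hyt : ‖y t‖ ^ 2 ≤ e ^ 2 * ((2 + 2 * D ^ 2 * Q) * R ^ 2) := by
    have h3 := (tsum_sq_le_of_decay (f := fun n => pairing (y t) (phi1 n)) (D := D * R) (e := e)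
      (hasSum_sq_phi1 (y 0)).summable ((hasSum_sq_phi1 (y 0)).tsum_eq.le.trans hy2)
      (fun n => ?_)).2
    · rw [(hasSum_sq_phi1 (y t)).tsum_eq] at h3
      refine h3.trans_eq ?_
      rw [hQ]; ring
    · set w : ℝ := 1 / ((n : ℝ) + 1) with hw
      have hw0 : 0 ≤ w := by positivity
      have e1 : pairing (y t) (phi1 n)
          = coord1 a b s y z n t - pairing (z t) (psi1 a b s n) := by simp only [coord1]; ring
      have e2 : |coord1 a b s y z n 0| ≤ |pairing (y 0) (phi1 n)| + R * (C * w) :=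
        (abs_add_le _ _).trans (add_le_add le_rfl ((hpz (z 0) n).trans (by gcongr)))
      have e3 : |pairing (z t) (psi1 a b s n)| ≤ e * (Real.sqrt S * R) * (C * w) :=
        (hpz (z t) n).trans (by gcongr)
      have e4 : K * R * (1 / ((n : ℝ) + 1) ^ 2) ≤ K * R * w := by
        gcongr; exact one_div_sq_le n
      rw [e1]
      refine (abs_sub _ _).trans ((add_le_add (h1 n) e3).trans ?_)
      have e5 := mul_le_mul_of_nonneg_left (add_le_add e2 e4) he
      rw [hD]
      linarith
  linarith

/-- The coefficients are multiplied by the frequencies, which turns the control response `1/(n+1)²`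
into `1/(n+1)`, still square summable. The order matters: `z t` must be known to lie in `H¹` before
`exists_pairing_psi1_le` can be applied to it in the estimate of `y t`. -/
theorem exists_H1_decay {a b : ℝ} (s : ℝ) {N₀ : ℕ} (hΔ : ∀ n m, (n, m) ∈ Delta a b → n ≤ N₀)
    {K : ℝ} (hK : 0 ≤ K) :
    ∃ C, 0 ≤ C ∧ ∀ (y z : ℝ → L2I) (R t e r₀ : ℝ), 0 ≤ e → 0 ≤ R →
      HasH1NormSq (y 0) (z 0) r₀ → r₀ ≤ R ^ 2 → ‖z t‖ ^ 2 ≤ e ^ 2 * (K * R ^ 2) →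
      (∀ n, |coord1 a b s y z n t| ≤ e *
        (|coord1 a b s y z n 0| + K * R * (1 / ((n : ℝ) + 1) ^ 2))) →
      (∀ m, |coord2 z m t| ≤ e * (|coord2 z m 0| + K * R * (1 / ((m : ℝ) + 1) ^ 2))) →
      ∃ r, HasH1NormSq (y t) (z t) r ∧ r ≤ e ^ 2 * (C * R ^ 2) := by
  obtain ⟨C, hC, hpsi⟩ := exists_pairing_psi1_le s hΔ
  set Q : ℝ := ∑' n : ℕ, 1 / ((n : ℝ) + 1) ^ 2 with hQ
  have hQ0 : 0 ≤ Q := tsum_nonneg fun n => by positivity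
  set S := 2 + 2 * (4 * K) ^ 2 * Q with hS
  have hS0 : 0 ≤ S := by positivity
  -- The factor 4 comes from `freq1 n ≤ 4 (n + 1)`; `2 * C` accounts for `‖z 0‖ + ‖dz‖ ≤ 2 R`.
  set D := 4 * (K + C * (Real.sqrt K + Real.sqrt S) + 2 * C) with hD
  have hD0 : 0 ≤ D := by positivity
  refine ⟨(2 + 2 * D ^ 2 * Q) + K + S, by positivity,
    fun y z R t e r₀ he hR hH hr hz h1 h2 => ?_⟩
  obtain ⟨Y, Z, dy, dz, hY, hY1, hZ, hr₀⟩ := hH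
  have b1 := sq_nonneg ‖dy‖
  have b2 := sq_nonneg ‖z 0‖
  have b3 := sq_nonneg ‖dz‖
  have hdy2 : ‖dy‖ ^ 2 ≤ R ^ 2 := by linarith
  have hz02 : ‖z 0‖ ^ 2 ≤ R ^ 2 := by linarith
  have hdz2 : ‖dz‖ ^ 2 ≤ R ^ 2 := by linarith
  have hz0 : ‖z 0‖ ≤ R := (abs_le_of_sq_le_sq' hz02 hR).2
  have hdz0 : ‖dz‖ ≤ R := (abs_le_of_sq_le_sq' hdz2 hR).2
  obtain ⟨sz, tz⟩ := hZ.summable_freq2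
  obtain ⟨sy, ty⟩ := hY.summable_freq1 hY1
  -- weighting by a frequency
  have hwt : ∀ (n : ℕ) (p : ℝ), 0 ≤ p → p ≤ 4 * ((n : ℝ) + 1) →
      p * (1 / ((n : ℝ) + 1) ^ 2) ≤ 4 * (1 / ((n : ℝ) + 1)) := by
    intro n p _ hp
    calc p * (1 / ((n : ℝ) + 1) ^ 2) ≤ 4 * ((n : ℝ) + 1) * (1 / ((n : ℝ) + 1) ^ 2) := by gcongr
      _ = _ := by field_simp
  obtain ⟨sz', tz'⟩ := tsum_sq_le_of_decay (f := fun m : ℕ => ((m : ℝ) * Real.pi) * pairing (z t) (psi2 m))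
    (D := 4 * K * R) (e := e) sz (tz.trans hdz2) (fun m => by
      have hp : 0 ≤ (m : ℝ) * Real.pi := by have := Real.pi_pos; positivity
      have hp4 : (m : ℝ) * Real.pi ≤ 4 * ((m : ℝ) + 1) := by
        have := Real.pi_le_four
        nlinarith [Nat.cast_nonneg (α := ℝ) m]
      have h3 := mul_le_mul_of_nonneg_left (h2 m) hp
      have h4 := mul_le_mul_of_nonneg_left (hwt m _ hp hp4) (show 0 ≤ e * (K * R) by positivity)
      rw [abs_mul ((m : ℝ) * Real.pi), abs_mul ((m : ℝ) * Real.pi), abs_of_nonneg hp]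
      simp only [coord2] at h3
      linarith)
  obtain ⟨Zt, dzt, hZt, hdzt⟩ := exists_isH1_of_summable_freq2 sz'
  have hdzt2 : ‖dzt‖ ^ 2 ≤ e ^ 2 * (S * R ^ 2) := by
    rw [hdzt]
    refine tz'.trans_eq ?_
    rw [hS, hQ]; ring
  have hzt' := le_sqrt_mul hK hR he hz
  have hdzt' := le_sqrt_mul hS0 hR he hdzt2
  obtain ⟨sy', ty'⟩ := tsum_sq_le_of_decay (f := fun n : ℕ => freq1 n * pairing (y t) (phi1 n))
    (D := D * R) (e := e) sy (ty.trans hdy2) (fun n => by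
      have hp := (freq1_pos n).le
      set w : ℝ := 1 / ((n : ℝ) + 1) ^ 2 with hw
      have hw0 : 0 ≤ w := by positivity
      have e1 : pairing (y t) (phi1 n)
          = coord1 a b s y z n t - pairing (z t) (psi1 a b s n) := by simp only [coord1]; ring
      have e2 : |coord1 a b s y z n 0| ≤ |pairing (y 0) (phi1 n)| + 2 * C * R * w := by
        refine (abs_add_le _ _).trans (add_le_add le_rfl ((hpsi n _ _ _ hZ).trans ?_))
        calc _ ≤ C / ((n : ℝ) + 1) ^ 2 * (R + R) := by gcongr
          _ = _ := by rw [hw]; ring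
      have e3 : |pairing (z t) (psi1 a b s n)|
          ≤ e * (C * (Real.sqrt K + Real.sqrt S) * R * w) := by
        refine (hpsi n _ _ _ hZt).trans ?_
        calc _ ≤ C / ((n : ℝ) + 1) ^ 2 * (e * (Real.sqrt K * R) + e * (Real.sqrt S * R)) := by gcongr
          _ = _ := by rw [hw]; ring
      have e4 : |pairing (y t) (phi1 n)| ≤ e * (|pairing (y 0) (phi1 n)|
          + (K + C * (Real.sqrt K + Real.sqrt S) + 2 * C) * R * w) := by
        rw [e1]
        refine (abs_sub _ _).trans ((add_le_add (h1 n) e3).trans ?_)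
        have e5 := mul_le_mul_of_nonneg_left e2 he
        linarith
      have e6 := mul_le_mul_of_nonneg_left e4 hp
      have e7 := mul_le_mul_of_nonneg_left (hwt n _ hp (freq1_le n))
        (show 0 ≤ e * ((K + C * (Real.sqrt K + Real.sqrt S) + 2 * C) * R) by positivity)
      rw [abs_mul, abs_mul, abs_of_nonneg hp, hD]
      linarith)
  obtain ⟨Yt, dyt, hYt, hYt1, hdyt⟩ := exists_isH1_of_summable_freq1 sy'
  refine ⟨_, ⟨Yt, Zt, dyt, dzt, hYt, hYt1, hZt, rfl⟩, ?_⟩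
  have hdyt2 : ‖dyt‖ ^ 2 ≤ e ^ 2 * ((2 + 2 * D ^ 2 * Q) * R ^ 2) := by
    rw [hdyt]
    refine ty'.trans_eq ?_
    rw [hQ]; ring
  linarith

/-- The Poincaré inequality in `{f ∈ H¹(0,1) | f(1) = 0}`. -/
theorem IsH1.norm_sq_le {f g : L2I} {F : ℝ → ℝ} (hf : IsH1 f F g) (h1 : F 1 = 0) :
    ‖f‖ ^ 2 ≤ ‖g‖ ^ 2 := by
  obtain ⟨h2, h3⟩ := hf.summable_freq1 h1
  refine le_trans ?_ h3
  rw [← (hasSum_sq_phi1 f).tsum_eq]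
  refine (hasSum_sq_phi1 f).summable.tsum_le_tsum (fun n => ?_) h2
  rw [mul_pow]
  refine le_mul_of_one_le_left (sq_nonneg _) (one_le_pow₀ ?_)
  linarith [add_one_le_freq1 n, Nat.cast_nonneg (α := ℝ) n]

theorem controllerNormSq_nonneg (N₀ M₀ N M : ℕ) (u : ℝ → ℝ) (X : ℝ → Idx N₀ M₀ → ℝ)
    (x1 x2 : ℕ → ℝ → ℝ) (t : ℝ) : 0 ≤ controllerNormSq N₀ M₀ N M u X x1 x2 t := by
  unfold controllerNormSq; positivity

end HeatCascade

/-! ### The stability theorem -/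

theorem theorem2 (a b s : ℝ) (hs : s ≠ 0) (c : HeatCascade.L2I) (δ : ℝ) (hδ : 0 < δ)
    (N₀ M₀ : ℕ)
    (hN₀ : HeatCascade.lam1 a (N₀ + 1) < -δ)
    (hM₀ : HeatCascade.lam2 b (M₀ + 1) < -δ)
    (hΔ : ∀ n m : ℕ, (n, m) ∈ HeatCascade.Delta a b → n ≤ N₀ ∧ m ≤ M₀)
    -- controllability assumption
    (hctrl : ∀ n : ℕ, n ≤ N₀ → n ∉ HeatCascade.Theta a b)
    -- observability assumption
    (hobs₁ : ∀ n : ℕ, n ≤ N₀ → HeatCascade.c1 c n ≠ 0)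
    (hobs₂ : ∀ m : ℕ, m ≤ M₀ → (¬ ∃ n : ℕ, (n, m) ∈ HeatCascade.Delta a b) →
      HeatCascade.c2 a b s c m ≠ 0)
    -- the gains
    (Kx : HeatCascade.Idx N₀ M₀ → ℝ) (ku : ℝ) (L : HeatCascade.Idx N₀ M₀ → ℝ)
    (hK : HeatCascade.SpectralAbscissaLT
      (HeatCascade.A₁a a b s N₀ M₀
        - Matrix.vecMulVec (HeatCascade.B₁a a b s N₀ M₀) (Sum.elim Kx (fun _ : Unit => ku))) δ)
    (hL : HeatCascade.SpectralAbscissaLT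
      (HeatCascade.A₁ a b s N₀ M₀
        - Matrix.vecMulVec L (HeatCascade.C₁ a b s c N₀ M₀)) δ) :
    ∃ N₁ M₁ : ℕ, ∀ N M : ℕ, N₀ ≤ N → N₁ ≤ N → M₀ ≤ M → M₁ ≤ M →
      ∃ C : ℝ, 0 < C ∧
        ∀ (y z : ℝ → HeatCascade.L2I) (u v : ℝ → ℝ) (X : ℝ → HeatCascade.Idx N₀ M₀ → ℝ)
          (x1 x2 : ℕ → ℝ → ℝ),
          HeatCascade.IsClosedLoopSolution a b s c N₀ M₀ N M Kx ku L y z u v X x1 x2 →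
          -- decay in the norm of L² × L²
          (∀ t : ℝ, 0 ≤ t →
            (‖y t‖ ^ 2 + ‖z t‖ ^ 2) + HeatCascade.controllerNormSq N₀ M₀ N M u X x1 x2 t
              ≤ C * Real.exp (-2 * δ * t) *
                ((‖y 0‖ ^ 2 + ‖z 0‖ ^ 2) + HeatCascade.controllerNormSq N₀ M₀ N M u X x1 x2 0)) ∧
          -- decay in the norm of H¹ × H¹ for compatible initial data
          (HeatCascade.CompatibleH2 s (y 0) (z 0) (u 0) →
            ∀ r₀ : ℝ, HeatCascade.HasH1NormSq (y 0) (z 0) r₀ →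
              ∀ t : ℝ, 0 ≤ t → ∃ r : ℝ, HeatCascade.HasH1NormSq (y t) (z t) r ∧
                r + HeatCascade.controllerNormSq N₀ M₀ N M u X x1 x2 t
                  ≤ C * Real.exp (-2 * δ * t) *
                    (r₀ + HeatCascade.controllerNormSq N₀ M₀ N M u X x1 x2 0)) := by

  have hΔ1 : ∀ n m : ℕ, (n, m) ∈ HeatCascade.Delta a b → n ≤ N₀ := fun n m h => (hΔ n m h).1
  obtain ⟨N₁, M₁, hmain⟩ := HeatCascade.exists_modal_decay hδ hN₀ hM₀ hΔ hK hL
  refine ⟨N₁, M₁, fun N M hNN hN hMM hM => ?_⟩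
  obtain ⟨K, hK0, hdec⟩ := hmain N M hNN hN hMM hM
  obtain ⟨C2, hC2, hL2⟩ := HeatCascade.exists_L2_decay s hΔ1 hK0
  -- In `exists_H1_decay` a single constant has to dominate both the modal bound `K` and the `L²`
  -- bound `C2` on `z t`.
  obtain ⟨C1, hC1, hH1⟩ := HeatCascade.exists_H1_decay s hΔ1 (add_nonneg hK0 hC2)
  refine ⟨C1 + C2 + K + 1, by positivity, fun y z u v X x1 x2 hsol => ?_⟩
  have hexp : ∀ t : ℝ, Real.exp (-2 * δ * t) = Real.exp (-δ * t) ^ 2 := by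
    intro t
    rw [← Real.exp_nat_mul]; congr 1; push_cast; ring
  have hc0 := HeatCascade.controllerNormSq_nonneg N₀ M₀ N M u X x1 x2 0
  refine ⟨fun t ht => ?_, fun _ r₀ hr₀ t ht => ?_⟩
  · set E := (‖y 0‖ ^ 2 + ‖z 0‖ ^ 2) + HeatCascade.controllerNormSq N₀ M₀ N M u X x1 x2 0 with hE
    have hE0 : 0 ≤ E := by positivity
    have hsq : Real.sqrt E ^ 2 = E := Real.sq_sqrt hE0
    obtain ⟨hy0, hz0, -⟩ := HeatCascade.initial_bounds (Real.sqrt_nonneg E) (hsq.symm ▸ hE.ge)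
    obtain ⟨d1, d2, d3⟩ := hdec y z u v X x1 x2 hsol _ (Real.sqrt_nonneg E) (hsq.symm ▸ hE.ge) t ht
    have h2 := hL2 y z _ t _ (Real.exp_pos _).le (Real.sqrt_nonneg E) hy0 hz0 d2 d3
    rw [hsq] at h2 d1
    rw [hexp]
    have h3 : 0 ≤ (C1 + 1) * (Real.exp (-δ * t) ^ 2 * E) := by positivity
    linarith
  · have hr := hr₀
    obtain ⟨Y, Z, dy, dz, hY, hY1, hZ, hreq⟩ := hr
    -- The `H¹` energy does not contain `‖y 0‖`; the Poincaré inequality supplies it, so that the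
    -- modal and `L²` estimates apply with the `H¹` energy as initial size.
    have hpoin := hY.norm_sq_le hY1
    have hr0 : 0 ≤ r₀ := by rw [hreq]; positivity
    set E := r₀ + HeatCascade.controllerNormSq N₀ M₀ N M u X x1 x2 0 with hE
    have hE0 : 0 ≤ E := by positivity
    have hsq : Real.sqrt E ^ 2 = E := Real.sq_sqrt hE0
    have hinit : ‖y 0‖ ^ 2 + ‖z 0‖ ^ 2 + HeatCascade.controllerNormSq N₀ M₀ N M u X x1 x2 0
        ≤ Real.sqrt E ^ 2 := by
      rw [hsq, hE, hreq]
      linarith [sq_nonneg ‖dz‖]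
    obtain ⟨hy0, hz0, -⟩ := HeatCascade.initial_bounds (Real.sqrt_nonneg E) hinit
    obtain ⟨d1, d2, d3⟩ := hdec y z u v X x1 x2 hsol _ (Real.sqrt_nonneg E) hinit t ht
    have h2 := hL2 y z _ t _ (Real.exp_pos _).le (Real.sqrt_nonneg E) hy0 hz0 d2 d3
    have hmono : K * Real.sqrt E ≤ (K + C2) * Real.sqrt E := by gcongr; linarith
    obtain ⟨r, hr1, hr2⟩ := hH1 y z (Real.sqrt E) t (Real.exp (-δ * t)) r₀ (Real.exp_pos _).le
      (Real.sqrt_nonneg E) hr₀ (by rw [hsq]; linarith)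
      (by
        have : 0 ≤ Real.exp (-δ * t) ^ 2 * (K * Real.sqrt E ^ 2) := by positivity
        linarith [sq_nonneg ‖y t‖])
      (fun n => (d2 n).trans (by gcongr)) (fun m => (d3 m).trans (by gcongr))
    refine ⟨r, hr1, ?_⟩
    rw [hsq] at d1 hr2
    rw [hexp]
    have h3 : 0 ≤ (C2 + 1) * (Real.exp (-δ * t) ^ 2 * E) := by positivity
    linarith
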